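/- **Setting.** All manifolds and maps are $C^\infty$. Let $G$ be a Lie group with Lie algebra $\mathfrak g$ and a bi-invariant Riemannian metric (for instance $G$ compact), $H\subset G$ a closed subgroup with Lie algebra $\mathfrak h$, $\mathfrak g=\mathfrak h\oplus\mathfrak h^\perp$ the orthogonal decomposition, $X=G/H$, and $\varphi:M\to X$ a smooth map from a manifold $M$. For $x=gH\in X$ let $H_x=gHg^{-1}$ be the isotropy group of $x$ and $\mathfrak h_x=\mathrm{Ad}_*(g)\mathfrak h$ its Lie algebra. The coset bundle is $\varphi^*G=\{(m,g)\in M\times G:\varphi(m)=gH\}$, a principal $H$-bundle over $M$ under $(m,g)\cdot h=(m,gh)$, with projection $\pi_1:\varphi^*G\to M$ and second coordinate $g:\varphi^*G\to G$. Put $H_\varphi=\{(m,\gamma)\in M\times G:\gamma\varphi(m)=\varphi(m)\}$, $\mathfrak h_\varphi=\{(m,\xi)\in M\times\mathfrak g:\xi\in\mathfrak h_{\varphi(m)}\}$, and let $\mathrm{Stab}_\varphi$ be the group of smooth maps $w:M\to G$ with $w\varphi=\varphi$, i.e. of sections of $H_\varphi$. Let $\mathrm{Ad}(\varphi^*G)=\varphi^*G\times_{\mathrm{Ad}}H$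 and $\mathrm{Ad}_*(\varphi^*G)=\varphi^*G\times_{\mathrm{Ad}_*}\mathfrak h$. All these spaces carry their standard smooth structures. For $1$-forms $\alpha,\beta$ with values in $\mathfrak g$ let $[\alpha,\beta](u,v)=[\alpha(u),\beta(v)]-[\alpha(v),\beta(u)]$ (that is, $\alpha\wedge\beta+\beta\wedge\alpha$ in a matrix representation) and $\alpha\wedge\alpha=\tfrac12[\alpha,\alpha]$. A superscript $\parallel$ on a $\mathfrak g$-valued form on $M$ denotes the pointwise orthogonal projection onto $\mathfrak h_{\varphi(m)}$. The coisotropy form $\omega^\perp$ is the $\mathfrak g$-valued $1$-form on $X$ with $\pi^*\omega^\perp=\mathrm{Ad}_*(g)\,\mathrm{pr}_{\mathfrak h^\perp}(g^{-1}dg)$, where $\pi:G\to X$ is the quotient map. A connection on $\varphi^*G$ is a smooth $\mathfrak h$-valued $1$-form $B$ on $\varphi^*G$ that equals $g^{-1}dg$ on vertical vectors and satisfies $R_h^*B=\mathrm{Ad}_*(h^{-1})B$ for $h\in H$. Its (untwisted) gauge potential is the smooth $\mathfrak g$-valued $1$-form $b$ on $M$ with $\pi_1^*b=\mathrm{Ad}_*(g)\bigl(B-\mathrm{pr}_{\mathfrak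 h}(g^{-1}dg)\bigr)$, and its curvature potential is the smooth $\mathfrak g$-valued $2$-form $F(b)$ on $M$ with $\pi_1^*F(b)=\mathrm{Ad}_*(g)(dB+B\wedge B)$. For $w\in\mathrm{Stab}_\varphi$ let $f_w:\varphi^*G\to\varphi^*G$, $f_w(m,g)=(m,w(m)g)$, and let $b^w$ be the gauge potential of $f_w^*B$. **Theorem 2.1.** The form $\omega^\perp$ exists, is unique and is smooth. Moreover: 1. The map $[(m,g),\lambda]\mapsto(m,g\lambda g^{-1})$ is a well-defined diffeomorphism $\mathrm{Ad}(\varphi^*G)\cong H_\varphi$ over $M$. It identifies the smooth sections of $\mathrm{Ad}(\varphi^*G)$ with the elements of $\mathrm{Stab}_\varphi$; the gauge transformation $p\mapsto p\lambda$ given by the section $\pi_1(p)\mapsto[p,\lambda]$ that corresponds to $w$ is $f_w$; and $w\mapsto f_w$ is an isomorphism from $\mathrm{Stab}_\varphi$ onto the gauge group of $\varphi^*G$ (the $H$-equivariant diffeomorphisms of $\varphi^*G$ that cover $\mathrm{id}_M$). 2. The map $[(m,g),\xi]\mapsto(m,\mathrm{Ad}_*(g)\xi)$ is a well-defined diffeomorphism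 $\mathrm{Ad}_*(\varphi^*G)\cong\mathfrak h_\varphi$ over $M$. For every $k\ge 0$ it induces a bijection between the smooth $\mathrm{Ad}_*(\varphi^*G)$-valued $k$-forms on $M$ and the smooth $\mathfrak g$-valued $k$-forms on $M$ with values in $\mathfrak h_\varphi$. For every connection $B$ the forms $B-\mathrm{pr}_{\mathfrak h}(g^{-1}dg)$ and $dB+B\wedge B$ descend to unique smooth $\mathrm{Ad}_*(\varphi^*G)$-valued forms on $M$ (the twisted potential and curvature), and these correspond to $b$ and $F(b)$. 3. Every connection $B$ has a unique gauge potential $b$ and a unique curvature potential $F(b)$; both take values in $\mathfrak h_\varphi$. Conversely, every smooth $\mathfrak h_\varphi$-valued $1$-form on $M$ is the gauge potential of a unique connection. 4. For every connection $B$ with gauge potential $b$ and every $w\in\mathrm{Stab}_\varphi$, the form $f_w^*B$ is a connection, and $$b^w=\mathrm{Ad}_*(w^{-1})b+w^{-1}dw-(\mathrm{Ad}_*(w^{-1})-I)\varphi^*\omega^\perp,$$ $$F(b^w)=\mathrm{Ad}_*(w^{-1})F(b),$$ $$F(b)=db+b\wedge b-[b,\varphi^*\omega^\perp]-(\varphi^*\omega^\perp\wedge\varphi^*\omega^\perp)^{\parallel}.$$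 -/

import Mathlib

open scoped Manifold ContDiff Topology
open Manifold

noncomputable section

namespace CosetGauge

/-! ### Differential forms on manifolds

`M` is a smooth manifold without boundary modelled on the normed space `E`, and `V` is the normed
space of values. -/

section Forms

variable {E : Type*} [NormedAddCommGroup E] [NormedSpace ℝ E]
  {M : Type*} [TopologicalSpace M] [ChartedSpace E M]
  {E' : Type*} [NormedAddCommGroup E'] [NormedSpace ℝ E']
  {N : Type*} [TopologicalSpace N] [ChartedSpace E' N]
  {V : Type*} [NormedAddCommGroup V] [NormedSpace ℝ V]

variable (E M V) in
/-- Not necessarily smooth `V`-valued differential `k`-forms on `M`. -/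
abbrev DForm (k : ℕ) : Type _ := ∀ m : M, TangentSpace 𝓘(ℝ, E) m [⋀^Fin k]→L[ℝ] V

/-- The form `α` read in the preferred chart at `m₀`, i.e. its pullback to the model space under
the inverse of that chart. -/
def formInChart {k : ℕ} (α : DForm E M V k) (m₀ : M) (y : E) : E [⋀^Fin k]→L[ℝ] V :=
  (α ((extChartAt 𝓘(ℝ, E) m₀).symm y)).compContinuousLinearMap
    (mfderiv 𝓘(ℝ, E) 𝓘(ℝ, E) (extChartAt 𝓘(ℝ, E) m₀).symm y)

/-- Smooth differential forms: smooth in every chart. -/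
def IsSmoothForm {k : ℕ} (α : DForm E M V k) : Prop :=
  ∀ m₀ : M, ContDiffOn ℝ ∞ (formInChart α m₀) (extChartAt 𝓘(ℝ, E) m₀).target

/-- The exterior derivative: `(dα)_m` is the exterior derivative of `α` read in the chart at `m`,
transported back to the tangent space at `m`. -/
def extD {k : ℕ} (α : DForm E M V k) : DForm E M V (k + 1) := fun m =>
  (extDeriv (formInChart α m) (extChartAt 𝓘(ℝ, E) m m)).compContinuousLinearMap
    (mfderiv 𝓘(ℝ, E) 𝓘(ℝ, E) (extChartAt 𝓘(ℝ, E) m) m)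

/-- The pullback `f^*α` of a form. -/
def pullback {k : ℕ} (f : M → N) (α : DForm E' N V k) : DForm E M V k := fun m =>
  (α (f m)).compContinuousLinearMap (mfderiv 𝓘(ℝ, E) 𝓘(ℝ, E') f m)

end Forms

/-! ### Lie groups

A Lie group `G` is modelled on the normed space `𝔤`.  In Mathlib the tangent space `T_1 G`, i.e. the
Lie algebra `GroupLieAlgebra 𝓘(ℝ, 𝔤) G`, has by definition the underlying vector space `𝔤`, and we
use `𝔤` (which carries a norm, needed to speak of smooth `𝔤`-valued maps) for it. -/

section LieGroups

variable {𝔤 : Type*} [NormedAddCommGroup 𝔤] [NormedSpace ℝ 𝔤]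
  {G : Type*} [TopologicalSpace G] [ChartedSpace 𝔤 G] [Group G]

/-- The adjoint action `Ad_*(g)` of `G` on its Lie algebra: the differential at `1` of
`x ↦ g x g⁻¹`. -/
def Ad (g : G) : 𝔤 →L[ℝ] 𝔤 :=
  mfderiv 𝓘(ℝ, 𝔤) 𝓘(ℝ, 𝔤) (fun x : G => g * x * g⁻¹) 1

/-- The left-invariant Maurer-Cartan form `g⁻¹dg` at the point `g`. -/
def maurerCartan (g : G) : TangentSpace 𝓘(ℝ, 𝔤) g →L[ℝ] 𝔤 :=
  mfderiv 𝓘(ℝ, 𝔤) 𝓘(ℝ, 𝔤) (fun x : G => g⁻¹ * x) g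

variable (G) in
/-- The Lie bracket of the Lie algebra of `G`. -/
def lieBr (ξ η : 𝔤) : 𝔤 :=
  Bracket.bracket (L := GroupLieAlgebra 𝓘(ℝ, 𝔤) G) (M := GroupLieAlgebra 𝓘(ℝ, 𝔤) G) ξ η

section Wedge

variable {E : Type*} [NormedAddCommGroup E] [NormedSpace ℝ E]
  {M : Type*} [TopologicalSpace M] [ChartedSpace E M]

variable (G) in
/-- The graded commutator `[α, β]` of two `𝔤`-valued `1`-forms (in a matrix representation
`α ∧ β + β ∧ α`). -/
def bracketForm (α β : DForm E M 𝔤 1) (m : M) (v : Fin 2 → TangentSpace 𝓘(ℝ, E) m) : 𝔤 :=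
  lieBr G (α m ![v 0]) (β m ![v 1]) - lieBr G (α m ![v 1]) (β m ![v 0])

variable (G) in
/-- The wedge square `α ∧ α = 1/2 [α, α]` of a `𝔤`-valued `1`-form. -/
def wedgeSq (α : DForm E M 𝔤 1) (m : M) (v : Fin 2 → TangentSpace 𝓘(ℝ, E) m) : 𝔤 :=
  (1 / 2 : ℝ) • bracketForm G α α m v

/-- The `𝔤`-valued `1`-form `w⁻¹dw` of a map `w : M → G`. -/
def logDeriv (w : M → G) (m : M) : TangentSpace 𝓘(ℝ, E) m →L[ℝ] 𝔤 :=
  (maurerCartan (w m)).comp (mfderiv 𝓘(ℝ, E) 𝓘(ℝ, 𝔤) w m)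

end Wedge


/-! ### The Lie algebra of a subgroup and the bi-invariant metric -/

section Subgroup

/-- The Lie algebra `𝔥` of a (closed) subgroup `H` of `G`: the velocities at `1` of smooth curves
through `1` in `G` that stay in `H`. -/
def lieAlgOf [LieGroup 𝓘(ℝ, 𝔤) ∞ G] (H : Subgroup G) : Submodule ℝ 𝔤 where
  carrier := {ξ | ∃ γ : ℝ → G, ContMDiffAt 𝓘(ℝ, ℝ) 𝓘(ℝ, 𝔤) ∞ γ 0 ∧ γ 0 = 1 ∧
    (∀ᶠ t in 𝓝 (0 : ℝ), γ t ∈ H) ∧ (mfderiv 𝓘(ℝ, ℝ) 𝓘(ℝ, 𝔤) γ 0 : ℝ →L[ℝ] 𝔤) 1 = ξ}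
  zero_mem' := by
    refine ⟨fun _ => 1, contMDiffAt_const, rfl, Filter.Eventually.of_forall fun _ => H.one_mem, ?_⟩
    rw [mfderiv_const]
    rfl
  add_mem' := by
    rintro _ _ ⟨γ, hγ, h1, hH, rfl⟩ ⟨δ, hδ, k1, kH, rfl⟩
    have hm : ContMDiff (𝓘(ℝ, 𝔤).prod 𝓘(ℝ, 𝔤)) 𝓘(ℝ, 𝔤) ∞ (fun p : G × G => p.1 * p.2) :=
      contMDiff_mul _ _
    refine ⟨fun t => γ t * δ t, ?_, by simp [h1, k1], ?_, ?_⟩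
    · exact hm.contMDiffAt.comp (0 : ℝ) (hγ.prodMk hδ)
    · filter_upwards [hH, kH] with t h k using H.mul_mem h k
    · have dγ := hγ.mdifferentiableAt (by simp)
      have dδ := hδ.mdifferentiableAt (by simp)
      have dm : MDifferentiableAt (𝓘(ℝ, 𝔤).prod 𝓘(ℝ, 𝔤)) 𝓘(ℝ, 𝔤) (fun p : G × G => p.1 * p.2)
        (γ 0, δ 0) := hm.mdifferentiableAt (by simp)
      have hc := mfderiv_comp (I' := 𝓘(ℝ, 𝔤).prod 𝓘(ℝ, 𝔤)) (0 : ℝ) dm (dγ.prodMk dδ)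
      have key : ∀ u v : 𝔤, (mfderiv (𝓘(ℝ, 𝔤).prod 𝓘(ℝ, 𝔤)) 𝓘(ℝ, 𝔤)
          (fun p : G × G => p.1 * p.2) (γ 0, δ 0) : 𝔤 × 𝔤 →L[ℝ] 𝔤) (u, v) = u + v := by
        intro u v
        have := mfderiv_prod_eq_add_apply (v := (u, v)) dm
        refine this.trans ?_
        have hid : ∀ (f : G → G) (x : G) (u : 𝔤), f = id →
            (mfderiv 𝓘(ℝ, 𝔤) 𝓘(ℝ, 𝔤) f x : 𝔤 →L[ℝ] 𝔤) u = u := by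
          rintro f x u rfl
          rw [mfderiv_id]
          rfl
        exact congrArg₂ (· + ·) (hid _ _ u (by ext z; simp [k1])) (hid _ _ v (by ext z; simp [h1]))
      have e := mfderiv_prodMk dγ dδ
      change (mfderiv 𝓘(ℝ, ℝ) 𝓘(ℝ, 𝔤) ((fun p : G × G => p.1 * p.2) ∘ fun t => (γ t, δ t)) 0 :
        ℝ →L[ℝ] 𝔤) 1 = _
      rw [hc, e]
      exact key _ _
  smul_mem' := by
    rintro c _ ⟨γ, hγ, h1, hH, rfl⟩
    have hs : ContMDiff 𝓘(ℝ, ℝ) 𝓘(ℝ, ℝ) ∞ (fun t : ℝ => c * t) :=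
      (contDiff_const.mul contDiff_id).contMDiff
    have h0 : c * (0 : ℝ) = 0 := mul_zero c
    refine ⟨fun t => γ (c * t), ?_, by simp [h1], ?_, ?_⟩
    · exact ContMDiffAt.comp (0 : ℝ) (by rw [h0]; exact hγ) hs.contMDiffAt
    · have ht : Filter.Tendsto (fun t : ℝ => c * t) (𝓝 0) (𝓝 0) := by
        have := (continuous_const_mul c).tendsto (0 : ℝ)
        rwa [h0] at this
      exact ht.eventually hH
    · have dγ := hγ.mdifferentiableAt (by simp)
      have dc : HasFDerivAt (fun t : ℝ => c * t) (c • ContinuousLinearMap.id ℝ ℝ) 0 :=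
        (hasFDerivAt_id (0 : ℝ)).const_mul c
      have dγ' : HasMFDerivAt 𝓘(ℝ, ℝ) 𝓘(ℝ, 𝔤) γ (c * 0) (mfderiv 𝓘(ℝ, ℝ) 𝓘(ℝ, 𝔤) γ 0) := by
        rw [h0]; exact dγ.hasMFDerivAt
      have hc := (dγ'.comp (0 : ℝ) dc.hasMFDerivAt).mfderiv
      change (mfderiv 𝓘(ℝ, ℝ) 𝓘(ℝ, 𝔤) (γ ∘ fun t => c * t) 0 : ℝ →L[ℝ] 𝔤) 1 = _
      rw [hc]
      exact map_smul (mfderiv 𝓘(ℝ, ℝ) 𝓘(ℝ, 𝔤) γ 0 : ℝ →L[ℝ] 𝔤) c (1 : ℝ)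

variable [LieGroup 𝓘(ℝ, 𝔤) ∞ G]

variable (𝔤 G) in
/-- A smooth Riemannian metric on the Lie group `G`. -/
abbrev GroupMetric : Type _ :=
  Bundle.ContMDiffRiemannianMetric 𝓘(ℝ, 𝔤) ∞ 𝔤 (fun g : G => TangentSpace 𝓘(ℝ, 𝔤) g)

/-- Bi-invariance of a metric: left and right translations are isometries. -/
def IsBiinvariant (ρ : GroupMetric 𝔤 G) : Prop :=
  (∀ (a g : G) (u v : TangentSpace 𝓘(ℝ, 𝔤) g),
    ρ.inner (a * g) (mfderiv 𝓘(ℝ, 𝔤) 𝓘(ℝ, 𝔤) (fun x : G => a * x) g u)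
      (mfderiv 𝓘(ℝ, 𝔤) 𝓘(ℝ, 𝔤) (fun x : G => a * x) g v) = ρ.inner g u v) ∧
  (∀ (a g : G) (u v : TangentSpace 𝓘(ℝ, 𝔤) g),
    ρ.inner (g * a) (mfderiv 𝓘(ℝ, 𝔤) 𝓘(ℝ, 𝔤) (fun x : G => x * a) g u)
      (mfderiv 𝓘(ℝ, 𝔤) 𝓘(ℝ, 𝔤) (fun x : G => x * a) g v) = ρ.inner g u v)

/-- The inner product on the Lie algebra `𝔤 = T_1 G` induced by a metric on `G`. -/
def innerOne (ρ : GroupMetric 𝔤 G) : LinearMap.BilinForm ℝ 𝔤 :=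
  ContinuousLinearMap.toLinearMap₁₂ (ρ.inner 1 : 𝔤 →L[ℝ] 𝔤 →L[ℝ] ℝ)

theorem isCompl_orthogonal [FiniteDimensional ℝ 𝔤] (ρ : GroupMetric 𝔤 G) (W : Submodule ℝ 𝔤) :
    IsCompl W ((innerOne ρ).orthogonal W) := by
  have hs : ∀ ξ η, innerOne ρ ξ η = innerOne ρ η ξ := fun ξ η => ρ.symm 1 ξ η
  have hr : (innerOne ρ).IsRefl := fun ξ η h => by rw [hs]; exact h
  rw [LinearMap.BilinForm.isCompl_orthogonal_iff_disjoint hr, Submodule.disjoint_def]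
  intro ξ hξ hξ'
  by_contra h
  exact (ρ.pos 1 ξ h).ne' (hξ' ξ hξ)

/-- The orthogonal projection `pr_W` of `𝔤` onto a subspace `W`. -/
def prOn [FiniteDimensional ℝ 𝔤] (ρ : GroupMetric 𝔤 G) (W : Submodule ℝ 𝔤) : 𝔤 →ₗ[ℝ] 𝔤 :=
  W.projection ((innerOne ρ).orthogonal W) (isCompl_orthogonal ρ W)

end Subgroup

/-! ### The homogeneous space `X = G/H`, the coset bundle and the isotropy subbundles -/

section Coset

variable [LieGroup 𝓘(ℝ, 𝔤) ∞ G] (H : Subgroup G)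

/-- The isotropy subalgebra `𝔥_x = Ad_*(g) 𝔥`, `x = gH`, of a point `x ∈ G/H`
(`Ad_*(g) 𝔥` does not depend on the representative `g` of `x`). -/
def isotropyAlgebra (x : G ⧸ H) : Submodule ℝ 𝔤 where
  carrier := {ξ | ∀ g : G, (g : G ⧸ H) = x → Ad g⁻¹ ξ ∈ lieAlgOf (𝔤 := 𝔤) H}
  zero_mem' := fun g _ => by rw [map_zero]; exact Submodule.zero_mem _
  add_mem' := fun {ξ η} hξ hη g hg => by
    rw [map_add]; exact Submodule.add_mem _ (hξ g hg) (hη g hg)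
  smul_mem' := fun c ξ hξ g hg => by
    rw [map_smul]; exact Submodule.smul_mem _ c (hξ g hg)

variable {H}
variable {EX : Type*} [NormedAddCommGroup EX] [NormedSpace ℝ EX] [ChartedSpace EX (G ⧸ H)]

/-- `θ` is the coisotropy form `ω^⊥` of `X = G/H`, i.e. the `𝔤`-valued `1`-form on `X` with
`π^* ω^⊥ = Ad_*(g) pr_{𝔥^⊥}(g⁻¹dg)`, where `π : G → X` is the quotient map. -/
def IsCoisotropyForm [FiniteDimensional ℝ 𝔤] (ρ : GroupMetric 𝔤 G)
    (θ : DForm EX (G ⧸ H) 𝔤 1) : Prop :=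
  ∀ (g : G) (v : TangentSpace 𝓘(ℝ, 𝔤) g),
    pullback (E := 𝔤) (QuotientGroup.mk : G → G ⧸ H) θ g ![v] =
      Ad g (maurerCartan g v - prOn ρ (lieAlgOf H) (maurerCartan g v))

variable {EM : Type*} [NormedAddCommGroup EM] [NormedSpace ℝ EM]
  {M : Type*} [TopologicalSpace M] [ChartedSpace EM M]

/-- The total space of the coset bundle `φ^*G = {(m, g) | φ(m) = gH}`, a subset of `M × G`. -/
def cosetBundle (φ : M → G ⧸ H) : Set (M × G) := {p | φ p.1 = (p.2 : G ⧸ H)}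

/-- The isotropy subbundle of groups `H_φ = {(m, γ) | γ ∈ H_{φ(m)}}` of `M × G`, where `H_x` is the
isotropy group of the point `x`. -/
def isotropyGroupBundle (φ : M → G ⧸ H) : Set (M × G) := {p | p.2 • φ p.1 = φ p.1}

/-- The isotropy subbundle of algebras `𝔥_φ = {(m, ξ) | ξ ∈ 𝔥_{φ(m)}}` of `M × 𝔤`. -/
def isotropyAlgebraBundle (φ : M → G ⧸ H) : Set (M × 𝔤) :=
  {p | p.2 ∈ isotropyAlgebra (𝔤 := 𝔤) H (φ p.1)}

variable {φ : M → G ⧸ H}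

/-- The bundle projection `φ^*G → M`. -/
def baseMap (p : cosetBundle φ) : M := p.1.1

/-- The second projection `φ^*G → G`, the "coordinate" `g` on `φ^*G ⊆ M × G`. -/
def groupCoord (p : cosetBundle φ) : G := p.1.2

/-- The principal right action `(m, g) · h = (m, g h)` of `H` on `φ^*G`. -/
def rightAct (h : H) (p : cosetBundle φ) : cosetBundle φ :=
  ⟨(p.1.1, p.1.2 * h), by
    have hp : φ p.1.1 = (p.1.2 : G ⧸ H) := p.2
    change φ p.1.1 = ((p.1.2 * h : G) : G ⧸ H)
    rw [hp, QuotientGroup.mk_mul_of_mem _ h.2]⟩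

/-- The bundle `Ad(φ^*G) = φ^*G ×_{Ad} H`: the quotient of `φ^*G × H` by
`(p, λ) ∼ (p h, h⁻¹ λ h)`. -/
def AdBundle (φ : M → G ⧸ H) : Type _ :=
  Quot (fun a b : cosetBundle φ × H => ∃ h : H, b.1 = rightAct h a.1 ∧ b.2 = h⁻¹ * a.2 * h)

instance : TopologicalSpace (AdBundle φ) :=
  inferInstanceAs (TopologicalSpace (Quot _))

/-- The class `[p, λ]` in `Ad(φ^*G)`. -/
def AdBundle.mk (a : cosetBundle φ × H) : AdBundle φ := Quot.mk _ a

/-- The bundle projection `Ad(φ^*G) → M`. -/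
def AdBundle.proj : AdBundle φ → M :=
  Quot.lift (fun a => baseMap a.1) (by rintro a b ⟨h, h1, -⟩; rw [h1]; rfl)

/-- The bundle `Ad_*(φ^*G) = φ^*G ×_{Ad_*} 𝔥`: the quotient of `φ^*G × 𝔥` by
`(p, ξ) ∼ (p h, Ad_*(h⁻¹) ξ)`. -/
def AdAlgBundle (φ : M → G ⧸ H) : Type _ :=
  Quot (fun a b : cosetBundle φ × lieAlgOf (𝔤 := 𝔤) H =>
    ∃ h : H, b.1 = rightAct h a.1 ∧ (b.2 : 𝔤) = Ad (h : G)⁻¹ (a.2 : 𝔤))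

instance : TopologicalSpace (AdAlgBundle (𝔤 := 𝔤) φ) :=
  inferInstanceAs (TopologicalSpace (Quot _))

/-- The class `[p, ξ]` in `Ad_*(φ^*G)`. -/
def AdAlgBundle.mk (a : cosetBundle φ × lieAlgOf (𝔤 := 𝔤) H) : AdAlgBundle (𝔤 := 𝔤) φ :=
  Quot.mk _ a

/-! ### Gauge transformations -/

variable (𝔤 EM) in
/-- The stabilizer `Stab_φ` of `φ`: the group of smooth maps `w : M → G` with `w φ = φ`, i.e. of
smooth sections of `H_φ`. -/
def stab (φ : M → G ⧸ H) : Subgroup (M → G) where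
  carrier := {w | ContMDiff 𝓘(ℝ, EM) 𝓘(ℝ, 𝔤) ∞ w ∧ ∀ m, w m • φ m = φ m}
  one_mem' := ⟨contMDiff_const, fun m => one_smul _ _⟩
  mul_mem' := by
    rintro a b ⟨ha, ha'⟩ ⟨hb, hb'⟩
    exact ⟨ha.mul hb, fun m => by rw [Pi.mul_apply, mul_smul, hb', ha']⟩
  inv_mem' := by
    rintro a ⟨ha, ha'⟩
    exact ⟨ha.inv, fun m => by rw [Pi.inv_apply, inv_smul_eq_iff, ha']⟩

/-- The map `f_w : φ^*G → φ^*G`, `f_w(m, g) = (m, w(m) g)`, for `w ∈ Stab_φ`. -/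
def gaugeMap (w : stab 𝔤 EM φ) (p : cosetBundle φ) : cosetBundle φ :=
  ⟨(p.1.1, w.1 p.1.1 * p.1.2), by
    have hp : φ p.1.1 = (p.1.2 : G ⧸ H) := p.2
    have hw := w.2.2 p.1.1
    rw [hp] at hw
    change φ p.1.1 = ((w.1 p.1.1 * p.1.2 : G) : G ⧸ H)
    rw [hp, ← hw]
    rfl⟩

section TotalSpace

variable {EP : Type*} [NormedAddCommGroup EP] [NormedSpace ℝ EP]
  [ChartedSpace EP (cosetBundle φ)]

variable (EP) in
/-- The gauge group of `φ^*G`: diffeomorphisms of the total space that cover the identity of `M` and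
commute with the right action of `H`. -/
def gaugeGroup (φ : M → G ⧸ H) [ChartedSpace EP (cosetBundle φ)] :
    Subgroup (Equiv.Perm (cosetBundle φ)) where
  carrier := {f | ContMDiff 𝓘(ℝ, EP) 𝓘(ℝ, EP) ∞ f ∧ ContMDiff 𝓘(ℝ, EP) 𝓘(ℝ, EP) ∞ f.symm ∧
    (∀ p, baseMap (f p) = baseMap p) ∧ ∀ h p, f (rightAct h p) = rightAct h (f p)}
  one_mem' := ⟨contMDiff_id, contMDiff_id, fun _ => rfl, fun _ _ => rfl⟩
  mul_mem' := by
    rintro a b ⟨ha, ha', ha1, ha2⟩ ⟨hb, hb', hb1, hb2⟩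
    exact ⟨ha.comp hb, hb'.comp ha', fun p => (ha1 _).trans (hb1 p), fun h p => by
      simp only [Equiv.Perm.coe_mul, Function.comp_apply, hb2, ha2]⟩
  inv_mem' := by
    rintro a ⟨ha, ha', ha1, ha2⟩
    refine ⟨ha', ha, fun p => ?_, fun h p => ?_⟩
    · have := ha1 (a.symm p)
      rw [a.apply_symm_apply] at this
      exact this.symm
    · change a.symm (rightAct h p) = rightAct h (a.symm p)
      rw [Equiv.symm_apply_eq, ha2, a.apply_symm_apply]

/-! ### Connections, potentials and curvature -/

variable [FiniteDimensional ℝ 𝔤] (ρ : GroupMetric 𝔤 G)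

variable (EM) in
/-- A connection form on `φ^*G`: a smooth `𝔥`-valued `1`-form `B` that restricts to the
Maurer-Cartan form `g⁻¹dg` on every fibre, i.e. on vertical vectors, and satisfies
`R_h^* B = Ad_*(h⁻¹) B`. -/
structure IsConnection (B : DForm EP (cosetBundle φ) 𝔤 1) : Prop where
  smooth : IsSmoothForm B
  mem : ∀ p v, B p v ∈ lieAlgOf (𝔤 := 𝔤) H
  vertical : ∀ (p : cosetBundle φ) (v : TangentSpace 𝓘(ℝ, EP) p),
    mfderiv 𝓘(ℝ, EP) 𝓘(ℝ, EM) (baseMap (φ := φ)) p v = 0 → B p ![v] = logDeriv groupCoord p v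
  equivariant : ∀ (h : H) p v, pullback (rightAct h) B p v = Ad (h : G)⁻¹ (B p v)

/-- The reference connection `(g⁻¹dg)^∥ = pr_𝔥(g⁻¹dg)` on `φ^*G`, as a function of a point and a
tangent vector. -/
def refConnection (p : cosetBundle φ) (v : TangentSpace 𝓘(ℝ, EP) p) : 𝔤 :=
  prOn ρ (lieAlgOf H) (logDeriv groupCoord p v)

/-- `b` is the (untwisted) gauge potential of the connection `B`, i.e. the smooth `𝔤`-valued
`1`-form on `M` with `π₁^* b = Ad_*(g) (B - (g⁻¹dg)^∥)`. -/
def IsPotential (B : DForm EP (cosetBundle φ) 𝔤 1) (b : DForm EM M 𝔤 1) : Prop :=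
  IsSmoothForm b ∧ ∀ p (v : TangentSpace 𝓘(ℝ, EP) p),
    pullback baseMap b p ![v] = Ad (groupCoord p) (B p ![v] - refConnection ρ p v)

/-- The curvature form `F(B) = dB + B ∧ B`. -/
def curvature (B : DForm EP (cosetBundle φ) 𝔤 1) (p : cosetBundle φ)
    (v : Fin 2 → TangentSpace 𝓘(ℝ, EP) p) : 𝔤 :=
  extD B p v + wedgeSq G B p v

/-- `F` is the curvature potential of the connection `B`, i.e. the smooth `𝔤`-valued `2`-form on `M`
with `π₁^* F = Ad_*(g) (dB + B ∧ B)`.  If `b` is the potential of `B`, this is the form `F(b)`. -/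
def IsCurvaturePotential (B : DForm EP (cosetBundle φ) 𝔤 1) (F : DForm EM M 𝔤 2) : Prop :=
  IsSmoothForm F ∧ ∀ p v, pullback baseMap F p v = Ad (groupCoord p) (curvature B p v)

end TotalSpace

/-! ### Forms with values in `Ad_*(φ^*G)` -/

section BundleValued

variable {EA : Type*} [NormedAddCommGroup EA] [NormedSpace ℝ EA]
  [ChartedSpace EA (AdAlgBundle (𝔤 := 𝔤) φ)]

/-- `α` is a smooth `Ad_*(φ^*G)`-valued `k`-form on `M`: in the linear coordinate on the fibre over
`m` given by any point `p` over `m` it is an alternating `k`-linear map, and its value on smooth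
vector fields is smooth. -/
def IsAdForm [IsManifold 𝓘(ℝ, EM) ∞ M] (k : ℕ)
    (α : ∀ m : M, (Fin k → TangentSpace 𝓘(ℝ, EM) m) → AdAlgBundle (𝔤 := 𝔤) φ) : Prop :=
  (∀ p : cosetBundle φ,
    ∃ A : TangentSpace 𝓘(ℝ, EM) (baseMap p) [⋀^Fin k]→L[ℝ] lieAlgOf (𝔤 := 𝔤) H,
      ∀ v, α (baseMap p) v = AdAlgBundle.mk (p, A v)) ∧
  ∀ (U : Set M) (X : Fin k → ∀ m : M, TangentSpace 𝓘(ℝ, EM) m), IsOpen U →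
    (∀ i, ContMDiffOn 𝓘(ℝ, EM) 𝓘(ℝ, EM).tangent ∞
      (fun m => (⟨m, X i m⟩ : TangentBundle 𝓘(ℝ, EM) M)) U) →
    ContMDiffOn 𝓘(ℝ, EM) 𝓘(ℝ, EA) ∞ (fun m => α m (fun i => X i m)) U

/-- The `Ad_*(φ^*G)`-valued form `β` on `M` is the descent `β(v₁, …) = [p, R(v̄₁, …)]` of the
`𝔥`-valued form `R` on `φ^*G`, where `v̄ᵢ` is any lift of `vᵢ` to the point `p`. -/
def IsDescent {EP : Type*} [NormedAddCommGroup EP] [NormedSpace ℝ EP]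
    [ChartedSpace EP (cosetBundle φ)] {k : ℕ}
    (R : ∀ p : cosetBundle φ, (Fin k → TangentSpace 𝓘(ℝ, EP) p) → 𝔤)
    (β : ∀ m : M, (Fin k → TangentSpace 𝓘(ℝ, EM) m) → AdAlgBundle (𝔤 := 𝔤) φ) : Prop :=
  ∀ p v, ∃ ξ : lieAlgOf (𝔤 := 𝔤) H, (ξ : 𝔤) = R p v ∧
    β (baseMap p) (fun i => mfderiv 𝓘(ℝ, EP) 𝓘(ℝ, EM) (baseMap (φ := φ)) p (v i)) =
      AdAlgBundle.mk (p, ξ)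

end BundleValued

end Coset

end LieGroups

end CosetGauge

end

open CosetGauge

namespace CosetGauge

noncomputable section

set_option linter.unusedSectionVars false

/-! ### Smooth families of alternating maps -/

section Calculus

variable {X : Type*} [NormedAddCommGroup X] [NormedSpace ℝ X]
  {E : Type*} [NormedAddCommGroup E] [NormedSpace ℝ E] [FiniteDimensional ℝ E]
  {V : Type*} [NormedAddCommGroup V] [NormedSpace ℝ V]

/-! Everything is read on P = φ^*G, where the coordinate g untwists the adjoint bundles: [p, λ] ↦
gλg⁻¹ and [p, ξ] ↦ Ad(g)ξ do not depend on the representative. They separate classes because H acts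
simply transitively on the fibres of P, and their images are H_φ and 𝔥_φ because H_x = gHg⁻¹ and 𝔥_x
= Ad(g)𝔥 (`AdBundle.mk_eq_iff`, `AdAlgBundle.mk_eq_iff`). Local sections of the quotient maps then
make these bijections diffeomorphisms (`exists_diffeomorph_of_isSubmersion`).

Local sections also govern forms. A local section s of G → G/H gives the local section m ↦ (m,
s(φ(m))) of P → M (`hasSections_baseMap`). Hence a form on the base is determined by its pullback,
is smooth if the pullback is, and exists as soon as a smooth form upstairs depends only on projected
points and vectors (`HasSections.exists_descent`). Applied to Ad(g) pr_{𝔥^⊥}(g⁻¹dg) this gives ω^⊥,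
and applied to Ad(g)(B - pr_𝔥(g⁻¹dg)) it gives b. Two facts make these forms basic: a vector on G is
vertical exactly when g⁻¹dg sends it into 𝔥 (`dmap_mk_eq_zero_iff`), and pr_𝔥 commutes with Ad(H),
by bi-invariance (`prOn_Ad_of_mem`). Conversely B = Ad(g⁻¹)π₁^*b + pr_𝔥(g⁻¹dg) recovers B from b
(`isPotential_iff_eq`).

For the curvature write l = g⁻¹dg, a = pr_𝔥 l, c = l - a, so that φ^*ω^⊥ pulls back to Ad(g)c. The
exterior derivative of B follows from the Maurer-Cartan equation (`extD_mcForm`) and from the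
derivative of Ad(g⁻¹) (`dmap_Ad_inv_comp`), which is itself a consequence of that equation. Since
pr_𝔥 commutes with ad(𝔥) (`prOn_lieBr`), the mixed terms cancel (`curvature_identity`), and dB + B ∧
B becomes Ad(g⁻¹) of the stated expression in b and φ^*ω^⊥. This formula also proves that F(b)
exists.

Under f_w the form l changes by Ad(g⁻¹)w⁻¹dw (`logD_groupCoord_gaugeMap`). Comparing the equations
for b and for φ^*ω^⊥ at p and at f_w(p) eliminates pr_𝔥 l and yields b^w; the law for F is the
naturality of d and of the bracket. A gauge transformation f comes from w = g(f(p)) g(p)⁻¹, which is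
constant along fibres by equivariance (`exists_gaugePerm_eq`). -/

theorem contDiffAt_alternating_apply {k : ℕ} {n : WithTop ℕ∞} {η : X → E [⋀^Fin k]→L[ℝ] V}
    {v : Fin k → X → E} {x : X} (hη : ContDiffAt ℝ n η x) (hv : ∀ i, ContDiffAt ℝ n (v i) x) :
    ContDiffAt ℝ n (fun y => η y (fun i => v i y)) x := by
  classical
  let b := Module.finBasis ℝ E
  -- Expansion of each vector in a basis leaves a finite sum of coordinate functions times values of
  -- η on fixed basis vectors.
  have h : ∀ y, η y (fun i => v i y) =
      ∑ r : Fin k → Fin (Module.finrank ℝ E),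
        (∏ i, b.repr (v i y) (r i)) • η y (fun i => b (r i)) := by
    intro y
    have h1 : (fun i => v i y) = fun i => ∑ j, b.repr (v i y) j • b j := by
      funext i; exact (b.sum_repr _).symm
    rw [h1]
    have := (η y).toMultilinearMap.map_sum (fun i j => b.repr (v i y) j • b j)
    refine this.trans (Finset.sum_congr rfl fun r _ => ?_)
    exact (η y).toMultilinearMap.map_smul_univ _ _
  simp_rw [h]
  refine ContDiffAt.sum fun r _ => ContDiffAt.smul ?_ ?_
  · refine contDiffAt_prod fun i _ => ?_
    exact ((b.coord (r i)).toContinuousLinearMap.contDiff.contDiffAt).comp x (hv i)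
  · exact ((ContinuousAlternatingMap.apply ℝ E V
      (fun i => b (r i))).contDiff.contDiffAt).comp x hη

/-- An alternating map is determined by its values on tuples of basis vectors. The resulting
injection `T` into a finite-dimensional space has a linear, hence smooth, left inverse, so
smoothness may be tested on constant vectors. -/
theorem contDiffAt_alternating_iff [FiniteDimensional ℝ V] {k : ℕ} {n : WithTop ℕ∞}
    {η : X → E [⋀^Fin k]→L[ℝ] V} {x : X} :
    ContDiffAt ℝ n η x ↔ ∀ v : Fin k → E, ContDiffAt ℝ n (fun y => η y v) x := by
  classical
  refine ⟨fun h v => contDiffAt_alternating_apply h fun i => contDiffAt_const, fun h => ?_⟩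
  let b := Module.finBasis ℝ E
  let T : (E [⋀^Fin k]→L[ℝ] V) →ₗ[ℝ] ((Fin k → Fin (Module.finrank ℝ E)) → V) :=
    { toFun := fun A r => A (fun i => b (r i))
      map_add' := fun _ _ => rfl
      map_smul' := fun _ _ => rfl }
  have hT : Function.Injective T := by
    intro A B hAB
    ext v
    have h1 : v = fun i => ∑ j, b.repr (v i) j • b j := by
      funext i; exact (b.sum_repr _).symm
    rw [h1]
    have hA := A.toMultilinearMap.map_sum (fun i j => b.repr (v i) j • b j)
    have hB := B.toMultilinearMap.map_sum (fun i j => b.repr (v i) j • b j)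
    refine hA.trans (Eq.trans (Finset.sum_congr rfl fun r _ => ?_) hB.symm)
    rw [A.toMultilinearMap.map_smul_univ, B.toMultilinearMap.map_smul_univ]
    exact congrArg _ (congrFun hAB r)
  have : FiniteDimensional ℝ (E [⋀^Fin k]→L[ℝ] V) := Module.Finite.of_injective T hT
  obtain ⟨S, hS⟩ := T.exists_leftInverse_of_injective (LinearMap.ker_eq_bot.2 hT)
  have h2 : η = fun y => S.toContinuousLinearMap (T (η y)) := by
    funext y
    exact (LinearMap.congr_fun hS (η y)).symm
  rw [h2]
  refine (S.toContinuousLinearMap.contDiff.contDiffAt).comp x ?_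
  exact contDiffAt_pi.2 fun r => h _

theorem contDiffAt_alternating_comp [FiniteDimensional ℝ V] {F : Type*} [NormedAddCommGroup F]
    [NormedSpace ℝ F] [FiniteDimensional ℝ F] {k : ℕ} {n : WithTop ℕ∞}
    {η : X → E [⋀^Fin k]→L[ℝ] V} {L : X → F →L[ℝ] E} {x : X}
    (hη : ContDiffAt ℝ n η x) (hL : ContDiffAt ℝ n L x) :
    ContDiffAt ℝ n (fun y => (η y).compContinuousLinearMap (L y)) x :=
  contDiffAt_alternating_iff.2 fun v =>
    contDiffAt_alternating_apply (v := fun i y => L y (v i)) hη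
      fun _ => hL.clm_apply contDiffAt_const

/-- At order ∞ the derivative of `f` is as smooth as `f`, so no order is lost. -/
theorem contDiffAt_pullback [FiniteDimensional ℝ V] {F : Type*} [NormedAddCommGroup F]
    [NormedSpace ℝ F] [FiniteDimensional ℝ F] {k : ℕ} {η : E → E [⋀^Fin k]→L[ℝ] V} {f : F → E}
    {x : F} (hη : ContDiffAt ℝ ∞ η (f x)) (hf : ContDiffAt ℝ ∞ f x) :
    ContDiffAt ℝ ∞ (fun y => (η (f y)).compContinuousLinearMap (fderiv ℝ f y)) x :=
  contDiffAt_alternating_comp (hη.comp x hf) (hf.fderiv_right (m := ∞) (by simp))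

theorem minSmoothness_two_le_infty : minSmoothness ℝ 2 ≤ (∞ : WithTop ℕ∞) := by
  rw [minSmoothness_of_isRCLikeNormedField]
  exact WithTop.coe_le_coe.2 le_top

end Calculus

/-! ### Derivatives of maps between manifolds -/

section Derivative

variable {E : Type*} [NormedAddCommGroup E] [NormedSpace ℝ E]
  {M : Type*} [TopologicalSpace M] [ChartedSpace E M]
  {E' : Type*} [NormedAddCommGroup E'] [NormedSpace ℝ E']
  {N : Type*} [TopologicalSpace N] [ChartedSpace E' N]
  {E'' : Type*} [NormedAddCommGroup E''] [NormedSpace ℝ E'']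
  {P : Type*} [TopologicalSpace P] [ChartedSpace E'' P]

/-- Smoothness at a point of a map between manifolds modelled on `E'` and `E`. -/
abbrev SmoothAt (E' : Type*) [NormedAddCommGroup E'] [NormedSpace ℝ E']
    (E : Type*) [NormedAddCommGroup E] [NormedSpace ℝ E]
    {N : Type*} [TopologicalSpace N] [ChartedSpace E' N]
    {M : Type*} [TopologicalSpace M] [ChartedSpace E M] (f : N → M) (x : N) : Prop :=
  ContMDiffAt 𝓘(ℝ, E') 𝓘(ℝ, E) ∞ f x

/-- The differential of a map, as a map between the model spaces. -/
def dmap (E' : Type*) [NormedAddCommGroup E'] [NormedSpace ℝ E']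
    (E : Type*) [NormedAddCommGroup E] [NormedSpace ℝ E]
    {N : Type*} [TopologicalSpace N] [ChartedSpace E' N]
    {M : Type*} [TopologicalSpace M] [ChartedSpace E M] (f : N → M) (x : N) : E' →L[ℝ] E :=
  mfderiv 𝓘(ℝ, E') 𝓘(ℝ, E) f x

theorem SmoothAt.mdiff {f : N → M} {x : N} (h : SmoothAt E' E f x) :
    MDifferentiableAt 𝓘(ℝ, E') 𝓘(ℝ, E) f x := h.mdifferentiableAt (by simp)

theorem dmap_comp {g : M → P} {f : N → M} {x : N} (hg : SmoothAt E E'' g (f x))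
    (hf : SmoothAt E' E f x) :
    dmap E' E'' (fun y => g (f y)) x = (dmap E E'' g (f x)).comp (dmap E' E f x) :=
  mfderiv_comp x hg.mdiff hf.mdiff

theorem dmap_comp_apply {g : M → P} {f : N → M} {x : N} (hg : SmoothAt E E'' g (f x))
    (hf : SmoothAt E' E f x) (v : E') :
    dmap E' E'' (fun y => g (f y)) x v = dmap E E'' g (f x) (dmap E' E f x v) := by
  rw [dmap_comp hg hf]; rfl

theorem dmap_congr {f g : N → M} {x : N} (h : f =ᶠ[𝓝 x] g) : dmap E' E f x = dmap E' E g x :=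
  h.mfderiv_eq

theorem dmap_id (x : M) : dmap E E (fun y : M => y) x = ContinuousLinearMap.id ℝ E :=
  mfderiv_id

theorem dmap_const (m : M) (x : N) : dmap E' E (fun _ : N => m) x = 0 :=
  mfderiv_const

theorem dmap_eq_fderiv (f : E' → E) (x : E') : dmap E' E f x = fderiv ℝ f x :=
  mfderiv_eq_fderiv

theorem SmoothAt.comp {g : M → P} {f : N → M} {x : N} (hg : SmoothAt E E'' g (f x))
    (hf : SmoothAt E' E f x) : SmoothAt E' E'' (fun y => g (f y)) x :=
  ContMDiffAt.comp x hg hf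

theorem smoothAt_iff_contDiffAt {f : E' → E} {x : E'} : SmoothAt E' E f x ↔ ContDiffAt ℝ ∞ f x :=
  contMDiffAt_iff_contDiffAt

variable [IsManifold 𝓘(ℝ, E) ∞ M]

theorem isManifold_one_of_infty : IsManifold 𝓘(ℝ, E) 1 M :=
  IsManifold.of_le (n := ∞) (by simp)

theorem smoothAt_chart {m₀ m : M} (h : m ∈ (chartAt E m₀).source) :
    SmoothAt E E (extChartAt 𝓘(ℝ, E) m₀) m := contMDiffAt_extChartAt' h

theorem isOpen_target (m₀ : M) : IsOpen (extChartAt 𝓘(ℝ, E) m₀).target :=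
  isOpen_extChartAt_target m₀

theorem smoothAt_chart_symm {m₀ : M} {y : E} (h : y ∈ (extChartAt 𝓘(ℝ, E) m₀).target) :
    SmoothAt E E (extChartAt 𝓘(ℝ, E) m₀).symm y :=
  (contMDiffOn_extChartAt_symm m₀).contMDiffAt ((isOpen_target m₀).mem_nhds h)

theorem dmap_chart_symm_comp {m₀ m : M} (h : m ∈ (chartAt E m₀).source) :
    (dmap E E (extChartAt 𝓘(ℝ, E) m₀).symm (extChartAt 𝓘(ℝ, E) m₀ m)).comp
      (dmap E E (extChartAt 𝓘(ℝ, E) m₀) m) = ContinuousLinearMap.id ℝ E := by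
  have hs : m ∈ (extChartAt 𝓘(ℝ, E) m₀).source := by rwa [extChartAt_source]
  rw [← dmap_comp (smoothAt_chart_symm ((extChartAt 𝓘(ℝ, E) m₀).map_source hs))
    (smoothAt_chart h), ← dmap_id m]
  refine dmap_congr ?_
  filter_upwards [(chartAt E m₀).open_source.mem_nhds h] with z hz
  exact (extChartAt 𝓘(ℝ, E) m₀).left_inv (by rwa [extChartAt_source])

/-- C^∞ at a point gives, for each finite order, a neighbourhood of that regularity, but no common
neighbourhood. Order 1 is enough for the chain rule at nearby points. -/
theorem SmoothAt.eventually_one [IsManifold 𝓘(ℝ, E') ∞ N] {f : N → M} {x : N}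
    (h : SmoothAt E' E f x) :
    ∀ᶠ y in 𝓝 x, MDifferentiableAt 𝓘(ℝ, E') 𝓘(ℝ, E) f y := by
  have : IsManifold 𝓘(ℝ, E) 1 M := isManifold_one_of_infty
  have : IsManifold 𝓘(ℝ, E') 1 N := isManifold_one_of_infty
  have h1 : ContMDiffAt 𝓘(ℝ, E') 𝓘(ℝ, E) 1 f x := h.of_le (by simp)
  filter_upwards [(contMDiffAt_iff_contMDiffAt_nhds (by simp)).1 h1] with y hy
  exact hy.mdifferentiableAt (by simp)

end Derivative

/-! ### Smooth forms, pullbacks and the exterior derivative -/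

section SmoothForms

variable {E : Type*} [NormedAddCommGroup E] [NormedSpace ℝ E]
  {M : Type*} [TopologicalSpace M] [ChartedSpace E M]
  {E' : Type*} [NormedAddCommGroup E'] [NormedSpace ℝ E']
  {N : Type*} [TopologicalSpace N] [ChartedSpace E' N]
  {E'' : Type*} [NormedAddCommGroup E''] [NormedSpace ℝ E'']
  {P : Type*} [TopologicalSpace P] [ChartedSpace E'' P]
  {V : Type*} [NormedAddCommGroup V] [NormedSpace ℝ V] {k : ℕ}

/-- Smoothness of a form at a point. -/
def SmoothFormAt (α : DForm E M V k) (m : M) : Prop :=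
  ContDiffAt ℝ ∞ (formInChart α m) (extChartAt 𝓘(ℝ, E) m m)

/-- The value of a form as an alternating map on the model space. -/
def DForm.at (α : DForm E M V k) (m : M) : E [⋀^Fin k]→L[ℝ] V := α m

theorem formInChart_eq (α : DForm E M V k) (m₀ : M) (y : E) :
    formInChart α m₀ y = (α.at ((extChartAt 𝓘(ℝ, E) m₀).symm y)).compContinuousLinearMap
      (dmap E E (extChartAt 𝓘(ℝ, E) m₀).symm y) := rfl

theorem pullback_at (f : N → M) (α : DForm E M V k) (n : N) :
    DForm.at (E := E') (pullback f α) n =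
      (α.at (f n)).compContinuousLinearMap (dmap E' E f n) := rfl

theorem extD_at (α : DForm E M V k) (m : M) :
    DForm.at (extD α) m =
      (extDeriv (formInChart α m) (extChartAt 𝓘(ℝ, E) m m)).compContinuousLinearMap
        (dmap E E (extChartAt 𝓘(ℝ, E) m) m) := rfl

theorem compCLM_comp {A : E [⋀^Fin k]→L[ℝ] V} (L : E' →L[ℝ] E) (K : E'' →L[ℝ] E') :
    (A.compContinuousLinearMap L).compContinuousLinearMap K =
      A.compContinuousLinearMap (L.comp K) := rfl

variable [IsManifold 𝓘(ℝ, E) ∞ M] [IsManifold 𝓘(ℝ, E') ∞ N]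

/-- The local expression of `f : N → M` in two preferred charts. -/
def localExpr (E' : Type*) [NormedAddCommGroup E'] [NormedSpace ℝ E']
    (E : Type*) [NormedAddCommGroup E] [NormedSpace ℝ E]
    {N : Type*} [TopologicalSpace N] [ChartedSpace E' N]
    {M : Type*} [TopologicalSpace M] [ChartedSpace E M] (f : N → M) (n₀ : N) (m₀ : M)
    (y : E') : E :=
  extChartAt 𝓘(ℝ, E) m₀ (f ((extChartAt 𝓘(ℝ, E') n₀).symm y))

theorem contDiffAt_localExpr {f : N → M} {n₀ : N} {m₀ : M} {y₀ : E'}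
    (hy : y₀ ∈ (extChartAt 𝓘(ℝ, E') n₀).target)
    (hf : SmoothAt E' E f ((extChartAt 𝓘(ℝ, E') n₀).symm y₀))
    (hm : f ((extChartAt 𝓘(ℝ, E') n₀).symm y₀) ∈ (chartAt E m₀).source) :
    ContDiffAt ℝ ∞ (localExpr E' E f n₀ m₀) y₀ :=
  smoothAt_iff_contDiffAt.1 (SmoothAt.comp (g := extChartAt 𝓘(ℝ, E) m₀) (smoothAt_chart hm)
    (hf.comp (smoothAt_chart_symm hy)))

/-- The chain rule on a neighbourhood where `f` is differentiable and stays in the chart at `m₀`. It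
turns questions about pullbacks on manifolds into questions about pullbacks between vector spaces.
-/
theorem formInChart_pullback {f : N → M} {n₀ : N} {m₀ : M} {y₀ : E'} (α : DForm E M V k)
    (hy : y₀ ∈ (extChartAt 𝓘(ℝ, E') n₀).target)
    (hf : SmoothAt E' E f ((extChartAt 𝓘(ℝ, E') n₀).symm y₀))
    (hm : f ((extChartAt 𝓘(ℝ, E') n₀).symm y₀) ∈ (chartAt E m₀).source) :
    formInChart (E := E') (pullback f α) n₀ =ᶠ[𝓝 y₀] fun y =>
      (formInChart α m₀ (localExpr E' E f n₀ m₀ y)).compContinuousLinearMap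
        (fderiv ℝ (localExpr E' E f n₀ m₀) y) := by
  have hs : SmoothAt E' E' (extChartAt 𝓘(ℝ, E') n₀).symm y₀ := smoothAt_chart_symm hy
  have h1 : ∀ᶠ y in 𝓝 y₀, y ∈ (extChartAt 𝓘(ℝ, E') n₀).target :=
    (isOpen_target n₀).mem_nhds hy
  have h2 : ∀ᶠ y in 𝓝 y₀, MDifferentiableAt 𝓘(ℝ, E') 𝓘(ℝ, E) f
      ((extChartAt 𝓘(ℝ, E') n₀).symm y) := hs.continuousAt.eventually hf.eventually_one
  have h3 : ∀ᶠ y in 𝓝 y₀, f ((extChartAt 𝓘(ℝ, E') n₀).symm y) ∈ (chartAt E m₀).source :=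
    (hf.comp hs).continuousAt.eventually ((chartAt E m₀).open_source.mem_nhds hm)
  filter_upwards [h1, h2, h3, h3.eventually_nhds] with y h1 h2 h3 h4
  have hz : f ((extChartAt 𝓘(ℝ, E') n₀).symm y) ∈ (extChartAt 𝓘(ℝ, E) m₀).source := by
    rwa [extChartAt_source]
  have hl : (extChartAt 𝓘(ℝ, E) m₀).symm (localExpr E' E f n₀ m₀ y) =
      f ((extChartAt 𝓘(ℝ, E') n₀).symm y) := (extChartAt 𝓘(ℝ, E) m₀).left_inv hz
  have hs' : SmoothAt E' E' (extChartAt 𝓘(ℝ, E') n₀).symm y := smoothAt_chart_symm h1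
  have hd : dmap E' E (fun z => f ((extChartAt 𝓘(ℝ, E') n₀).symm z)) y =
      (dmap E' E f ((extChartAt 𝓘(ℝ, E') n₀).symm y)).comp
        (dmap E' E' (extChartAt 𝓘(ℝ, E') n₀).symm y) :=
    mfderiv_comp y h2 hs'.mdiff
  have hd2 : fderiv ℝ (localExpr E' E f n₀ m₀) y =
      (dmap E E (extChartAt 𝓘(ℝ, E) m₀) (f ((extChartAt 𝓘(ℝ, E') n₀).symm y))).comp
      (dmap E' E (fun z => f ((extChartAt 𝓘(ℝ, E') n₀).symm z)) y) := by
    rw [← dmap_eq_fderiv]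
    exact mfderiv_comp (I' := 𝓘(ℝ, E)) y (smoothAt_chart h3).mdiff (h2.comp y hs'.mdiff)
  rw [formInChart_eq, formInChart_eq, pullback_at, compCLM_comp, compCLM_comp, hl, ← hd, hd2,
    ← ContinuousLinearMap.comp_assoc]
  congr 1
  have := dmap_chart_symm_comp h3
  change _ = (ContinuousLinearMap.comp (dmap E E (extChartAt 𝓘(ℝ, E) m₀).symm
    (extChartAt 𝓘(ℝ, E) m₀ (f ((extChartAt 𝓘(ℝ, E') n₀).symm y)))) _).comp _
  rw [this, ContinuousLinearMap.id_comp]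

theorem center_mem (m : M) : extChartAt 𝓘(ℝ, E) m m ∈ (extChartAt 𝓘(ℝ, E) m).target :=
  mem_extChartAt_target m

/-! ### Independence of the chart; naturality of pullback and exterior derivative -/

section ChangeOfChart

variable {α : DForm E M V k}

theorem pullback_id : pullback (E := E) (fun x : M => x) α = α := by
  funext m
  have : DForm.at (E := E) (pullback (fun x : M => x) α) m = α.at m := by
    rw [pullback_at, dmap_id]; rfl
  exact this

/-- A change of chart is the pullback along the identity, read in two different charts. -/
theorem formInChart_change (α : DForm E M V k) {m₀ m₁ : M} {y₀ : E}
    (hy : y₀ ∈ (extChartAt 𝓘(ℝ, E) m₀).target)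
    (hm : (extChartAt 𝓘(ℝ, E) m₀).symm y₀ ∈ (chartAt E m₁).source) :
    formInChart α m₀ =ᶠ[𝓝 y₀] fun y =>
      (formInChart α m₁ (localExpr E E (fun x : M => x) m₀ m₁ y)).compContinuousLinearMap
        (fderiv ℝ (localExpr E E (fun x : M => x) m₀ m₁) y) := by
  have := formInChart_pullback (f := fun x : M => x) (m₀ := m₁) α hy contMDiffAt_id hm
  rwa [pullback_id] at this

variable [FiniteDimensional ℝ E] [FiniteDimensional ℝ V]

theorem SmoothFormAt.contDiffAt_formInChart {m₀ : M} {y : E}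
    (hy : y ∈ (extChartAt 𝓘(ℝ, E) m₀).target)
    (h : SmoothFormAt α ((extChartAt 𝓘(ℝ, E) m₀).symm y)) :
    ContDiffAt ℝ ∞ (formInChart α m₀) y := by
  set m := (extChartAt 𝓘(ℝ, E) m₀).symm y with hm
  have hms : m ∈ (chartAt E m).source := mem_chart_source E m
  have hF : ContDiffAt ℝ ∞ (localExpr E E (fun x : M => x) m₀ m) y :=
    contDiffAt_localExpr (E' := E) hy contMDiffAt_id hms
  refine ContDiffAt.congr_of_eventuallyEq ?_ (formInChart_change α hy hms)
  exact contDiffAt_pullback h hF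

/-- Pointwise smoothness refers only to the chart centred at the point; transition maps carry it to
every other chart. Later arguments use this pointwise version. -/
theorem smoothForm_iff : IsSmoothForm α ↔ ∀ m, SmoothFormAt α m := by
  refine ⟨fun h m => (h m).contDiffAt ((isOpen_target m).mem_nhds (center_mem m)),
    fun h m₀ y hy => ?_⟩
  exact ((h _).contDiffAt_formInChart hy).contDiffWithinAt

/-- The exterior derivative can be computed in any chart. -/
theorem formInChart_extD {m₀ : M} {y : E} (hy : y ∈ (extChartAt 𝓘(ℝ, E) m₀).target)
    (h : SmoothFormAt α ((extChartAt 𝓘(ℝ, E) m₀).symm y)) :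
    formInChart (extD α) m₀ y = extDeriv (formInChart α m₀) y := by
  set m := (extChartAt 𝓘(ℝ, E) m₀).symm y with hm
  have hms : m ∈ (chartAt E m).source := mem_chart_source E m
  have hF : ContDiffAt ℝ ∞ (localExpr E E (fun x : M => x) m₀ m) y :=
    contDiffAt_localExpr (E' := E) hy contMDiffAt_id hms
  have hw : DifferentiableAt ℝ (formInChart α m) (localExpr E E (fun x : M => x) m₀ m y) :=
    ContDiffAt.differentiableAt h (by simp)
  rw [(formInChart_change α hy hms).extDeriv_eq,
    -- In vector spaces d commutes with the pullback along the transition map from the chart at `m₀`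
    -- to the chart at `m`.
    extDeriv_pullback hw hF minSmoothness_two_le_infty, formInChart_eq, extD_at, compCLM_comp, ← hm]
  congr 1
  rw [← dmap_eq_fderiv]
  exact (dmap_comp (smoothAt_chart hms) (smoothAt_chart_symm hy)).symm

/-- At a nearby point the exterior derivative is computed in the chart of that point. Comparing it
with the derivative in one fixed chart needs smoothness there too, hence the assumption at all
points. -/
theorem SmoothFormAt.extD (h : ∀ m, SmoothFormAt α m) (m : M) : SmoothFormAt (extD α) m := by
  have h1 : formInChart (CosetGauge.extD α) m =ᶠ[𝓝 (extChartAt 𝓘(ℝ, E) m m)]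
      extDeriv (formInChart α m) := by
    filter_upwards [(isOpen_target m).mem_nhds (center_mem m)] with y hy
    exact formInChart_extD hy (h _)
  refine ContDiffAt.congr_of_eventuallyEq ?_ h1
  have h2 : ContDiffAt ℝ ∞ (fderiv ℝ (formInChart α m)) (extChartAt 𝓘(ℝ, E) m m) :=
    ContDiffAt.fderiv_right (m := ∞) (h m) (by simp)
  exact ((ContinuousAlternatingMap.alternatizeUncurryFinCLM ℝ E V).contDiff.contDiffAt).comp _ h2

variable [FiniteDimensional ℝ E']

theorem SmoothFormAt.pullback {f : N → M} {n : N} (h : SmoothFormAt α (f n))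
    (hf : SmoothAt E' E f n) : SmoothFormAt (E := E') (pullback f α) n := by
  have e : (extChartAt 𝓘(ℝ, E') n).symm (extChartAt 𝓘(ℝ, E') n n) = n := extChartAt_to_inv n
  have hf' : SmoothAt E' E f ((extChartAt 𝓘(ℝ, E') n).symm (extChartAt 𝓘(ℝ, E') n n)) := by
    rwa [e]
  have hm : f ((extChartAt 𝓘(ℝ, E') n).symm (extChartAt 𝓘(ℝ, E') n n)) ∈
      (chartAt E (f n)).source := by rw [e]; exact mem_chart_source E _
  have hF := contDiffAt_localExpr (center_mem n) hf' hm
  refine ContDiffAt.congr_of_eventuallyEq ?_ (formInChart_pullback α (center_mem n) hf' hm)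
  refine contDiffAt_pullback ?_ hF
  have : localExpr E' E f n (f n) (extChartAt 𝓘(ℝ, E') n n) =
      extChartAt 𝓘(ℝ, E) (f n) (f n) := by
    rw [localExpr, e]
  rw [this]
  exact h

/-- The exterior derivative commutes with pullbacks. -/
theorem extD_pullback {f : N → M} {n : N} (h : SmoothFormAt α (f n))
    (hf : SmoothAt E' E f n) :
    DForm.at (E := E') (CosetGauge.extD (E := E') (CosetGauge.pullback f α)) n =
      DForm.at (E := E') (CosetGauge.pullback f (CosetGauge.extD α)) n := by
  have e : (extChartAt 𝓘(ℝ, E') n).symm (extChartAt 𝓘(ℝ, E') n n) = n := extChartAt_to_inv n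
  have hf' : SmoothAt E' E f ((extChartAt 𝓘(ℝ, E') n).symm (extChartAt 𝓘(ℝ, E') n n)) := by
    rwa [e]
  have hm : f ((extChartAt 𝓘(ℝ, E') n).symm (extChartAt 𝓘(ℝ, E') n n)) ∈
      (chartAt E (f n)).source := by rw [e]; exact mem_chart_source E _
  have hF := contDiffAt_localExpr (center_mem n) hf' hm
  have hc : localExpr E' E f n (f n) (extChartAt 𝓘(ℝ, E') n n) =
      extChartAt 𝓘(ℝ, E) (f n) (f n) := by
    rw [localExpr, e]
  have hw : DifferentiableAt ℝ (formInChart α (f n))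
      (localExpr E' E f n (f n) (extChartAt 𝓘(ℝ, E') n n)) := by
    rw [hc]; exact ContDiffAt.differentiableAt h (by simp)
  rw [extD_at, (formInChart_pullback α (center_mem n) hf' hm).extDeriv_eq,
    extDeriv_pullback hw hF minSmoothness_two_le_infty, hc, pullback_at, extD_at,
    compCLM_comp, compCLM_comp]
  congr 1
  have hF' : SmoothAt E' E (localExpr E' E f n (f n)) (extChartAt 𝓘(ℝ, E') n n) :=
    smoothAt_iff_contDiffAt.2 hF
  rw [← dmap_eq_fderiv, ← dmap_comp hF' (smoothAt_chart (mem_chart_source E' n)),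
    ← dmap_comp (smoothAt_chart (mem_chart_source E (f n))) hf]
  refine dmap_congr ?_
  -- Chart after inverse chart cancels near `n`, so the local expression composed with the chart at
  -- `n` is `f` followed by the chart at `f n`.
  filter_upwards [(chartAt E' n).open_source.mem_nhds (mem_chart_source E' n)] with z hz
  rw [localExpr, (extChartAt 𝓘(ℝ, E') n).left_inv (by rwa [extChartAt_source])]

end ChangeOfChart

end SmoothForms

/-! ### Algebraic operations on forms -/

section FormAlgebra

variable {E : Type*} [NormedAddCommGroup E] [NormedSpace ℝ E]
  {M : Type*} [TopologicalSpace M] [ChartedSpace E M]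
  {E' : Type*} [NormedAddCommGroup E'] [NormedSpace ℝ E']
  {N : Type*} [TopologicalSpace N] [ChartedSpace E' N]
  {V : Type*} [NormedAddCommGroup V] [NormedSpace ℝ V]
  {W : Type*} [NormedAddCommGroup W] [NormedSpace ℝ W] {k : ℕ}

/-- The `1`-form with given values. -/
def oneForm (A : M → E →L[ℝ] V) : DForm E M V 1 := fun m =>
  (ContinuousAlternatingMap.ofSubsingleton ℝ E V (0 : Fin 1) (A m) : E [⋀^Fin 1]→L[ℝ] V)

/-- A `1`-form as a family of linear maps. -/
def DForm.lin (α : DForm E M V 1) (m : M) : E →L[ℝ] V :=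
  (ContinuousAlternatingMap.ofSubsingleton ℝ E V (0 : Fin 1)).symm (α.at m)

theorem DForm.lin_apply (α : DForm E M V 1) (m : M) (v : E) : α.lin m v = α.at m ![v] := by
  have : (fun _ : Fin 1 => v) = ![v] := by funext i; fin_cases i; rfl
  rw [← this]; rfl

theorem DForm.at_eq_lin (α : DForm E M V 1) (m : M) (v : Fin 1 → E) :
    α.at m v = α.lin m (v 0) := by
  rw [DForm.lin_apply]; congr 1; funext i; fin_cases i; rfl

theorem DForm.ext_at {α β : DForm E M V k} (h : ∀ m v, α.at m v = β.at m v) : α = β := by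
  funext m
  exact ContinuousAlternatingMap.ext (h m)

theorem DForm.ext_lin {α β : DForm E M V 1} (h : ∀ m v, α.lin m v = β.lin m v) : α = β :=
  DForm.ext_at fun m v => by rw [α.at_eq_lin, β.at_eq_lin, h]

theorem pullback_lin (f : N → M) (α : DForm E M V 1) (n : N) (v : E') :
    DForm.lin (E := E') (pullback f α) n v = α.lin (f n) (dmap E' E f n v) := rfl

/-- The sum of two forms. -/
def addForm (α β : DForm E M V k) : DForm E M V k := fun m => α.at m + β.at m

/-- A form acted on pointwise by linear maps. -/
def actForm (A : M → V →L[ℝ] W) (α : DForm E M V k) : DForm E M W k := fun m =>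
  (A m).compContinuousAlternatingMap (α.at m)

theorem addForm_at (α β : DForm E M V k) (m : M) (v : Fin k → E) :
    (addForm α β).at m v = α.at m v + β.at m v := rfl

theorem actForm_at (A : M → V →L[ℝ] W) (α : DForm E M V k) (m : M) (v : Fin k → E) :
    (actForm A α).at m v = A m (α.at m v) := rfl

/-- The alternating map `(u, v) ↦ L (a u) (b v) - L (a v) (b u)`. -/
def altPair (L : V →L[ℝ] V →L[ℝ] W) (a b : E →L[ℝ] V) : E [⋀^Fin 2]→L[ℝ] W where
  toFun v := L (a (v 0)) (b (v 1)) - L (a (v 1)) (b (v 0))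
  map_update_add' := by
    intro d v i x y
    have : d = instDecidableEqFin 2 := Subsingleton.elim _ _
    subst this
    fin_cases i <;> simp <;> abel
  map_update_smul' := by
    intro d v i c x
    have : d = instDecidableEqFin 2 := Subsingleton.elim _ _
    subst this
    fin_cases i <;> simp [smul_sub]
  map_eq_zero_of_eq' := by
    intro v i j h hij
    fin_cases i <;> fin_cases j <;> simp_all
  cont := by fun_prop

/-- The wedge product of two `1`-forms with respect to a bilinear pairing of the values. -/
def wedgeForm (L : V →L[ℝ] V →L[ℝ] W) (α β : DForm E M V 1) : DForm E M W 2 := fun m =>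
  (altPair L (α.lin m) (β.lin m) : E [⋀^Fin 2]→L[ℝ] W)

theorem wedgeForm_at (L : V →L[ℝ] V →L[ℝ] W) (α β : DForm E M V 1) (m : M) (v : Fin 2 → E) :
    (wedgeForm L α β).at m v =
      L (α.lin m (v 0)) (β.lin m (v 1)) - L (α.lin m (v 1)) (β.lin m (v 0)) := rfl

theorem formInChart_apply (α : DForm E M V k) (m₀ : M) (y : E) (v : Fin k → E) :
    formInChart α m₀ y v = α.at ((extChartAt 𝓘(ℝ, E) m₀).symm y)
      (fun i => dmap E E (extChartAt 𝓘(ℝ, E) m₀).symm y (v i)) := rfl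

theorem formInChart_one (α : DForm E M V 1) (m₀ : M) (y : E) (v : Fin 1 → E) :
    formInChart α m₀ y v = α.lin ((extChartAt 𝓘(ℝ, E) m₀).symm y)
      (dmap E E (extChartAt 𝓘(ℝ, E) m₀).symm y (v 0)) := by
  rw [formInChart_apply, DForm.at_eq_lin]

theorem formInChart_addForm (α β : DForm E M V k) (m₀ : M) :
    formInChart (addForm α β) m₀ = fun y => formInChart α m₀ y + formInChart β m₀ y := rfl

theorem formInChart_actForm (A : M → V →L[ℝ] W) (α : DForm E M V k) (m₀ : M) :
    formInChart (actForm A α) m₀ = fun y =>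
      (A ((extChartAt 𝓘(ℝ, E) m₀).symm y)).compContinuousAlternatingMap
        (formInChart α m₀ y) := rfl

variable [FiniteDimensional ℝ E] [FiniteDimensional ℝ V] [FiniteDimensional ℝ W]
  [IsManifold 𝓘(ℝ, E) ∞ M]

theorem SmoothFormAt.add {α β : DForm E M V k} {m : M} (hα : SmoothFormAt α m)
    (hβ : SmoothFormAt β m) : SmoothFormAt (addForm α β) m :=
  ContDiffAt.add hα hβ

theorem smoothAt_in_chart {f : M → V} {m : M} (hf : SmoothAt E V f m) :
    ContDiffAt ℝ ∞ (fun y => f ((extChartAt 𝓘(ℝ, E) m).symm y)) (extChartAt 𝓘(ℝ, E) m m) := by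
  rw [← smoothAt_iff_contDiffAt]
  refine SmoothAt.comp ?_ (smoothAt_chart_symm (center_mem m))
  rwa [extChartAt_to_inv m]

theorem SmoothFormAt.act {A : M → V →L[ℝ] W} {α : DForm E M V k} {m : M}
    (hA : SmoothAt E (V →L[ℝ] W) A m) (hα : SmoothFormAt α m) : SmoothFormAt (actForm A α) m := by
  have h := smoothAt_in_chart (f := A) hA
  refine contDiffAt_alternating_iff.2 fun v => ?_
  rw [formInChart_actForm]
  exact h.clm_apply (contDiffAt_alternating_iff.1 hα v)

theorem SmoothFormAt.wedge (L : V →L[ℝ] V →L[ℝ] W) {α β : DForm E M V 1} {m : M}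
    (hα : SmoothFormAt α m) (hβ : SmoothFormAt β m) : SmoothFormAt (wedgeForm L α β) m := by
  refine contDiffAt_alternating_iff.2 fun v => ?_
  have e : ∀ y, formInChart (wedgeForm L α β) m y v =
      L (formInChart α m y ![v 0]) (formInChart β m y ![v 1]) -
      L (formInChart α m y ![v 1]) (formInChart β m y ![v 0]) := by
    intro y
    rw [formInChart_apply, wedgeForm_at]
    simp only [formInChart_one]
    rfl
  simp_rw [e]
  have ha := contDiffAt_alternating_iff.1 hα
  have hb := contDiffAt_alternating_iff.1 hβ
  exact ((contDiffAt_const.clm_apply (ha _)).clm_apply (hb _)).sub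
    ((contDiffAt_const.clm_apply (ha _)).clm_apply (hb _))

/-- The tangent space at `m` is identified with `E` through the preferred chart at `m`, so this
chart has the identity as its differential there. Formulas at the centre of a chart thus carry no
correction factor. -/
theorem dmap_chart_self (m : M) :
    dmap E E (extChartAt 𝓘(ℝ, E) m) m = ContinuousLinearMap.id ℝ E := by
  have : IsManifold 𝓘(ℝ, E) 1 M := isManifold_one_of_infty
  exact mfderiv_extChartAt_self

theorem dmap_chart_symm_self (m : M) :
    dmap E E (extChartAt 𝓘(ℝ, E) m).symm (extChartAt 𝓘(ℝ, E) m m) =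
      ContinuousLinearMap.id ℝ E := by
  have := dmap_chart_symm_comp (mem_chart_source E m)
  rwa [dmap_chart_self, ContinuousLinearMap.comp_id] at this

theorem extD_at_center (α : DForm E M V k) (m : M) :
    DForm.at (extD α) m = extDeriv (formInChart α m) (extChartAt 𝓘(ℝ, E) m m) := by
  rw [extD_at, dmap_chart_self]; rfl

theorem formInChart_center (α : DForm E M V k) (m : M) :
    formInChart α m (extChartAt 𝓘(ℝ, E) m m) = α.at m := by
  rw [formInChart_eq, dmap_chart_symm_self, extChartAt_to_inv m]; rfl

theorem formInChart_vectorSpace (α : DForm E E V k) (x : E) : formInChart α x = α.at := by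
  funext y
  have h : (extChartAt 𝓘(ℝ, E) x).symm = PartialEquiv.refl E := by
    rw [extChartAt_model_space_eq_id]; rfl
  rw [formInChart_eq, h]
  change (α.at y).compContinuousLinearMap (dmap E E (fun z : E => z) y) = _
  rw [dmap_id]; rfl

theorem extChartAt_vectorSpace_apply (x : E) : extChartAt 𝓘(ℝ, E) x x = x := by
  rw [extChartAt_model_space_eq_id]; rfl

theorem extD_vectorSpace (α : DForm E E V k) (x : E) :
    DForm.at (extD α) x = extDeriv α.at x := by
  rw [extD_at_center, formInChart_vectorSpace, extChartAt_vectorSpace_apply]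

theorem SmoothFormAt.vectorSpace {α : DForm E E V k} {x : E} (h : SmoothFormAt α x) :
    ContDiffAt ℝ ∞ α.at x := by
  have := h
  rwa [SmoothFormAt, formInChart_vectorSpace, extChartAt_vectorSpace_apply] at this

theorem extDeriv_one_apply {η : E → E [⋀^Fin 1]→L[ℝ] V} {x : E} (h : DifferentiableAt ℝ η x)
    (v : Fin 2 → E) :
    extDeriv η x v = fderiv ℝ (fun y => η y ![v 1]) x (v 0) -
      fderiv ℝ (fun y => η y ![v 0]) x (v 1) := by
  have e0 : Fin.removeNth 0 v = ![v 1] := by funext i; fin_cases i; rfl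
  have e1 : Fin.removeNth 1 v = ![v 0] := by funext i; fin_cases i; rfl
  rw [extDeriv_apply h, Fin.sum_univ_two, e0, e1]
  simp [sub_eq_add_neg]

theorem extD_addForm {α β : DForm E M V k} {m : M} (hα : SmoothFormAt α m)
    (hβ : SmoothFormAt β m) (v : Fin (k + 1) → E) :
    DForm.at (extD (addForm α β)) m v = DForm.at (extD α) m v + DForm.at (extD β) m v := by
  rw [extD_at_center, extD_at_center, extD_at_center, formInChart_addForm,
    extDeriv_fun_add (hα.differentiableAt (by simp)) (hβ.differentiableAt (by simp))]
  rfl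

/-- The Leibniz rule for the exterior derivative of a `1`-form acted on by linear maps. -/
theorem extD_actForm {A : M → V →L[ℝ] W} {α : DForm E M V 1} {m : M}
    (hA : SmoothAt E (V →L[ℝ] W) A m) (hα : SmoothFormAt α m) (v : Fin 2 → E) :
    DForm.at (extD (actForm A α)) m v = A m (DForm.at (extD α) m v) +
      (dmap E W (fun x => A x (α.lin m (v 1))) m (v 0) -
        dmap E W (fun x => A x (α.lin m (v 0))) m (v 1)) := by
  have hA' := smoothAt_in_chart (f := A) hA
  set y₀ := extChartAt 𝓘(ℝ, E) m m with hy₀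
  have hd := hA'.differentiableAt (by simp)
  -- The product rule in the chart at `m`: the term that differentiates `A` has the value of α
  -- frozen at `m`, which allows it to be written intrinsically as a `dmap`.
  have key : ∀ u w : E, fderiv ℝ (fun y => formInChart (actForm A α) m y ![u]) y₀ w =
      dmap E W (fun x => A x (α.lin m u)) m w +
        A m (fderiv ℝ (fun y => formInChart α m y ![u]) y₀ w) := by
    intro u w
    have hu : DifferentiableAt ℝ (fun y => formInChart α m y ![u]) y₀ :=
      (contDiffAt_alternating_iff.1 hα _).differentiableAt (by simp)
    have h1 : (fun y => formInChart (actForm A α) m y ![u]) = fun y =>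
        (A ((extChartAt 𝓘(ℝ, E) m).symm y)) (formInChart α m y ![u]) := rfl
    have hc : formInChart α m y₀ ![u] = α.lin m u := by
      rw [hy₀, formInChart_center, DForm.lin_apply]
    have h2 : dmap E W (fun x => A x (α.lin m u)) m w =
        fderiv ℝ (fun y => A ((extChartAt 𝓘(ℝ, E) m).symm y)) y₀ w (α.lin m u) := by
      have hS : SmoothAt E W (fun x => A x (α.lin m u)) ((extChartAt 𝓘(ℝ, E) m).symm y₀) := by
        rw [hy₀, extChartAt_to_inv m]
        exact hA.clm_apply contMDiffAt_const
      have h3 := dmap_comp hS (smoothAt_chart_symm (center_mem m))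
      rw [show dmap E E (extChartAt 𝓘(ℝ, E) m).symm y₀ = _ from dmap_chart_symm_self m,
        ContinuousLinearMap.comp_id, show (extChartAt 𝓘(ℝ, E) m).symm y₀ = m from
        extChartAt_to_inv m, dmap_eq_fderiv] at h3
      rw [← h3]
      have := (hd.hasFDerivAt.clm_apply (hasFDerivAt_const (α.lin m u) y₀)).fderiv
      rw [this]
      simp
    rw [h1, (hd.hasFDerivAt.clm_apply hu.hasFDerivAt).fderiv, h2, hc]
    have : A ((extChartAt 𝓘(ℝ, E) m).symm y₀) = A m := by rw [hy₀, extChartAt_to_inv m]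
    simp only [add_apply, ContinuousLinearMap.comp_apply,
      ContinuousLinearMap.flip_apply]
    rw [this, add_comm]
  rw [extD_at_center, extD_at_center, ← hy₀,
    extDeriv_one_apply ((hα.act hA).differentiableAt (by simp)),
    extDeriv_one_apply (hα.differentiableAt (by simp)), key, key, map_sub]
  abel

end FormAlgebra

/-! ### The adjoint action and logarithmic derivatives -/

section LieGroupCalculus

variable {𝔤 : Type*} [NormedAddCommGroup 𝔤] [NormedSpace ℝ 𝔤]
  {G : Type*} [TopologicalSpace G] [ChartedSpace 𝔤 G] [Group G] [LieGroup 𝓘(ℝ, 𝔤) ∞ G]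
  {E : Type*} [NormedAddCommGroup E] [NormedSpace ℝ E]
  {M : Type*} [TopologicalSpace M] [ChartedSpace E M]
  {E' : Type*} [NormedAddCommGroup E'] [NormedSpace ℝ E']
  {N : Type*} [TopologicalSpace N] [ChartedSpace E' N]

theorem SmoothAt.mul {a b : M → G} {m : M} (ha : SmoothAt E 𝔤 a m) (hb : SmoothAt E 𝔤 b m) :
    SmoothAt E 𝔤 (fun x => a x * b x) m := ContMDiffAt.mul ha hb

theorem SmoothAt.inv {a : M → G} {m : M} (ha : SmoothAt E 𝔤 a m) :
    SmoothAt E 𝔤 (fun x => (a x)⁻¹) m := ContMDiffAt.inv ha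

theorem smoothAt_const (g : G) (m : M) : SmoothAt E 𝔤 (fun _ : M => g) m := contMDiffAt_const

theorem smoothAt_id (g : G) : SmoothAt 𝔤 𝔤 (fun x : G => x) g := contMDiffAt_id

theorem smoothAt_mul_left (a g : G) : SmoothAt 𝔤 𝔤 (fun x : G => a * x) g :=
  (smoothAt_const a g).mul (smoothAt_id g)

theorem smoothAt_conj (a g : G) : SmoothAt 𝔤 𝔤 (fun x : G => a * x * a⁻¹) g :=
  (smoothAt_mul_left a g).mul (smoothAt_const _ g)

theorem Ad_def (g : G) : (Ad g : 𝔤 →L[ℝ] 𝔤) = dmap 𝔤 𝔤 (fun x : G => g * x * g⁻¹) 1 := rfl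

theorem Ad_one : (Ad (1 : G) : 𝔤 →L[ℝ] 𝔤) = ContinuousLinearMap.id ℝ 𝔤 := by
  rw [Ad_def, ← dmap_id (E := 𝔤) (1 : G)]
  simp

theorem Ad_mul (g h : G) : (Ad (g * h) : 𝔤 →L[ℝ] 𝔤) = (Ad g).comp (Ad h) := by
  have e : (fun x : G => g * h * x * (g * h)⁻¹) = fun x => g * (h * x * h⁻¹) * g⁻¹ := by
    funext x; group
  rw [Ad_def, Ad_def, Ad_def, e, dmap_comp (g := fun x => g * x * g⁻¹) (smoothAt_conj g _)
    (smoothAt_conj h 1)]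
  simp

theorem Ad_mul_apply (g h : G) (ξ : 𝔤) : Ad (g * h) ξ = Ad g (Ad h ξ) := by
  rw [Ad_mul]; rfl

theorem Ad_inv_Ad (g : G) (ξ : 𝔤) : Ad g⁻¹ (Ad g ξ) = ξ := by
  rw [← Ad_mul_apply, inv_mul_cancel, Ad_one]; rfl

theorem Ad_Ad_inv (g : G) (ξ : 𝔤) : Ad g (Ad g⁻¹ ξ) = ξ := by
  rw [← Ad_mul_apply, mul_inv_cancel, Ad_one]; rfl

/-- The logarithmic derivative `a⁻¹da` as a map between the model spaces. -/
def logD (E : Type*) [NormedAddCommGroup E] [NormedSpace ℝ E] (𝔤 : Type*) [NormedAddCommGroup 𝔤]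
    [NormedSpace ℝ 𝔤] {G : Type*} [TopologicalSpace G] [ChartedSpace 𝔤 G] [Group G]
    {M : Type*} [TopologicalSpace M] [ChartedSpace E M] (a : M → G) (m : M) : E →L[ℝ] 𝔤 :=
  dmap E 𝔤 (fun x => (a m)⁻¹ * a x) m

/-- The Maurer-Cartan form as a map between the model spaces. -/
def mc (g : G) : 𝔤 →L[ℝ] 𝔤 := maurerCartan g

theorem mc_eq (g : G) : (mc g : 𝔤 →L[ℝ] 𝔤) = logD 𝔤 𝔤 (fun x : G => x) g := rfl

theorem logD_comp {a : M → G} {f : N → M} {n : N} (ha : SmoothAt E 𝔤 a (f n))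
    (hf : SmoothAt E' E f n) (v : E') :
    logD E' 𝔤 (fun x => a (f x)) n v = logD E 𝔤 a (f n) (dmap E' E f n v) :=
  dmap_comp_apply (g := fun x => (a (f n))⁻¹ * a x) ((smoothAt_const _ _).mul ha) hf v

theorem logDeriv_eq {a : M → G} {m : M} (ha : SmoothAt E 𝔤 a m) (v : E) :
    CosetGauge.logDeriv (𝔤 := 𝔤) a m v = logD E 𝔤 a m v :=
  (logD_comp (a := fun x : G => x) (smoothAt_id _) ha v).symm

theorem mc_dmap {a : M → G} {m : M} (ha : SmoothAt E 𝔤 a m) (v : E) :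
    mc (a m) (dmap E 𝔤 a m v) = logD E 𝔤 a m v :=
  (logD_comp (a := fun x : G => x) (smoothAt_id _) ha v).symm

/-- The differential of the multiplication at (1, 1) is addition, because both partial maps there
are the identity. -/
theorem dmap_mul_of_eq_one {a b : M → G} {m : M} (ha : SmoothAt E 𝔤 a m)
    (hb : SmoothAt E 𝔤 b m) (ha1 : a m = 1) (hb1 : b m = 1) :
    dmap E 𝔤 (fun x => a x * b x) m = dmap E 𝔤 a m + dmap E 𝔤 b m := by
  have hm : ContMDiff (𝓘(ℝ, 𝔤).prod 𝓘(ℝ, 𝔤)) 𝓘(ℝ, 𝔤) ∞ (fun p : G × G => p.1 * p.2) :=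
    contMDiff_mul _ _
  have dm : MDifferentiableAt (𝓘(ℝ, 𝔤).prod 𝓘(ℝ, 𝔤)) 𝓘(ℝ, 𝔤) (fun p : G × G => p.1 * p.2)
    (a m, b m) := hm.mdifferentiableAt (by simp)
  have hc := mfderiv_comp (I' := 𝓘(ℝ, 𝔤).prod 𝓘(ℝ, 𝔤)) m dm (ha.mdiff.prodMk hb.mdiff)
  have key : ∀ u v : 𝔤, (mfderiv (𝓘(ℝ, 𝔤).prod 𝓘(ℝ, 𝔤)) 𝓘(ℝ, 𝔤)
      (fun p : G × G => p.1 * p.2) (a m, b m) : 𝔤 × 𝔤 →L[ℝ] 𝔤) (u, v) = u + v := by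
    intro u v
    have := mfderiv_prod_eq_add_apply (v := (u, v)) dm
    refine this.trans ?_
    have hid : ∀ (f : G → G) (x : G) (u : 𝔤), f = id →
        (mfderiv 𝓘(ℝ, 𝔤) 𝓘(ℝ, 𝔤) f x : 𝔤 →L[ℝ] 𝔤) u = u := by
      rintro f x u rfl
      rw [mfderiv_id]
      rfl
    exact congrArg₂ (· + ·) (hid _ _ u (by ext z; simp [hb1])) (hid _ _ v (by ext z; simp [ha1]))
  have e := mfderiv_prodMk ha.mdiff hb.mdiff
  change (mfderiv 𝓘(ℝ, E) 𝓘(ℝ, 𝔤) ((fun p : G × G => p.1 * p.2) ∘ fun t => (a t, b t)) m :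
    E →L[ℝ] 𝔤) = _
  rw [hc, e]
  exact ContinuousLinearMap.ext fun v => key _ _

/-- Up to conjugation by b(m)⁻¹, the translated product splits as a(m)⁻¹a(x) times b(m)⁻¹b(x). Both
factors equal 1 at m, so their differentials add. -/
theorem logD_mul {a b : M → G} {m : M} (ha : SmoothAt E 𝔤 a m) (hb : SmoothAt E 𝔤 b m) (v : E) :
    logD E 𝔤 (fun x => a x * b x) m v = Ad (b m)⁻¹ (logD E 𝔤 a m v) + logD E 𝔤 b m v := by
  have h1 : SmoothAt E 𝔤 (fun x => (a m)⁻¹ * a x) m := (smoothAt_const _ _).mul ha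
  have h2 : SmoothAt E 𝔤 (fun x => (b m)⁻¹ * b x) m := (smoothAt_const _ _).mul hb
  have h3 : SmoothAt 𝔤 𝔤 (fun x : G => (b m)⁻¹ * x * (b m)⁻¹⁻¹) ((a m)⁻¹ * a m) :=
    smoothAt_conj _ _
  have e : (fun x => (a m * b m)⁻¹ * (a x * b x)) = fun x =>
      ((b m)⁻¹ * ((a m)⁻¹ * a x) * (b m)⁻¹⁻¹) * ((b m)⁻¹ * b x) := by
    funext x; group
  have h4 := dmap_mul_of_eq_one (𝔤 := 𝔤) (a := fun x => (b m)⁻¹ * ((a m)⁻¹ * a x) * (b m)⁻¹⁻¹)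
    (SmoothAt.comp (g := fun x : G => (b m)⁻¹ * x * (b m)⁻¹⁻¹)
      (f := fun x => (a m)⁻¹ * a x) (x := m) h3 h1) h2 (by simp) (by simp)
  have h5 := dmap_comp_apply (g := fun x : G => (b m)⁻¹ * x * (b m)⁻¹⁻¹)
    (f := fun x => (a m)⁻¹ * a x) (x := m) h3 h1 v
  rw [inv_mul_cancel] at h5
  change dmap E 𝔤 (fun x => (a m * b m)⁻¹ * (a x * b x)) m v = _
  rw [e, h4]
  exact congrArg (· + _) h5

theorem logD_const (g : G) (m : M) : logD E 𝔤 (fun _ : M => g) m = 0 := dmap_const _ _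

theorem logD_const_mul {a : M → G} {m : M} (g : G) (ha : SmoothAt E 𝔤 a m) (v : E) :
    logD E 𝔤 (fun x => g * a x) m v = logD E 𝔤 a m v := by
  rw [logD_mul (smoothAt_const _ _) ha, logD_const]
  simp

theorem logD_mul_const {a : M → G} {m : M} (g : G) (ha : SmoothAt E 𝔤 a m) (v : E) :
    logD E 𝔤 (fun x => a x * g) m v = Ad g⁻¹ (logD E 𝔤 a m v) := by
  rw [logD_mul ha (smoothAt_const _ _), logD_const]
  simp

theorem logD_of_eq_one {a : M → G} {m : M} (h : a m = 1) :
    logD E 𝔤 a m = dmap E 𝔤 a m := by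
  simp [logD, h]

theorem logD_conj (g x : G) (v : 𝔤) :
    logD 𝔤 𝔤 (fun y : G => g * y * g⁻¹) x v = Ad g (mc x v) := by
  rw [logD_mul_const _ (smoothAt_mul_left g x), logD_const_mul _ (smoothAt_id x), inv_inv,
    mc_eq]

theorem mc_mul_left (a g : G) (v : 𝔤) :
    mc (a * g) (dmap 𝔤 𝔤 (fun x : G => a * x) g v) =
      mc g v := by
  rw [mc_dmap (a := fun x : G => a * x) (smoothAt_mul_left a g),
    logD_const_mul _ (smoothAt_id g), mc_eq]

theorem mc_one : (mc (1 : G) : 𝔤 →L[ℝ] 𝔤) = ContinuousLinearMap.id ℝ 𝔤 := by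
  rw [mc_eq, logD_of_eq_one (a := fun x : G => x) (m := (1 : G)) rfl, dmap_id]

theorem mc_comp_left (g : G) (ξ : 𝔤) :
    mc g (dmap 𝔤 𝔤 (fun x : G => g * x) 1 ξ) = ξ := by
  have := mc_mul_left g 1 ξ
  rw [mul_one, mc_one] at this
  exact this

theorem left_comp_mc (g : G) (v : 𝔤) :
    dmap 𝔤 𝔤 (fun x : G => g * x) 1 (mc g v) = v := by
  have h := dmap_comp_apply (g := fun x : G => g * x) (f := fun x : G => g⁻¹ * x) (x := g)
    (smoothAt_mul_left g _) (smoothAt_mul_left g⁻¹ g) v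
  rw [inv_mul_cancel] at h
  have e : (fun y : G => g * (g⁻¹ * y)) = fun y => y := by funext y; group
  rw [e, dmap_id] at h
  exact h.symm

variable (𝔤 G) in
/-- The Maurer-Cartan form of `G`. -/
def mcForm : DForm 𝔤 G 𝔤 1 := oneForm (mc (𝔤 := 𝔤) (G := G))

theorem pullback_mcForm_lin {a : M → G} {m : M} (ha : SmoothAt E 𝔤 a m) :
    DForm.lin (E := E) (pullback a (mcForm 𝔤 G)) m = logD E 𝔤 a m := by
  ext v
  exact mc_dmap ha v

theorem pullback_mul_left_mcForm (g : G) :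
    pullback (E := 𝔤) (fun x : G => g * x) (mcForm 𝔤 G) = mcForm 𝔤 G :=
  DForm.ext_lin fun x v => mc_mul_left g x v

variable [FiniteDimensional ℝ 𝔤]

/-- Partial derivatives of maps to `G` that are constant equal to `1` along a graph. -/
theorem contDiffAt_dmap_of_eq_one {X : Type*} [NormedAddCommGroup X] [NormedSpace ℝ X]
    {Y : Type*} [NormedAddCommGroup Y] [NormedSpace ℝ Y] {F : X → Y → G} {y : X → Y} {x₀ : X}
    (hF : SmoothAt (X × Y) 𝔤 (fun p : X × Y => F p.1 p.2) (x₀, y x₀))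
    (hy : ContDiffAt ℝ ∞ y x₀) (h1 : ∀ x, F x (y x) = 1) :
    ContDiffAt ℝ ∞ (fun x => dmap Y 𝔤 (F x) (y x)) x₀ := by
  -- All values along the graph are 1, so the one chart at 1 serves for every `x`; its differential
  -- at 1 is the identity, and the coordinate derivative is the intrinsic one.
  have hc : SmoothAt 𝔤 𝔤 (extChartAt 𝓘(ℝ, 𝔤) (1 : G)) (F x₀ (y x₀)) := by
    rw [h1]; exact smoothAt_chart (mem_chart_source 𝔤 1)
  have h2 : ContDiffAt ℝ ∞ (Function.uncurry fun x z => extChartAt 𝓘(ℝ, 𝔤) (1 : G) (F x z))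
      (x₀, y x₀) := by
    rw [← smoothAt_iff_contDiffAt]
    exact SmoothAt.comp (E := 𝔤) (f := fun p : X × Y => F p.1 p.2) hc hF
  refine (ContDiffAt.fderiv (m := ∞) h2 hy (by simp)).congr_of_eventuallyEq ?_
  have hy1 : Filter.Tendsto (fun x => (x, y x)) (𝓝 x₀) (𝓝 (x₀, y x₀)) :=
    (continuousAt_id.prodMk hy.continuousAt).tendsto
  filter_upwards [hy1.eventually (SmoothAt.eventually_one hF)] with x hx
  have hxy : MDifferentiableAt 𝓘(ℝ, Y) 𝓘(ℝ, 𝔤) (F x) (y x) := by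
    have hi : MDifferentiableAt 𝓘(ℝ, Y) 𝓘(ℝ, X × Y) (fun z : Y => ((x, z) : X × Y)) (y x) :=
      ((differentiableAt_const x).prodMk differentiableAt_id).mdifferentiableAt
    exact MDifferentiableAt.comp (y x) (I' := 𝓘(ℝ, X × Y)) (f := fun z : Y => ((x, z) : X × Y))
      (g := fun p : X × Y => F p.1 p.2) hx hi
  have hch : SmoothAt 𝔤 𝔤 (extChartAt 𝓘(ℝ, 𝔤) (1 : G)) (F x (y x)) := by
    rw [h1]; exact smoothAt_chart (mem_chart_source 𝔤 1)
  have h3 : dmap Y 𝔤 (fun z => extChartAt 𝓘(ℝ, 𝔤) (1 : G) (F x z)) (y x) =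
      (dmap 𝔤 𝔤 (extChartAt 𝓘(ℝ, 𝔤) (1 : G)) (F x (y x))).comp (dmap Y 𝔤 (F x) (y x)) :=
    mfderiv_comp (y x) hch.mdiff hxy
  rw [h1, dmap_chart_self, ContinuousLinearMap.id_comp, dmap_eq_fderiv] at h3
  exact h3.symm

/-- In the chart, the form at x is the z-derivative at z = x of ψ⁻¹(x)⁻¹ψ⁻¹(z), a smooth map equal
to 1 on the diagonal. -/
theorem smoothFormAt_mcForm_one : SmoothFormAt (mcForm 𝔤 G) 1 := by
  set ψ := extChartAt 𝓘(ℝ, 𝔤) (1 : G) with hψ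
  have hs : SmoothAt 𝔤 𝔤 ψ.symm (ψ 1) := smoothAt_chart_symm (center_mem (1 : G))
  have h := contDiffAt_dmap_of_eq_one (𝔤 := 𝔤) (G := G) (X := 𝔤) (Y := 𝔤) (x₀ := ψ 1)
    (F := fun x z => (ψ.symm x)⁻¹ * ψ.symm z) (y := fun x => x)
    (by
      refine SmoothAt.mul (SmoothAt.inv ?_) ?_
      · exact SmoothAt.comp (f := fun p : 𝔤 × 𝔤 => p.1) hs
          (smoothAt_iff_contDiffAt.2 contDiffAt_fst)
      · exact SmoothAt.comp (f := fun p : 𝔤 × 𝔤 => p.2) hs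
          (smoothAt_iff_contDiffAt.2 contDiffAt_snd))
    contDiffAt_id (by simp)
  refine contDiffAt_alternating_iff.2 fun v => ?_
  refine (h.clm_apply (contDiffAt_const (c := v 0))).congr_of_eventuallyEq ?_
  filter_upwards [(isOpen_target (1 : G)).mem_nhds (center_mem (1 : G))] with y hy
  rw [formInChart_one]
  exact mc_dmap (a := ψ.symm) (smoothAt_chart_symm hy) (v 0)

/-- Left invariance transports smoothness from the identity to every point. -/
theorem smoothFormAt_mcForm (g : G) : SmoothFormAt (mcForm 𝔤 G) g := by
  rw [← pullback_mul_left_mcForm g⁻¹]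
  refine SmoothFormAt.pullback ?_ (smoothAt_mul_left _ _)
  rw [inv_mul_cancel]
  exact smoothFormAt_mcForm_one

/-- Ad(x) is the derivative at the identity of z ↦ xzx⁻¹, a map smooth in both variables that sends
the identity to 1 for every x. -/
theorem smoothAt_Ad (g : G) : SmoothAt 𝔤 (𝔤 →L[ℝ] 𝔤) (fun x : G => (Ad x : 𝔤 →L[ℝ] 𝔤)) g := by
  set ψ := extChartAt 𝓘(ℝ, 𝔤) (1 : G) with hψ
  set χ := extChartAt 𝓘(ℝ, 𝔤) g with hχ
  have hs : SmoothAt 𝔤 𝔤 ψ.symm (ψ 1) := smoothAt_chart_symm (center_mem (1 : G))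
  have ht : SmoothAt 𝔤 𝔤 χ.symm (χ g) := smoothAt_chart_symm (center_mem g)
  have e1 : ψ.symm (ψ 1) = 1 := extChartAt_to_inv (1 : G)
  have h := contDiffAt_dmap_of_eq_one (𝔤 := 𝔤) (G := G) (X := 𝔤) (Y := 𝔤) (x₀ := χ g)
    (F := fun x z => χ.symm x * ψ.symm z * (χ.symm x)⁻¹) (y := fun _ => ψ 1)
    (by
      have h1 : SmoothAt (𝔤 × 𝔤) 𝔤 (fun p : 𝔤 × 𝔤 => χ.symm p.1) (χ g, ψ 1) :=
        SmoothAt.comp (f := fun p : 𝔤 × 𝔤 => p.1) ht (smoothAt_iff_contDiffAt.2 contDiffAt_fst)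
      refine SmoothAt.mul (SmoothAt.mul h1 ?_) (SmoothAt.inv h1)
      exact SmoothAt.comp (f := fun p : 𝔤 × 𝔤 => p.2) hs
          (smoothAt_iff_contDiffAt.2 contDiffAt_snd))
    contDiffAt_const (by intro x; simp [e1])
  have h2 : (fun x => dmap 𝔤 𝔤 (fun z => χ.symm x * ψ.symm z * (χ.symm x)⁻¹) (ψ 1)) =
      fun x => (Ad (χ.symm x) : 𝔤 →L[ℝ] 𝔤) := by
    funext x
    rw [dmap_comp (g := fun z : G => χ.symm x * z * (χ.symm x)⁻¹) (smoothAt_conj _ _) hs, e1,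
      dmap_chart_symm_self]
    rfl
  rw [h2, ← smoothAt_iff_contDiffAt] at h
  have h3 := SmoothAt.comp (g := fun x => (Ad (χ.symm x) : 𝔤 →L[ℝ] 𝔤)) (f := χ) (x := g) h
    (smoothAt_chart (mem_chart_source 𝔤 g))
  refine h3.congr_of_eventuallyEq ?_
  filter_upwards [(chartAt 𝔤 g).open_source.mem_nhds (mem_chart_source 𝔤 g)] with z hz
  rw [χ.left_inv (by rwa [hχ, extChartAt_source])]

theorem SmoothAt.Ad {a : M → G} {m : M} (ha : SmoothAt E 𝔤 a m) :
    SmoothAt E (𝔤 →L[ℝ] 𝔤) (fun x => (CosetGauge.Ad (a x) : 𝔤 →L[ℝ] 𝔤)) m :=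
  SmoothAt.comp (smoothAt_Ad _) ha

end LieGroupCalculus

/-! ### The bracket and the Maurer-Cartan equation -/

section Bracket

variable {𝔤 : Type*} [NormedAddCommGroup 𝔤] [NormedSpace ℝ 𝔤] [FiniteDimensional ℝ 𝔤]
  {G : Type*} [TopologicalSpace G] [ChartedSpace 𝔤 G] [Group G] [LieGroup 𝓘(ℝ, 𝔤) ∞ G]
  {E : Type*} [NormedAddCommGroup E] [NormedSpace ℝ E] [FiniteDimensional ℝ E]
  {M : Type*} [TopologicalSpace M] [ChartedSpace E M] [IsManifold 𝓘(ℝ, E) ∞ M]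

variable (𝔤 G) in
theorem lieGroup_minSmoothness : LieGroup 𝓘(ℝ, 𝔤) (minSmoothness ℝ 3) G := by
  refine LieGroup.of_le (n := ∞) ?_
  rw [minSmoothness_of_isRCLikeNormedField]
  exact WithTop.coe_le_coe.2 le_top

variable (G) in
theorem lieBr_add_left (ξ η ζ : 𝔤) : lieBr G (ξ + η) ζ = lieBr G ξ ζ + lieBr G η ζ := by
  have := lieGroup_minSmoothness 𝔤 G
  have := FiniteDimensional.complete ℝ 𝔤
  exact add_lie (L := GroupLieAlgebra 𝓘(ℝ, 𝔤) G) (M := GroupLieAlgebra 𝓘(ℝ, 𝔤) G) ξ η ζ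

variable (G) in
theorem lieBr_add_right (ξ η ζ : 𝔤) : lieBr G ξ (η + ζ) = lieBr G ξ η + lieBr G ξ ζ := by
  have := lieGroup_minSmoothness 𝔤 G
  have := FiniteDimensional.complete ℝ 𝔤
  exact lie_add (L := GroupLieAlgebra 𝓘(ℝ, 𝔤) G) (M := GroupLieAlgebra 𝓘(ℝ, 𝔤) G) ξ η ζ

variable (G) in
theorem lieBr_smul_left (c : ℝ) (ξ η : 𝔤) : lieBr G (c • ξ) η = c • lieBr G ξ η := by
  have := lieGroup_minSmoothness 𝔤 G
  have := FiniteDimensional.complete ℝ 𝔤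
  exact smul_lie (L := GroupLieAlgebra 𝓘(ℝ, 𝔤) G) (M := GroupLieAlgebra 𝓘(ℝ, 𝔤) G) c ξ η

variable (G) in
theorem lieBr_smul_right (c : ℝ) (ξ η : 𝔤) : lieBr G ξ (c • η) = c • lieBr G ξ η := by
  have := lieGroup_minSmoothness 𝔤 G
  have := FiniteDimensional.complete ℝ 𝔤
  exact lie_smul (L := GroupLieAlgebra 𝓘(ℝ, 𝔤) G) (M := GroupLieAlgebra 𝓘(ℝ, 𝔤) G) c ξ η

variable (G) in
theorem lieBr_swap (ξ η : 𝔤) : lieBr G ξ η = -lieBr G η ξ := by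
  have := lieGroup_minSmoothness 𝔤 G
  have := FiniteDimensional.complete ℝ 𝔤
  exact (lie_skew (L := GroupLieAlgebra 𝓘(ℝ, 𝔤) G) ξ η).symm

variable (𝔤 G) in
/-- The Lie bracket as a continuous bilinear map. -/
def brL : 𝔤 →L[ℝ] 𝔤 →L[ℝ] 𝔤 :=
  LinearMap.toContinuousLinearMap
    ((LinearMap.toContinuousLinearMap : (𝔤 →ₗ[ℝ] 𝔤) ≃ₗ[ℝ] (𝔤 →L[ℝ] 𝔤)).toLinearMap ∘ₗ
      LinearMap.mk₂ ℝ (lieBr (𝔤 := 𝔤) G) (lieBr_add_left G) (lieBr_smul_left G)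
        (lieBr_add_right G) (lieBr_smul_right G))

open VectorField in
/-- The Maurer-Cartan equation at the identity. -/
theorem extD_mcForm_one (ξ η : 𝔤) :
    DForm.at (extD (mcForm 𝔤 G)) 1 ![ξ, η] = -lieBr G ξ η := by
  have := lieGroup_minSmoothness 𝔤 G
  have hcs := FiniteDimensional.complete ℝ 𝔤
  have : IsManifold 𝓘(ℝ, 𝔤) 1 G := isManifold_one_of_infty
  have : IsManifold 𝓘(ℝ, 𝔤) 2 G := IsManifold.of_le (n := ∞) (WithTop.coe_le_coe.2 le_top)
  set ψ := extChartAt 𝓘(ℝ, 𝔤) (1 : G) with hψ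
  let X : 𝔤 → (g : G) → TangentSpace 𝓘(ℝ, 𝔤) g := fun ζ => mulInvariantVectorField (G := G) ζ
  -- The left-invariant field of ζ, read in the chart at 1.
  let Z : 𝔤 → 𝔤 → 𝔤 := fun ζ =>
    mpullbackWithin 𝓘(ℝ, 𝔤) 𝓘(ℝ, 𝔤) ψ.symm (X ζ) (Set.range 𝓘(ℝ, 𝔤))
  have hrange : Set.range 𝓘(ℝ, 𝔤) = Set.univ := by simp
  have hZd : ∀ ζ, DifferentiableAt ℝ (Z ζ) (ψ 1) := by
    intro ζ
    have h1 : MDifferentiableAt 𝓘(ℝ, 𝔤) 𝓘(ℝ, 𝔤).tangent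
        (fun g : G => (X ζ g : TangentBundle 𝓘(ℝ, 𝔤) G)) 1 :=
      mdifferentiableAt_mulInvariantVectorField (G := G) (I := 𝓘(ℝ, 𝔤)) ζ
    have h2 : DifferentiableWithinAt ℝ (Z ζ)
        (ψ.symm ⁻¹' Set.univ ∩ Set.range 𝓘(ℝ, 𝔤)) (ψ 1) :=
      MDifferentiableWithinAt.differentiableWithinAt_mpullbackWithin_vectorField
        (s := Set.univ) h1.mdifferentiableWithinAt
    rw [Set.preimage_univ, Set.univ_inter, hrange] at h2
    exact differentiableWithinAt_univ.1 h2
  have hsymm : ∀ y ∈ ψ.target, ∀ ζ, dmap 𝔤 𝔤 ψ.symm y (Z ζ y) = X ζ (ψ.symm y) := by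
    intro y hy ζ
    have hinv : (mfderivWithin 𝓘(ℝ, 𝔤) 𝓘(ℝ, 𝔤) ψ.symm (Set.range 𝓘(ℝ, 𝔤)) y).IsInvertible :=
      isInvertible_mfderivWithin_extChartAt_symm hy
    have h3 : (mfderivWithin 𝓘(ℝ, 𝔤) 𝓘(ℝ, 𝔤) ψ.symm (Set.range 𝓘(ℝ, 𝔤)) y) (Z ζ y) =
        X ζ (ψ.symm y) := hinv.self_apply_inverse _
    have h4 : dmap 𝔤 𝔤 ψ.symm y =
        mfderivWithin 𝓘(ℝ, 𝔤) 𝓘(ℝ, 𝔤) ψ.symm (Set.range 𝓘(ℝ, 𝔤)) y := by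
      rw [hrange, mfderivWithin_univ]; rfl
    rw [h4]; exact h3
  -- The Maurer-Cartan form is constant on left-invariant fields.
  have hval : ∀ ζ, ∀ᶠ y in 𝓝 (ψ 1), formInChart (mcForm 𝔤 G) 1 y ![Z ζ y] = ζ := by
    intro ζ
    filter_upwards [(isOpen_target (1 : G)).mem_nhds (center_mem (1 : G))] with y hy
    rw [formInChart_one]
    change mc (ψ.symm y) (dmap 𝔤 𝔤 ψ.symm y (Z ζ y)) = ζ
    rw [hsymm y hy ζ]
    exact mc_comp_left _ ζ
  have hbr : lieBr G ξ η = lieBracket ℝ (Z ξ) (Z η) (ψ 1) := by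
    have h1 : lieBr G ξ η = mlieBracket 𝓘(ℝ, 𝔤) (X ξ) (X η) (1 : G) := rfl
    have h2 : lieBr G ξ η = (dmap 𝔤 𝔤 ψ 1).inverse (lieBracketWithin ℝ (Z ξ) (Z η)
        (ψ.symm ⁻¹' Set.univ ∩ Set.range 𝓘(ℝ, 𝔤)) (ψ 1)) := by
      rw [h1, ← mlieBracketWithin_univ]
      exact mlieBracketWithin_apply
    rw [h2, hψ, dmap_chart_self, ContinuousLinearMap.inverse_id, Set.preimage_univ,
      Set.univ_inter, hrange, lieBracketWithin_univ]
    rfl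
  have hcenter : ∀ ζ, Z ζ (ψ 1) = ζ := by
    intro ζ
    have h1 := (hval ζ).self_of_nhds
    rw [hψ, formInChart_center, ← DForm.lin_apply] at h1
    change mc (1 : G) (Z ζ (ψ 1)) = ζ at h1
    rwa [mc_one] at h1
  have hd : DifferentiableAt ℝ (formInChart (mcForm 𝔤 G) 1) (ψ 1) :=
    ContDiffAt.differentiableAt smoothFormAt_mcForm_one (by simp)
  -- In dω(X, Y) = X ω(Y) - Y ω(X) - ω([X, Y]) the first two terms differentiate constants, so only
  -- the bracket survives.
  have h5 := extDeriv_apply_vectorField (n := 0) (V := ![Z ξ, Z η]) hd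
    (by intro i; fin_cases i; exacts [hZd ξ, hZd η])
  have hv : (fun i => (![Z ξ, Z η] : Fin 2 → 𝔤 → 𝔤) i (ψ 1)) = ![ξ, η] := by
    funext i; fin_cases i; exacts [hcenter ξ, hcenter η]
  rw [extD_at_center, ← hψ, ← hv]
  rw [h5]
  have hz : ∀ (ζ : 𝔤) (w : 𝔤), fderiv ℝ (fun y => formInChart (mcForm 𝔤 G) 1 y ![Z ζ y]) (ψ 1) w
      = 0 := by
    intro ζ w
    have : (fun y => formInChart (mcForm 𝔤 G) 1 y ![Z ζ y]) =ᶠ[𝓝 (ψ 1)] fun _ => ζ := hval ζ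
    rw [this.fderiv_eq]
    simp
  have e0 : ∀ x, Fin.removeNth (0 : Fin 2) (fun i => (![Z ξ, Z η] : Fin 2 → 𝔤 → 𝔤) i x) =
      ![Z η x] := by
    intro x; funext i; fin_cases i; rfl
  have e1 : ∀ x, Fin.removeNth (1 : Fin 2) (fun i => (![Z ξ, Z η] : Fin 2 → 𝔤 → 𝔤) i x) =
      ![Z ξ x] := by
    intro x; funext i; fin_cases i; rfl
  rw [Fin.sum_univ_two]
  simp only [e0, e1, hz]
  have hs : ∀ w : Fin 1 → 𝔤, formInChart (mcForm 𝔤 G) 1 (ψ 1) w = w 0 := by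
    intro w
    rw [hψ, formInChart_center, DForm.at_eq_lin]
    change mc (1 : G) (w 0) = w 0
    rw [mc_one]; rfl
  rw [hbr]
  simp [hs]

/-- The Maurer-Cartan equation. -/
theorem extD_mcForm (g : G) (v : Fin 2 → 𝔤) :
    DForm.at (extD (mcForm 𝔤 G)) g v = -lieBr G (mc g (v 0)) (mc g (v 1)) := by
  have h := extD_pullback (E' := 𝔤) (f := fun x : G => g⁻¹ * x) (n := g)
    (smoothFormAt_mcForm (𝔤 := 𝔤) (g⁻¹ * g)) (smoothAt_mul_left g⁻¹ g)
  rw [pullback_mul_left_mcForm, pullback_at, inv_mul_cancel] at h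
  rw [h, ← extD_mcForm_one]
  change DForm.at (extD (mcForm 𝔤 G)) 1 (fun i => mc g (v i)) = _
  congr 1
  funext i; fin_cases i <;> rfl

/-- The pulled back Maurer-Cartan form `a⁻¹da`. -/
def logForm (a : M → G) : DForm E M 𝔤 1 := oneForm (logD E 𝔤 a)

theorem logForm_eq_pullback {a : M → G} (ha : ∀ m, SmoothAt E 𝔤 a m) :
    logForm (E := E) (𝔤 := 𝔤) a = pullback a (mcForm 𝔤 G) :=
  DForm.ext_lin fun m v => by rw [pullback_mcForm_lin (ha m)]; rfl

theorem smoothFormAt_logForm {a : M → G} (ha : ∀ m, SmoothAt E 𝔤 a m) (m : M) :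
    SmoothFormAt (logForm (E := E) (𝔤 := 𝔤) a) m := by
  rw [logForm_eq_pullback ha]
  exact (smoothFormAt_mcForm _).pullback (ha m)

theorem extD_pullback_mcForm {a : M → G} {m : M} (ha : SmoothAt E 𝔤 a m) (v : Fin 2 → E) :
    DForm.at (E := E) (extD (E := E) (pullback a (mcForm 𝔤 G))) m v =
      -lieBr G (logD E 𝔤 a m (v 0)) (logD E 𝔤 a m (v 1)) := by
  rw [extD_pullback (smoothFormAt_mcForm _) ha, pullback_at]
  change DForm.at (extD (mcForm 𝔤 G)) (a m) (fun i => dmap E 𝔤 a m (v i)) = _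
  rw [extD_mcForm, mc_dmap ha, mc_dmap ha]

theorem extD_logForm {a : M → G} (ha : ∀ m, SmoothAt E 𝔤 a m) (m : M) (v : Fin 2 → E) :
    DForm.at (extD (logForm (E := E) (𝔤 := 𝔤) a)) m v =
      -lieBr G (logD E 𝔤 a m (v 0)) (logD E 𝔤 a m (v 1)) := by
  rw [logForm_eq_pullback ha, extD_pullback_mcForm (ha m)]

/-- The adjoint action preserves the bracket. -/
theorem Ad_lieBr (g : G) (ξ η : 𝔤) : Ad g (lieBr G ξ η) = lieBr G (Ad g ξ) (Ad g η) := by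
  have hc : ∀ m : G, SmoothAt 𝔤 𝔤 (fun y : G => g * y * g⁻¹) m := fun m => smoothAt_conj g m
  -- Conjugation by g pulls the Maurer-Cartan form back to Ad(g) times itself. The exterior
  -- derivative at 1, computed from each side of this equality, gives the two sides of the claim.
  have h1 : logForm (E := 𝔤) (𝔤 := 𝔤) (fun y : G => g * y * g⁻¹) =
      actForm (fun _ => Ad g) (mcForm 𝔤 G) :=
    DForm.ext_lin fun x v => logD_conj g x v
  have h2 := extD_logForm hc 1 ![ξ, η]
  rw [h1, extD_actForm (contMDiffAt_const) (smoothFormAt_mcForm 1), extD_mcForm_one, dmap_const,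
    dmap_const, logD_conj, logD_conj, mc_one] at h2
  have h3 : (0 : 𝔤 →L[ℝ] 𝔤) ((![ξ, η] : Fin 2 → 𝔤) 0) - (0 : 𝔤 →L[ℝ] 𝔤) ((![ξ, η] : Fin 2 → 𝔤) 1)
    = 0 := by simp
  rw [h3, add_zero, map_neg] at h2
  exact neg_injective h2

/-- The derivative of `Ad(a⁻¹)` for a map `a` from a vector space to `G`. -/
theorem fderiv_Ad_inv {a : E → G} {x : E} (ha' : ∀ᶠ y in 𝓝 x, SmoothAt E 𝔤 a y) (ξ : 𝔤) (v : E) :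
    fderiv ℝ (fun y => Ad (a y)⁻¹ ξ) x v = -lieBr G (logD E 𝔤 a x v) (Ad (a x)⁻¹ ξ) := by
  have ha := ha'.self_of_nhds
  set ψ := extChartAt 𝓘(ℝ, 𝔤) (1 : G) with hψ
  have hs : SmoothAt 𝔤 𝔤 ψ.symm (ψ 1) := smoothAt_chart_symm (center_mem (1 : G))
  have e1 : ψ.symm (ψ 1) = 1 := extChartAt_to_inv (1 : G)
  -- The Maurer-Cartan equation is applied to the pullback by (z, y) ↦ ψ⁻¹(z)a(y), in the directions
  -- (0, v) and (ξ, 0). At z = ψ(1) its value on (ξ, 0) is Ad(a(y)⁻¹)ξ, whose y-derivative is the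
  -- one sought.
  let f : 𝔤 × E → G := fun p => ψ.symm p.1 * a p.2
  have hfs : ∀ z y, SmoothAt 𝔤 𝔤 ψ.symm z → SmoothAt E 𝔤 a y → SmoothAt (𝔤 × E) 𝔤 f (z, y) :=
    fun z y hz hy => SmoothAt.mul
      (SmoothAt.comp (f := fun p : 𝔤 × E => p.1) hz (smoothAt_iff_contDiffAt.2 contDiffAt_fst))
      (SmoothAt.comp (f := fun p : 𝔤 × E => p.2) hy (smoothAt_iff_contDiffAt.2 contDiffAt_snd))
  have hf := hfs _ _ hs ha
  have hF1 : ∀ (z : 𝔤) (y : E), HasFDerivAt (fun w : 𝔤 => ((w, y) : 𝔤 × E))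
      ((ContinuousLinearMap.id ℝ 𝔤).prod 0) z :=
    fun z y => (hasFDerivAt_id z).prodMk (hasFDerivAt_const y z)
  have hF2 : ∀ (z : 𝔤) (y : E), HasFDerivAt (fun w : E => ((z, w) : 𝔤 × E))
      ((0 : E →L[ℝ] 𝔤).prod (ContinuousLinearMap.id ℝ E)) y :=
    fun z y => (hasFDerivAt_const z y).prodMk (hasFDerivAt_id y)
  have hi1 : ∀ (z : 𝔤) (y : E), SmoothAt 𝔤 (𝔤 × E) (fun w : 𝔤 => ((w, y) : 𝔤 × E)) z :=
    fun z y => smoothAt_iff_contDiffAt.2 (contDiffAt_id.prodMk contDiffAt_const)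
  have hi2 : ∀ (z : 𝔤) (y : E), SmoothAt E (𝔤 × E) (fun w : E => ((z, w) : 𝔤 × E)) y :=
    fun z y => smoothAt_iff_contDiffAt.2 (contDiffAt_const.prodMk contDiffAt_id)
  have hd1 : ∀ (z : 𝔤) (y : E) (u : 𝔤), dmap 𝔤 (𝔤 × E) (fun w : 𝔤 => ((w, y) : 𝔤 × E)) z u =
      (u, 0) := by
    intro z y u
    rw [dmap_eq_fderiv, (hF1 z y).fderiv]; rfl
  have hd2 : ∀ (z : 𝔤) (y : E) (u : E), dmap E (𝔤 × E) (fun w : E => ((z, w) : 𝔤 × E)) y u =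
      (0, u) := by
    intro z y u
    rw [dmap_eq_fderiv, (hF2 z y).fderiv]; rfl
  let β : DForm (𝔤 × E) (𝔤 × E) 𝔤 1 := pullback f (mcForm 𝔤 G)
  have hβ : ContDiffAt ℝ ∞ β.at (ψ 1, x) :=
    ((smoothFormAt_mcForm _).pullback hf).vectorSpace
  have hev : ∀ w : 𝔤 × E, DifferentiableAt ℝ (fun p => β.at p ![w]) (ψ 1, x) := fun w =>
    (contDiffAt_alternating_iff.1 hβ _).differentiableAt (by simp)
  have hmain := extD_pullback_mcForm hf ![((0, v) : 𝔤 × E), ((ξ, 0) : 𝔤 × E)]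
  rw [extD_vectorSpace, extDeriv_one_apply (hβ.differentiableAt (by simp))] at hmain
  have hβv : ∀ z y, SmoothAt 𝔤 𝔤 ψ.symm z → SmoothAt E 𝔤 a y → ∀ w,
      β.at (z, y) ![w] = logD (𝔤 × E) 𝔤 f (z, y) w := fun z y hz hy w => by
    rw [← DForm.lin_apply, pullback_mcForm_lin (hfs z y hz hy)]
  have hl1 : ∀ y, SmoothAt E 𝔤 a y → ∀ z, SmoothAt 𝔤 𝔤 ψ.symm z → ∀ u,
      logD (𝔤 × E) 𝔤 f (z, y) (u, 0) = Ad (a y)⁻¹ (logD 𝔤 𝔤 ψ.symm z u) := by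
    intro y hy z hz u
    have := logD_comp (a := f) (f := fun w : 𝔤 => ((w, y) : 𝔤 × E)) (hfs z y hz hy) (hi1 z y) u
    rw [hd1] at this
    rw [← this]
    exact logD_mul_const (a y) hz u
  have hl2 : ∀ z, SmoothAt 𝔤 𝔤 ψ.symm z → ∀ u,
      logD (𝔤 × E) 𝔤 f (z, x) (0, u) = logD E 𝔤 a x u := by
    intro z hz u
    have := logD_comp (a := f) (f := fun w : E => ((z, w) : 𝔤 × E)) (hfs z x hz ha) (hi2 z x) u
    rw [hd2] at this
    rw [← this]
    exact logD_const_mul _ ha u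
  have hlψ : ∀ u, logD 𝔤 𝔤 ψ.symm (ψ 1) u = u := by
    intro u
    rw [logD_of_eq_one e1, hψ, dmap_chart_symm_self]; rfl
  have hA : fderiv ℝ (fun p => β.at p ![((ξ, 0) : 𝔤 × E)]) (ψ 1, x) (0, v) =
      fderiv ℝ (fun y => Ad (a y)⁻¹ ξ) x v := by
    have h1 := ((hev (ξ, 0)).hasFDerivAt.comp x (hF2 (ψ 1) x)).fderiv
    have h2 : ((fun p => β.at p ![((ξ, 0) : 𝔤 × E)]) ∘ fun w : E => ((ψ 1, w) : 𝔤 × E)) =ᶠ[𝓝 x]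
        fun y => Ad (a y)⁻¹ ξ := by
      filter_upwards [ha'] with y hy
      change β.at (ψ 1, y) _ = _
      rw [hβv _ _ hs hy, hl1 y hy _ hs, hlψ]
    rw [h2.fderiv_eq] at h1
    rw [h1]; rfl
  -- The value on (0, v) is the logarithmic derivative of `a`, unchanged by left factors and so
  -- independent of z.
  have hB : fderiv ℝ (fun p => β.at p ![((0, v) : 𝔤 × E)]) (ψ 1, x) (ξ, 0) = 0 := by
    have h1 := ((hev (0, v)).hasFDerivAt.comp (ψ 1) (hF1 (ψ 1) x)).fderiv
    have h2 : ((fun p => β.at p ![((0, v) : 𝔤 × E)]) ∘ fun w : 𝔤 => ((w, x) : 𝔤 × E)) =ᶠ[𝓝 (ψ 1)]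
        fun _ => logD E 𝔤 a x v := by
      filter_upwards [(isOpen_target (1 : G)).mem_nhds (center_mem (1 : G))] with z hz
      change β.at (z, x) _ = _
      rw [hβv _ _ (smoothAt_chart_symm hz) ha, hl2 _ (smoothAt_chart_symm hz)]
    rw [h2.fderiv_eq] at h1
    have h3 := congrArg (fun L : 𝔤 →L[ℝ] 𝔤 => L ξ) h1
    simp only [Pi.zero_apply, fderiv_fun_const] at h3
    exact h3.symm
  have hmain' : fderiv ℝ (fun p => β.at p ![((ξ, 0) : 𝔤 × E)]) (ψ 1, x) (0, v) -
      fderiv ℝ (fun p => β.at p ![((0, v) : 𝔤 × E)]) (ψ 1, x) (ξ, 0) =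
      -lieBr G (logD (𝔤 × E) 𝔤 f (ψ 1, x) (0, v)) (logD (𝔤 × E) 𝔤 f (ψ 1, x) (ξ, 0)) := hmain
  rw [hA, hB, sub_zero, hl1 x ha _ hs, hl2 _ hs, hlψ] at hmain'
  exact hmain'

theorem smoothAt_Ad_inv_apply (g : G) (ξ : 𝔤) : SmoothAt 𝔤 𝔤 (fun x : G => Ad x⁻¹ ξ) g :=
  (SmoothAt.Ad (SmoothAt.inv (smoothAt_id g))).clm_apply contMDiffAt_const

/-- The vector space case, applied to the inverse of the chart at `g`, whose differential at the
centre is the identity. -/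
theorem dmap_Ad_inv (g : G) (ξ v : 𝔤) :
    dmap 𝔤 𝔤 (fun x : G => Ad x⁻¹ ξ) g v = -lieBr G (mc g v) (Ad g⁻¹ ξ) := by
  set χ := extChartAt 𝓘(ℝ, 𝔤) g with hχ
  have ht : SmoothAt 𝔤 𝔤 χ.symm (χ g) := smoothAt_chart_symm (center_mem g)
  have e1 : χ.symm (χ g) = g := extChartAt_to_inv g
  have h1 := fderiv_Ad_inv (𝔤 := 𝔤) (a := χ.symm) (x := χ g) (by
    filter_upwards [(isOpen_target g).mem_nhds (center_mem g)] with z hz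
    exact smoothAt_chart_symm hz) ξ v
  have h2 := dmap_comp_apply (g := fun x : G => Ad x⁻¹ ξ) (f := χ.symm) (x := χ g)
    (smoothAt_Ad_inv_apply _ ξ) ht v
  have h3 := logD_comp (a := fun x : G => x) (f := χ.symm) (n := χ g) (smoothAt_id _) ht v
  rw [e1, hχ, dmap_chart_symm_self] at h2 h3
  rw [← dmap_eq_fderiv] at h1
  refine h2.symm.trans (h1.trans ?_)
  rw [hχ, show (extChartAt 𝓘(ℝ, 𝔤) g).symm (extChartAt 𝓘(ℝ, 𝔤) g g) = g from e1]
  exact congrArg (fun z => -lieBr G z _) h3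

/-- The derivative of `Ad(a⁻¹) ξ`. -/
theorem dmap_Ad_inv_comp {a : M → G} {m : M} (ha : SmoothAt E 𝔤 a m) (ξ : 𝔤) (v : E) :
    dmap E 𝔤 (fun x => Ad (a x)⁻¹ ξ) m v = -lieBr G (logD E 𝔤 a m v) (Ad (a m)⁻¹ ξ) := by
  rw [dmap_comp_apply (g := fun x : G => Ad x⁻¹ ξ) (smoothAt_Ad_inv_apply _ ξ) ha v, dmap_Ad_inv,
    mc_dmap ha]

/-- The exterior derivative of `Ad(a⁻¹) α`. -/
theorem extD_actForm_Ad_inv {a : M → G} {m : M} (ha : SmoothAt E 𝔤 a m) {α : DForm E M 𝔤 1}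
    (hα : SmoothFormAt α m) (v : Fin 2 → E) :
    DForm.at (extD (actForm (fun x => (Ad (a x)⁻¹ : 𝔤 →L[ℝ] 𝔤)) α)) m v =
      Ad (a m)⁻¹ (DForm.at (extD α) m v) -
        (lieBr G (logD E 𝔤 a m (v 0)) (Ad (a m)⁻¹ (α.lin m (v 1))) -
          lieBr G (logD E 𝔤 a m (v 1)) (Ad (a m)⁻¹ (α.lin m (v 0)))) := by
  rw [extD_actForm (SmoothAt.Ad (SmoothAt.inv ha)) hα, dmap_Ad_inv_comp ha, dmap_Ad_inv_comp ha]
  abel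

end Bracket

/-! ### Orthogonal projections and isotropy subalgebras -/

section Projection

variable {𝔤 : Type*} [NormedAddCommGroup 𝔤] [NormedSpace ℝ 𝔤] [FiniteDimensional ℝ 𝔤]
  {G : Type*} [TopologicalSpace G] [ChartedSpace 𝔤 G] [Group G] [LieGroup 𝓘(ℝ, 𝔤) ∞ G]
  (ρ : GroupMetric 𝔤 G)

/-- Conjugation is a left translation followed by a right translation, both isometries. -/
theorem innerOne_Ad (hρ : IsBiinvariant ρ) (g : G) (ξ η : 𝔤) :
    innerOne ρ (Ad g ξ) (Ad g η) = innerOne ρ ξ η := by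
  let inn : G → 𝔤 →L[ℝ] 𝔤 →L[ℝ] ℝ := fun x => ρ.inner x
  have h1 : inn (g * 1) (dmap 𝔤 𝔤 (fun x : G => g * x) 1 ξ) (dmap 𝔤 𝔤 (fun x : G => g * x) 1 η) =
      inn 1 ξ η := hρ.1 g 1 ξ η
  have h2 : inn (g * 1 * g⁻¹)
      (dmap 𝔤 𝔤 (fun x : G => x * g⁻¹) (g * 1) (dmap 𝔤 𝔤 (fun x : G => g * x) 1 ξ))
      (dmap 𝔤 𝔤 (fun x : G => x * g⁻¹) (g * 1) (dmap 𝔤 𝔤 (fun x : G => g * x) 1 η)) =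
      inn (g * 1) (dmap 𝔤 𝔤 (fun x : G => g * x) 1 ξ) (dmap 𝔤 𝔤 (fun x : G => g * x) 1 η) :=
    hρ.2 g⁻¹ (g * 1) _ _
  have hr : SmoothAt 𝔤 𝔤 (fun x : G => x * g⁻¹) (g * 1) := (smoothAt_id _).mul (smoothAt_const _ _)
  rw [← dmap_comp_apply (g := fun x : G => x * g⁻¹) hr (smoothAt_mul_left g 1),
    ← dmap_comp_apply (g := fun x : G => x * g⁻¹) hr (smoothAt_mul_left g 1), h1, mul_one,
    mul_inv_cancel] at h2
  exact h2

theorem prOn_mem (W : Submodule ℝ 𝔤) (ξ : 𝔤) : prOn ρ W ξ ∈ W :=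
  Submodule.projection_apply_mem _ ξ

theorem prOn_of_mem {W : Submodule ℝ 𝔤} {ξ : 𝔤} (h : ξ ∈ W) : prOn ρ W ξ = ξ :=
  (Submodule.projection_eq_self_iff (isCompl_orthogonal ρ W) ξ).2 h

theorem sub_prOn_mem (W : Submodule ℝ 𝔤) (ξ : 𝔤) :
    ξ - prOn ρ W ξ ∈ (innerOne ρ).orthogonal W := by
  rw [← Submodule.projection_apply_eq_zero_iff (isCompl_orthogonal ρ W)]
  change prOn ρ W (ξ - prOn ρ W ξ) = 0
  rw [map_sub, prOn_of_mem ρ (prOn_mem ρ W ξ), sub_self]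

theorem prOn_eq {W : Submodule ℝ 𝔤} {ξ η : 𝔤} (h : η ∈ W)
    (h' : ξ - η ∈ (innerOne ρ).orthogonal W) : prOn ρ W ξ = η := by
  have h1 : prOn ρ W (ξ - η) = 0 := (Submodule.projection_apply_eq_zero_iff _).2 h'
  rw [map_sub, prOn_of_mem ρ h, sub_eq_zero] at h1
  exact h1

variable {ρ}

/-- The hypothesis says W' = Ad(g)W; as Ad(g) is an isometry, it also carries the orthogonal
complement of W to that of W'. -/
theorem prOn_Ad (hρ : IsBiinvariant ρ) {W W' : Submodule ℝ 𝔤} {g : G}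
    (hW : ∀ ξ, ξ ∈ W' ↔ Ad g⁻¹ ξ ∈ W) (ξ : 𝔤) :
    prOn ρ W' ξ = Ad g (prOn ρ W (Ad g⁻¹ ξ)) := by
  refine prOn_eq ρ ?_ fun η hη => ?_
  · rw [hW, Ad_inv_Ad]; exact prOn_mem _ _ _
  · have h1 := sub_prOn_mem ρ W (Ad g⁻¹ ξ) (Ad g⁻¹ η) ((hW η).1 hη)
    change innerOne ρ _ _ = 0 at h1
    rw [← innerOne_Ad ρ hρ g, map_sub, Ad_Ad_inv, Ad_Ad_inv] at h1
    exact h1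

/-- The orthogonal projection as a continuous linear map. -/
def prL (ρ : GroupMetric 𝔤 G) (W : Submodule ℝ 𝔤) : 𝔤 →L[ℝ] 𝔤 :=
  LinearMap.toContinuousLinearMap (prOn ρ W)

variable {H : Subgroup G}

theorem mem_lieAlgOf {ξ : 𝔤} : ξ ∈ lieAlgOf (𝔤 := 𝔤) H ↔ ∃ γ : ℝ → G, SmoothAt ℝ 𝔤 γ 0 ∧
    γ 0 = 1 ∧ (∀ᶠ t in 𝓝 (0 : ℝ), γ t ∈ H) ∧ dmap ℝ 𝔤 γ 0 1 = ξ := Iff.rfl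

theorem Ad_mem_lieAlgOf {h : G} (hh : h ∈ H) {ξ : 𝔤} (hξ : ξ ∈ lieAlgOf (𝔤 := 𝔤) H) :
    Ad h ξ ∈ lieAlgOf (𝔤 := 𝔤) H := by
  obtain ⟨γ, hγ, h1, hH, rfl⟩ := mem_lieAlgOf.1 hξ
  refine mem_lieAlgOf.2 ⟨fun t => h * γ t * h⁻¹, SmoothAt.comp (g := fun x : G => h * x * h⁻¹)
    (smoothAt_conj _ _) hγ, by simp [h1], ?_, ?_⟩
  · filter_upwards [hH] with t ht
    exact H.mul_mem (H.mul_mem hh ht) (H.inv_mem hh)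
  · rw [dmap_comp_apply (g := fun x : G => h * x * h⁻¹) (smoothAt_conj _ _) hγ, h1]
    rfl

theorem Ad_mem_lieAlgOf_iff {h : G} (hh : h ∈ H) {ξ : 𝔤} :
    Ad h ξ ∈ lieAlgOf (𝔤 := 𝔤) H ↔ ξ ∈ lieAlgOf (𝔤 := 𝔤) H := by
  refine ⟨fun hξ => ?_, Ad_mem_lieAlgOf hh⟩
  have := Ad_mem_lieAlgOf (H.inv_mem hh) hξ
  rwa [Ad_inv_Ad] at this

/-- One representative suffices: any two differ by an element of H, and Ad(H) preserves 𝔥. -/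
theorem mem_isotropyAlgebra {g : G} {ξ : 𝔤} :
    ξ ∈ isotropyAlgebra (𝔤 := 𝔤) H (g : G ⧸ H) ↔ Ad g⁻¹ ξ ∈ lieAlgOf (𝔤 := 𝔤) H := by
  refine ⟨fun h => h g rfl, fun h g' hg' => ?_⟩
  have hh : g'⁻¹ * g ∈ H := QuotientGroup.eq.1 hg'
  have := Ad_mem_lieAlgOf hh h
  rwa [← Ad_mul_apply, mul_assoc, mul_inv_cancel, mul_one] at this

theorem Ad_mem_isotropyAlgebra {g : G} {ξ : 𝔤} (hξ : ξ ∈ lieAlgOf (𝔤 := 𝔤) H) :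
    Ad g ξ ∈ isotropyAlgebra (𝔤 := 𝔤) H (g : G ⧸ H) := by
  rw [mem_isotropyAlgebra, Ad_inv_Ad]; exact hξ

theorem prOn_Ad_of_mem (hρ : IsBiinvariant ρ) {h : G} (hh : h ∈ H) (ξ : 𝔤) :
    prOn ρ (lieAlgOf H) (Ad h ξ) = Ad h (prOn ρ (lieAlgOf H) ξ) := by
  rw [prOn_Ad hρ (W := lieAlgOf H) (g := h)
    (fun η => (Ad_mem_lieAlgOf_iff (H.inv_mem hh)).symm), Ad_inv_Ad]

theorem prOn_isotropyAlgebra (hρ : IsBiinvariant ρ) (g : G) (ξ : 𝔤) :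
    prOn ρ (isotropyAlgebra H (g : G ⧸ H)) ξ = Ad g (prOn ρ (lieAlgOf H) (Ad g⁻¹ ξ)) :=
  prOn_Ad hρ (fun _ => mem_isotropyAlgebra) ξ

/-- The infinitesimal form of Ad(H)-equivariance: differentiate pr(Ad(γ(t)⁻¹)η) = Ad(γ(t)⁻¹)pr(η) at
t = 0 along a curve in H with velocity ξ. -/
theorem prOn_lieBr (hρ : IsBiinvariant ρ) {ξ : 𝔤} (hξ : ξ ∈ lieAlgOf (𝔤 := 𝔤) H) (η : 𝔤) :
    prOn ρ (lieAlgOf H) (lieBr G ξ η) = lieBr G ξ (prOn ρ (lieAlgOf H) η) := by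
  obtain ⟨γ, hγ, h1, hH, rfl⟩ := mem_lieAlgOf.1 hξ
  have hl : logD ℝ 𝔤 γ 0 = dmap ℝ 𝔤 γ 0 := logD_of_eq_one h1
  have hd : ∀ ζ : 𝔤, dmap ℝ 𝔤 (fun t => Ad (γ t)⁻¹ ζ) 0 1 = -lieBr G (dmap ℝ 𝔤 γ 0 1) ζ := by
    intro ζ
    rw [dmap_Ad_inv_comp hγ, hl, h1, inv_one, Ad_one]; rfl
  have hs : SmoothAt ℝ 𝔤 (fun t => Ad (γ t)⁻¹ η) 0 :=
    SmoothAt.comp (g := fun x : G => Ad x⁻¹ η) (smoothAt_Ad_inv_apply _ η) hγ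
  have hp : SmoothAt 𝔤 𝔤 (prL ρ (lieAlgOf H)) (Ad (γ 0)⁻¹ η) :=
    smoothAt_iff_contDiffAt.2 (prL ρ (lieAlgOf H)).contDiff.contDiffAt
  have h2 := dmap_comp_apply (g := prL ρ (lieAlgOf H)) (f := fun t => Ad (γ t)⁻¹ η) hp hs 1
  have h3 : (fun t => prL ρ (lieAlgOf H) (Ad (γ t)⁻¹ η)) =ᶠ[𝓝 0]
      fun t => Ad (γ t)⁻¹ (prOn ρ (lieAlgOf H) η) := by
    filter_upwards [hH] with t ht
    exact prOn_Ad_of_mem hρ (H.inv_mem ht) η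
  rw [dmap_congr h3, hd, hd, dmap_eq_fderiv, ContinuousLinearMap.fderiv, map_neg] at h2
  exact (neg_injective h2).symm

end Projection

/-! ### Submersions and embeddings -/

section Submersion

variable {E : Type*} [NormedAddCommGroup E] [NormedSpace ℝ E] {K : Type*} [TopologicalSpace K]
  {I : ModelWithCorners ℝ E K} [I.Boundaryless]
  {N : Type*} [TopologicalSpace N] [ChartedSpace K N]
  {E' : Type*} [NormedAddCommGroup E'] [NormedSpace ℝ E']
  {X : Type*} [TopologicalSpace X] [ChartedSpace E' X]

/-- A submersion has smooth local sections through every point. -/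
theorem exists_section_of_isSubmersionAt {f : N → X} {x : N}
    (h : IsSubmersionAt I 𝓘(ℝ, E') ∞ f x) :
    ∃ s : X → N, ContMDiffAt 𝓘(ℝ, E') I ∞ s (f x) ∧ s (f x) = x ∧ ∀ᶠ y in 𝓝 (f x), f (s y) = y := by
  set d := h.domChart.extend I with hd
  set c := h.codChart.extend 𝓘(ℝ, E') with hc
  have hxd : x ∈ d.source := by
    rw [hd, OpenPartialHomeomorph.extend_source]
    exact h.mem_domChart_source
  have hxc : f x ∈ h.codChart.source := h.mem_codChart_source
  have hu0 : d x ∈ d.target := d.map_source hxd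
  have hw : ∀ u ∈ d.target, c (f (d.symm u)) = (h.equiv u).1 := fun u hu => h.writtenInCharts hu
  have hc0 : c (f x) = (h.equiv (d x)).1 := by
    rw [← hw _ hu0, d.left_inv hxd]
  -- In the adapted charts `f` is the projection to the first factor. The section follows `y` in
  -- that factor and keeps the complementary coordinate of `x`.
  let z : X → E := fun y => h.equiv.symm (c y, (h.equiv (d x)).2)
  have hz0 : z (f x) = d x := by
    simp only [z]
    rw [hc0, Prod.mk.eta, ContinuousLinearEquiv.symm_apply_apply]
  have hcs : ContMDiffAt 𝓘(ℝ, E') 𝓘(ℝ, E') ∞ c (f x) :=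
    OpenPartialHomeomorph.contMDiffAt_extend h.codChart_mem_maximalAtlas hxc
  have hzs : ContMDiffAt 𝓘(ℝ, E') 𝓘(ℝ, E) ∞ z (f x) := by
    have h1 : ContMDiff 𝓘(ℝ, E') 𝓘(ℝ, E) ∞
        (fun w : E' => h.equiv.symm (w, (h.equiv (d x)).2)) := by
      rw [contMDiff_iff_contDiff]
      exact h.equiv.symm.contDiff.comp (contDiff_id.prodMk contDiff_const)
    exact ContMDiffAt.comp (f x) (g := fun w : E' => h.equiv.symm (w, (h.equiv (d x)).2))
      h1.contMDiffAt hcs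
  have hto : IsOpen d.target := OpenPartialHomeomorph.isOpen_extend_target _
  have hds : ContMDiffAt 𝓘(ℝ, E) I ∞ d.symm (d x) := by
    have := contMDiffOn_extend_symm h.domChart_mem_maximalAtlas
    rw [← OpenPartialHomeomorph.extend_target'] at this
    exact this.contMDiffAt (hto.mem_nhds hu0)
  refine ⟨fun y => d.symm (z y), ?_, ?_, ?_⟩
  · exact ContMDiffAt.comp (f x) (g := d.symm) (by rw [hz0]; exact hds) hzs
  · change d.symm (z (f x)) = x
    rw [hz0, d.left_inv hxd]
  · have h1 : ∀ᶠ y in 𝓝 (f x), z y ∈ d.target :=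
      hzs.continuousAt.eventually (by rw [hz0]; exact hto.mem_nhds hu0)
    filter_upwards [h1, h.codChart.open_source.mem_nhds hxc] with y hy hyc
    have h2 : c (f (d.symm (z y))) = c y := by
      rw [hw _ hy]
      simp [z]
    have h3 : d.symm (z y) ∈ h.domChart.source := by
      have := d.map_target hy
      rwa [hd, OpenPartialHomeomorph.extend_source] at this
    have h4 : f (d.symm (z y)) ∈ h.codChart.source := h.source_subset_preimage_source h3
    refine c.injOn ?_ ?_ h2
    · rw [hc, OpenPartialHomeomorph.extend_source]; exact h4
    · rw [hc, OpenPartialHomeomorph.extend_source]; exact hyc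

end Submersion

section SubmersionKernel

variable {E : Type*} [NormedAddCommGroup E] [NormedSpace ℝ E]
  {N : Type*} [TopologicalSpace N] [ChartedSpace E N]
  {E' : Type*} [NormedAddCommGroup E'] [NormedSpace ℝ E']
  {X : Type*} [TopologicalSpace X] [ChartedSpace E' X]

/-- The kernel of the differential of a submersion consists of velocities of curves in the
fibre. -/
theorem exists_curve_of_isSubmersionAt {f : N → X} {x : N}
    (h : IsSubmersionAt 𝓘(ℝ, E) 𝓘(ℝ, E') ∞ f x) {v : E} (hv : dmap E E' f x v = 0) :
    ∃ γ : ℝ → N, SmoothAt ℝ E γ 0 ∧ γ 0 = x ∧ (∀ᶠ t in 𝓝 (0 : ℝ), f (γ t) = f x) ∧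
      dmap ℝ E γ 0 1 = v := by
  set d := h.domChart.extend 𝓘(ℝ, E) with hd
  set c := h.codChart.extend 𝓘(ℝ, E') with hc
  have hxs : x ∈ h.domChart.source := h.mem_domChart_source
  have hxd : x ∈ d.source := by rw [hd, OpenPartialHomeomorph.extend_source]; exact hxs
  have hxc : f x ∈ h.codChart.source := h.mem_codChart_source
  have hu0 : d x ∈ d.target := d.map_source hxd
  have hw : ∀ u ∈ d.target, c (f (d.symm u)) = (h.equiv u).1 := fun u hu => h.writtenInCharts hu
  have hcs : SmoothAt E' E' c (f x) :=
    OpenPartialHomeomorph.contMDiffAt_extend h.codChart_mem_maximalAtlas hxc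
  have hdd : SmoothAt E E d x :=
    OpenPartialHomeomorph.contMDiffAt_extend h.domChart_mem_maximalAtlas hxs
  have hto : IsOpen d.target := OpenPartialHomeomorph.isOpen_extend_target _
  have hso : IsOpen d.source := OpenPartialHomeomorph.isOpen_extend_source _
  have hds : SmoothAt E E d.symm (d x) := by
    have := contMDiffOn_extend_symm h.domChart_mem_maximalAtlas
    rw [← OpenPartialHomeomorph.extend_target'] at this
    exact this.contMDiffAt (hto.mem_nhds hu0)
  have hf : SmoothAt E E' f x := h.contMDiffAt
  have hproj : SmoothAt E E' (fun u : E => (h.equiv u).1) (d x) :=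
    smoothAt_iff_contDiffAt.2 (contDiff_fst.comp h.equiv.contDiff).contDiffAt
  -- In the adapted charts, df(v) = 0 says that `v` has no component along the base.
  have hker : (h.equiv (dmap E E d x v)).1 = 0 := by
    have h1 := dmap_comp_apply (g := c) (f := f) (x := x) hcs hf v
    have h2 := dmap_comp_apply (g := fun u : E => (h.equiv u).1) (f := d) (x := x) hproj hdd v
    have h3 : (fun y => c (f y)) =ᶠ[𝓝 x] fun y => (h.equiv (d y)).1 := by
      filter_upwards [hso.mem_nhds hxd] with y hy
      rw [← hw _ (d.map_source hy), d.left_inv hy]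
    rw [hv, map_zero, dmap_congr h3, h2, dmap_eq_fderiv] at h1
    have h4 : HasFDerivAt (fun u : E => (h.equiv u).1)
        ((ContinuousLinearMap.fst ℝ E' h.complement).comp (h.equiv : E →L[ℝ] E' × h.complement))
        (d x) := ((ContinuousLinearMap.fst ℝ E' h.complement).comp
          (h.equiv : E →L[ℝ] E' × h.complement)).hasFDerivAt
    rw [h4.fderiv] at h1
    exact h1
  -- A straight line in the chart, along which the base coordinate is constant.
  let ℓ : ℝ → E := fun t => d x + t • dmap E E d x v
  have hℓ0 : ℓ 0 = d x := by simp [ℓ]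
  have hℓs : SmoothAt ℝ E ℓ 0 :=
    smoothAt_iff_contDiffAt.2 (contDiffAt_const.add (contDiffAt_id.smul contDiffAt_const))
  have hℓd : dmap ℝ E ℓ 0 1 = dmap E E d x v := by
    have h1 : HasDerivAt ℓ ((1 : ℝ) • dmap E E d x v) 0 :=
      ((hasDerivAt_id (0 : ℝ)).smul_const _).const_add _
    rw [dmap_eq_fderiv, h1.hasFDerivAt.fderiv]
    simp
  refine ⟨fun t => d.symm (ℓ t), ?_, ?_, ?_, ?_⟩
  · exact SmoothAt.comp (g := d.symm) (f := ℓ) (by rw [hℓ0]; exact hds) hℓs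
  · change d.symm (ℓ 0) = x
    rw [hℓ0, d.left_inv hxd]
  · have h1 : ∀ᶠ t in 𝓝 (0 : ℝ), ℓ t ∈ d.target :=
      hℓs.continuousAt.eventually (by rw [hℓ0]; exact hto.mem_nhds hu0)
    filter_upwards [h1] with t ht
    have h2 : c (f (d.symm (ℓ t))) = c (f x) := by
      have h5 := hw _ hu0
      rw [d.left_inv hxd] at h5
      rw [hw _ ht, h5]
      simp only [ℓ, map_add, map_smul, Prod.fst_add, Prod.smul_fst, hker, smul_zero, add_zero]
    have h3 : d.symm (ℓ t) ∈ h.domChart.source := by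
      have := d.map_target ht
      rwa [hd, OpenPartialHomeomorph.extend_source] at this
    have h4 : f (d.symm (ℓ t)) ∈ h.codChart.source := h.source_subset_preimage_source h3
    refine c.injOn ?_ ?_ h2
    · rw [hc, OpenPartialHomeomorph.extend_source]; exact h4
    · rw [hc, OpenPartialHomeomorph.extend_source]; exact hxc
  · have h1 := dmap_comp_apply (g := d.symm) (f := ℓ) (x := (0 : ℝ)) (by rw [hℓ0]; exact hds) hℓs 1
    rw [h1, hℓd, hℓ0, ← dmap_comp_apply (g := d.symm) (f := d) hds hdd]
    have h3 : (fun y => d.symm (d y)) =ᶠ[𝓝 x] fun y => y := by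
      filter_upwards [hso.mem_nhds hxd] with y hy
      exact d.left_inv hy
    rw [dmap_congr h3, dmap_id]; rfl

end SubmersionKernel

/-! ### Smooth maps into embedded submanifolds -/

section Embedding

variable {E : Type*} [NormedAddCommGroup E] [NormedSpace ℝ E]
  {M : Type*} [TopologicalSpace M] [ChartedSpace E M]
  {F : Type*} [NormedAddCommGroup F] [NormedSpace ℝ F]
  {Q : Type*} [TopologicalSpace Q] [ChartedSpace F Q]
  {E' : Type*} [NormedAddCommGroup E'] [NormedSpace ℝ E']
  {N : Type*} [TopologicalSpace N] [ChartedSpace E' N]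
  {S : Set (M × Q)} {ES : Type*} [NormedAddCommGroup ES] [NormedSpace ℝ ES] [ChartedSpace ES S]

/-- An immersion reflects smoothness of continuous maps, and continuity is reflected because an
embedding carries the induced topology. -/
theorem smoothAt_of_isSmoothEmbedding {E₀ : Type*} [NormedAddCommGroup E₀] [NormedSpace ℝ E₀]
    {K : Type*} [TopologicalSpace K] [ChartedSpace E₀ K]
    {ι : K → M} (hι : IsSmoothEmbedding 𝓘(ℝ, E₀) 𝓘(ℝ, E) ∞ ι) {f : N → K} {n : N}
    (h : SmoothAt E' E (fun x => ι (f x)) n) : SmoothAt E' E₀ f n :=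
  (ContMDiffAt.iff_comp_isImmersionAt (hι.isImmersion.isImmersionAt _)).2
    ⟨hι.isEmbedding.isInducing.continuousAt_iff.2 h.continuousAt, h⟩

/-- Maps into an embedded submanifold of a product are smooth if their components are. -/
theorem contMDiffAt_of_isSmoothEmbedding_prod {K : Type*} [TopologicalSpace K]
    {I : ModelWithCorners ℝ E' K} {N : Type*} [TopologicalSpace N] [ChartedSpace K N]
    (hS : IsSmoothEmbedding 𝓘(ℝ, ES) (𝓘(ℝ, E).prod 𝓘(ℝ, F)) ∞ (Subtype.val : S → M × Q))
    {f : N → S} {n : N} (h1 : ContMDiffAt I 𝓘(ℝ, E) ∞ (fun x => (f x).1.1) n)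
    (h2 : ContMDiffAt I 𝓘(ℝ, F) ∞ (fun x => (f x).1.2) n) : ContMDiffAt I 𝓘(ℝ, ES) ∞ f n := by
  have h : ContMDiffAt I (𝓘(ℝ, E).prod 𝓘(ℝ, F)) ∞ (fun x => (f x).1) n := h1.prodMk h2
  exact (ContMDiffAt.iff_comp_isImmersionAt (hS.isImmersion.isImmersionAt _)).2
    ⟨hS.isEmbedding.isInducing.continuousAt_iff.2 h.continuousAt, h⟩

theorem smoothAt_fst_of_isSmoothEmbedding
    (hS : IsSmoothEmbedding 𝓘(ℝ, ES) (𝓘(ℝ, E).prod 𝓘(ℝ, F)) ∞ (Subtype.val : S → M × Q)) (p : S) :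
    SmoothAt ES E (fun x : S => x.1.1) p :=
  ContMDiffAt.comp p (g := Prod.fst) (I' := 𝓘(ℝ, E).prod 𝓘(ℝ, F)) contMDiffAt_fst
    hS.contMDiff.contMDiffAt

theorem smoothAt_snd_of_isSmoothEmbedding
    (hS : IsSmoothEmbedding 𝓘(ℝ, ES) (𝓘(ℝ, E).prod 𝓘(ℝ, F)) ∞ (Subtype.val : S → M × Q)) (p : S) :
    SmoothAt ES F (fun x : S => x.1.2) p :=
  ContMDiffAt.comp p (g := Prod.snd) (I' := 𝓘(ℝ, E).prod 𝓘(ℝ, F)) contMDiffAt_snd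
    hS.contMDiff.contMDiffAt

end Embedding

/-! ### Descent of forms -/

section Descent

variable {E : Type*} [NormedAddCommGroup E] [NormedSpace ℝ E] [FiniteDimensional ℝ E]
  {M : Type*} [TopologicalSpace M] [ChartedSpace E M] [IsManifold 𝓘(ℝ, E) ∞ M]
  {E' : Type*} [NormedAddCommGroup E'] [NormedSpace ℝ E'] [FiniteDimensional ℝ E']
  {P : Type*} [TopologicalSpace P] [ChartedSpace E' P] [IsManifold 𝓘(ℝ, E') ∞ P]
  {V : Type*} [NormedAddCommGroup V] [NormedSpace ℝ V] [FiniteDimensional ℝ V] {k : ℕ}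

/-- A smooth surjective map with smooth local sections through every point. -/
structure HasSections (E' : Type*) [NormedAddCommGroup E'] [NormedSpace ℝ E']
    (E : Type*) [NormedAddCommGroup E] [NormedSpace ℝ E]
    {P : Type*} [TopologicalSpace P] [ChartedSpace E' P]
    {M : Type*} [TopologicalSpace M] [ChartedSpace E M] (q : P → M) : Prop where
  smooth : ∀ p, SmoothAt E' E q p
  surj : Function.Surjective q
  exists_section : ∀ p, ∃ s : M → P, SmoothAt E E' s (q p) ∧ s (q p) = p ∧
    ∀ᶠ m in 𝓝 (q p), q (s m) = m

theorem HasSections.section_deriv {q : P → M} (hq : HasSections E' E q) {s : M → P} {m : M}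
    (hs : MDifferentiableAt 𝓘(ℝ, E) 𝓘(ℝ, E') s m) (h : ∀ᶠ m' in 𝓝 m, q (s m') = m') (v : E) :
    dmap E' E q (s m) (dmap E E' s m v) = v := by
  have h1 : dmap E E (fun m' => q (s m')) m =
      (dmap E' E q (s m)).comp (dmap E E' s m) := mfderiv_comp m (hq.smooth _).mdiff hs
  have h2 : (fun m' => q (s m')) =ᶠ[𝓝 m] fun m' => m' := h
  rw [dmap_congr h2, dmap_id] at h1
  exact (DFunLike.congr_fun h1 v).symm

theorem HasSections.dmap_surjective {q : P → M} (hq : HasSections E' E q) (p : P) :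
    Function.Surjective (dmap E' E q p) := by
  obtain ⟨s, hs, hp, h⟩ := hq.exists_section p
  intro v
  have := hq.section_deriv hs.mdiff h v
  rw [hp] at this
  exact ⟨_, this⟩

theorem HasSections.exists_lift {q : P → M} (hq : HasSections E' E q) {ι : Type*} (p : P)
    (v : ι → E) : ∃ u : ι → E', ∀ i, dmap E' E q p (u i) = v i :=
  ⟨fun i => (hq.dmap_surjective p (v i)).choose, fun i => (hq.dmap_surjective p (v i)).choose_spec⟩

/-- Both the map and its differentials are surjective, so every tuple of tangent vectors on the base
has a lift. -/
theorem HasSections.form_ext {q : P → M} (hq : HasSections E' E q) {b b' : DForm E M V k}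
    (h : ∀ p (v : Fin k → E'), b.at (q p) (fun i => dmap E' E q p (v i)) =
      b'.at (q p) (fun i => dmap E' E q p (v i))) : b = b' := by
  refine DForm.ext_at fun m v => ?_
  obtain ⟨p, rfl⟩ := hq.surj m
  obtain ⟨u, hu⟩ := hq.exists_lift p v
  have := h p u
  simp only [hu] at this
  exact this

/-- A form is smooth if its pullback is. -/
theorem HasSections.smoothFormAt {q : P → M} (hq : HasSections E' E q) {b : DForm E M V k}
    (h : ∀ p, SmoothFormAt (E := E') (pullback (E := E') q b) p) (m : M) : SmoothFormAt b m := by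
  obtain ⟨p, rfl⟩ := hq.surj m
  obtain ⟨s, hs, hp, hqs⟩ := hq.exists_section p
  have h1 : SmoothFormAt (E := E) (pullback (E := E) s (pullback (E := E') q b)) (q p) :=
    SmoothFormAt.pullback (h _) hs
  -- Near q(p) the form is the pullback along the local section of its own pullback, because q ∘ s
  -- is the identity there.
  have h2 : ∀ᶠ m in 𝓝 (q p), b.at m =
      DForm.at (E := E) (pullback (E := E) s (pullback (E := E') q b)) m := by
    filter_upwards [SmoothAt.eventually_one (E := E') (E' := E) hs,
      hqs.eventually_nhds] with m hm hm'
    rw [pullback_at, pullback_at]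
    ext v
    change b.at m v = b.at (q (s m)) (fun i => dmap E' E q (s m) (dmap E E' s m (v i)))
    simp only [hq.section_deriv hm hm']
    rw [hm'.self_of_nhds]
  refine ContDiffAt.congr_of_eventuallyEq h1 ?_
  have hc : Filter.Tendsto (extChartAt 𝓘(ℝ, E) (q p)).symm (𝓝 (extChartAt 𝓘(ℝ, E) (q p) (q p)))
      (𝓝 (q p)) := by
    have := ContMDiffAt.continuousAt
      (smoothAt_chart_symm (E := E) (M := M) (center_mem (E := E) (q p))) |>.tendsto
    rwa [extChartAt_to_inv] at this
  filter_upwards [hc.eventually h2] with y hy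
  rw [formInChart_eq, formInChart_eq, hy]

/-- A smooth basic form descends. -/
theorem HasSections.exists_descent {q : P → M} (hq : HasSections E' E q) {β : DForm E' P V k}
    (hβ : ∀ p, SmoothFormAt β p)
    (hb : ∀ p p' (v v' : Fin k → E'), q p = q p' →
      (∀ i, dmap E' E q p (v i) = dmap E' E q p' (v' i)) → β.at p v = β.at p' v') :
    ∃ b : DForm E M V k, (∀ m, SmoothFormAt b m) ∧
      ∀ p (v : Fin k → E'), b.at (q p) (fun i => dmap E' E q p (v i)) = β.at p v := by
  choose p hp using hq.surj
  choose s hs hsp hqs using fun m => hq.exists_section (p m)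
  -- At `m` only the differential at `m` of its own section enters, so the sections need not fit
  -- together. By `hb` the pullback of `b` is `β`, and smoothness then comes from `β`.
  let b : DForm E M V k := fun m =>
    ((β.at (p m)).compContinuousLinearMap (dmap E E' (s m) m) : E [⋀^Fin k]→L[ℝ] V)
  have hpull : ∀ p' (v : Fin k → E'), b.at (q p') (fun i => dmap E' E q p' (v i)) = β.at p' v := by
    intro p' v
    refine hb _ _ (fun i => dmap E E' (s (q p')) (q p') (dmap E' E q p' (v i))) _ (hp _) fun i => ?_
    have h1 := hs (q p')
    have h2 := hqs (q p')
    rw [hp] at h1 h2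
    have h3 := hq.section_deriv h1.mdiff h2 (dmap E' E q p' (v i))
    have h4 := hsp (q p')
    rw [hp] at h4
    rwa [h4] at h3
  refine ⟨b, hq.smoothFormAt fun p' => ?_, hpull⟩
  have : pullback (E := E') q b = β := DForm.ext_at hpull
  rw [this]
  exact hβ p'

end Descent

/-! ### The homogeneous space and its coisotropy form -/

section Homogeneous

variable {𝔤 : Type*} [NormedAddCommGroup 𝔤] [NormedSpace ℝ 𝔤] [FiniteDimensional ℝ 𝔤]
  {G : Type*} [TopologicalSpace G] [ChartedSpace 𝔤 G] [Group G] [LieGroup 𝓘(ℝ, 𝔤) ∞ G]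
  {ρ : GroupMetric 𝔤 G} {H : Subgroup G}
  {EX : Type*} [NormedAddCommGroup EX] [NormedSpace ℝ EX] [FiniteDimensional ℝ EX]
  [ChartedSpace EX (G ⧸ H)] [IsManifold 𝓘(ℝ, EX) ∞ (G ⧸ H)]

section Kernel

variable (hX : IsSubmersion 𝓘(ℝ, 𝔤) 𝓘(ℝ, EX) ∞ (QuotientGroup.mk : G → G ⧸ H))

include hX

theorem smoothAt_mk (g : G) : SmoothAt 𝔤 EX (QuotientGroup.mk : G → G ⧸ H) g :=
  hX.contMDiff.contMDiffAt

theorem hasSections_mk : HasSections 𝔤 EX (QuotientGroup.mk : G → G ⧸ H) where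
  smooth := smoothAt_mk hX
  surj := QuotientGroup.mk_surjective
  exists_section g := exists_section_of_isSubmersionAt (hX.isSubmersionAt g)

/-- The vertical vectors of `G → G/H`. -/
theorem dmap_mk_eq_zero_iff (g : G) (v : 𝔤) :
    dmap 𝔤 EX (QuotientGroup.mk : G → G ⧸ H) g v = 0 ↔ mc g v ∈ lieAlgOf (𝔤 := 𝔤) H := by
  constructor
  · intro h
    -- A vertical vector is the velocity of a curve in the coset gH; translation by g⁻¹ moves this
    -- curve into H, through 1.
    obtain ⟨γ, hγ, h0, hH, hd⟩ := exists_curve_of_isSubmersionAt (hX.isSubmersionAt g) h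
    refine mem_lieAlgOf.2 ⟨fun t => g⁻¹ * γ t, (smoothAt_const _ _).mul hγ, by simp [h0], ?_, ?_⟩
    · filter_upwards [hH] with t ht
      exact QuotientGroup.eq.1 ht.symm
    · rw [dmap_comp_apply (g := fun x : G => g⁻¹ * x) (smoothAt_mul_left _ _) hγ, hd, h0]
      rfl
  · intro h
    obtain ⟨γ, hγ, h0, hH, hd⟩ := mem_lieAlgOf.1 h
    have hc : SmoothAt ℝ 𝔤 (fun t => g * γ t) 0 := (smoothAt_const _ _).mul hγ
    have hv : dmap ℝ 𝔤 (fun t => g * γ t) 0 1 = v := by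
      rw [dmap_comp_apply (g := fun x : G => g * x) (smoothAt_mul_left _ _) hγ, hd, h0,
        left_comp_mc]
    have h1 := dmap_comp_apply (g := (QuotientGroup.mk : G → G ⧸ H)) (f := fun t => g * γ t)
      (smoothAt_mk hX _) hc 1
    have h2 : (fun t => (QuotientGroup.mk (g * γ t) : G ⧸ H)) =ᶠ[𝓝 0] fun _ => (g : G ⧸ H) := by
      filter_upwards [hH] with t ht
      exact QuotientGroup.mk_mul_of_mem _ ht
    rw [dmap_congr h2, dmap_const, hv, h0, mul_one] at h1
    exact h1.symm

/-- Right translation by h leaves the projection to G/H unchanged and acts on g⁻¹dg by Ad(h⁻¹). Two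
lifts of one vector to g and gh therefore agree up to a vertical vector. -/
theorem mc_of_dmap_mk_eq {g h : G} (hh : h ∈ H) {v v' : 𝔤}
    (hv : dmap 𝔤 EX (QuotientGroup.mk : G → G ⧸ H) (g * h) v' =
      dmap 𝔤 EX (QuotientGroup.mk : G → G ⧸ H) g v) :
    mc (g * h) v' - Ad h⁻¹ (mc g v) ∈ lieAlgOf (𝔤 := 𝔤) H := by
  have hR : SmoothAt 𝔤 𝔤 (fun x : G => x * h) g := (smoothAt_id g).mul (smoothAt_const _ _)
  have h1 := dmap_comp_apply (g := (QuotientGroup.mk : G → G ⧸ H)) (f := fun x : G => x * h)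
    (smoothAt_mk hX _) hR v
  have h2 : (fun x : G => (QuotientGroup.mk (x * h) : G ⧸ H)) = QuotientGroup.mk := by
    funext x; exact QuotientGroup.mk_mul_of_mem _ hh
  rw [h2] at h1
  have h3 : Ad h⁻¹ (mc g v) = mc (g * h) (dmap 𝔤 𝔤 (fun x : G => x * h) g v) := by
    rw [mc_dmap (a := fun x : G => x * h) hR, logD_mul_const _ (smoothAt_id g), mc_eq]
  rw [h3, ← map_sub, ← dmap_mk_eq_zero_iff hX, map_sub, hv, h1, sub_self]

end Kernel

theorem isCoisotropyForm_iff {θ : DForm EX (G ⧸ H) 𝔤 1} :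
    IsCoisotropyForm ρ θ ↔ ∀ (g : G) (v : 𝔤),
      θ.lin (g : G ⧸ H) (dmap 𝔤 EX (QuotientGroup.mk : G → G ⧸ H) g v) =
        Ad g (mc g v - prOn ρ (lieAlgOf H) (mc g v)) := by
  have h : ∀ (g : G) (v : 𝔤), DForm.at (E := 𝔤) (pullback (E := 𝔤) (QuotientGroup.mk : G → G ⧸ H) θ)
      g ![v] = θ.lin (g : G ⧸ H) (dmap 𝔤 EX (QuotientGroup.mk : G → G ⧸ H) g v) := by
    intro g v
    rw [← DForm.lin_apply, pullback_lin]
  exact forall_congr' fun g => forall_congr' fun v => by rw [← h g v]; rfl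

/-- The coisotropy form exists, is unique and smooth. -/
theorem existsUnique_coisotropyForm (hρ : IsBiinvariant ρ)
    (hX : IsSubmersion 𝓘(ℝ, 𝔤) 𝓘(ℝ, EX) ∞ (QuotientGroup.mk : G → G ⧸ H)) :
    ∃! θ : DForm EX (G ⧸ H) 𝔤 1, IsSmoothForm θ ∧ IsCoisotropyForm ρ θ := by
  have hq := hasSections_mk hX
  let A : G → 𝔤 →L[ℝ] 𝔤 := fun g =>
    (Ad g).comp (ContinuousLinearMap.id ℝ 𝔤 - prL ρ (lieAlgOf H))
  have hA : ∀ g, SmoothAt 𝔤 (𝔤 →L[ℝ] 𝔤) A g := fun g =>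
    ContMDiffAt.clm_comp (smoothAt_Ad g) contMDiffAt_const
  let β : DForm 𝔤 G 𝔤 1 := actForm A (mcForm 𝔤 G)
  have hβv : ∀ g v, β.lin g v = Ad g (mc g v - prOn ρ (lieAlgOf H) (mc g v)) := fun _ _ => rfl
  obtain ⟨θ, hθ, hθv⟩ := hq.exists_descent (β := β)
    (fun g => SmoothFormAt.act (hA g) (smoothFormAt_mcForm g)) (by
      intro g g' v v' hgg hvv
      obtain ⟨h, hh, rfl⟩ : ∃ h ∈ H, g' = g * h := ⟨g⁻¹ * g', QuotientGroup.eq.1 hgg, by group⟩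
      have hk := mc_of_dmap_mk_eq hX hh (hvv 0).symm
      -- The discrepancy `k` between the two lifts lies in 𝔥, where the projection to 𝔥^⊥ vanishes;
      -- the factor Ad(h⁻¹) is absorbed by Ad(gh).
      set k := mc (g * h) (v' 0) - Ad h⁻¹ (mc g (v 0)) with hkdef
      have h1 : mc (g * h) (v' 0) = Ad h⁻¹ (mc g (v 0)) + k := by rw [hkdef]; abel
      rw [DForm.at_eq_lin, DForm.at_eq_lin, hβv, hβv, h1, map_add, prOn_of_mem ρ hk,
        prOn_Ad_of_mem hρ (H.inv_mem hh), add_sub_add_right_eq_sub, ← map_sub, Ad_mul_apply,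
        Ad_Ad_inv])
  have hθ' : IsCoisotropyForm ρ θ := isCoisotropyForm_iff.2 fun g v => by
    have := hθv g ![v]
    rw [DForm.at_eq_lin, DForm.at_eq_lin] at this
    exact this
  refine ⟨θ, ⟨smoothForm_iff.2 hθ, hθ'⟩, fun θ' h' => ?_⟩
  refine hq.form_ext fun g v => ?_
  rw [DForm.at_eq_lin, DForm.at_eq_lin, isCoisotropyForm_iff.1 h'.2, isCoisotropyForm_iff.1 hθ']

end Homogeneous

/-! ### The coset bundle -/

section CosetBundle

variable {𝔤 : Type*} [NormedAddCommGroup 𝔤] [NormedSpace ℝ 𝔤] [FiniteDimensional ℝ 𝔤]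
  {G : Type*} [TopologicalSpace G] [ChartedSpace 𝔤 G] [Group G] [LieGroup 𝓘(ℝ, 𝔤) ∞ G]
  {H : Subgroup G}
  {EX : Type*} [NormedAddCommGroup EX] [NormedSpace ℝ EX] [FiniteDimensional ℝ EX]
  [ChartedSpace EX (G ⧸ H)] [IsManifold 𝓘(ℝ, EX) ∞ (G ⧸ H)]
  {EM : Type*} [NormedAddCommGroup EM] [NormedSpace ℝ EM]
  {M : Type*} [TopologicalSpace M] [ChartedSpace EM M]
  {φ : M → G ⧸ H}
  {EP : Type*} [NormedAddCommGroup EP] [NormedSpace ℝ EP]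
  [ChartedSpace EP (cosetBundle φ)]
  {E' : Type*} [NormedAddCommGroup E'] [NormedSpace ℝ E']
  {N : Type*} [TopologicalSpace N] [ChartedSpace E' N]

theorem mk_groupCoord (p : cosetBundle φ) :
    (QuotientGroup.mk (groupCoord p) : G ⧸ H) = φ (baseMap p) := p.2.symm

/-- The point of the coset bundle with given coordinates. -/
def cosetPoint (m : M) (g : G) (h : φ m = (g : G ⧸ H)) : cosetBundle φ := ⟨(m, g), h⟩

theorem cosetBundle_ext {p q : cosetBundle φ} (h1 : baseMap p = baseMap q)
    (h2 : groupCoord p = groupCoord q) : p = q :=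
  Subtype.ext (Prod.ext h1 h2)

theorem baseMap_surjective : Function.Surjective (baseMap (φ := φ)) := fun m =>
  let ⟨g, hg⟩ := QuotientGroup.mk_surjective (φ m)
  ⟨cosetPoint m g hg.symm, rfl⟩

theorem exists_rightAct {p q : cosetBundle φ} (h : baseMap p = baseMap q) :
    ∃ l : H, q = rightAct l p := by
  refine ⟨⟨(groupCoord p)⁻¹ * groupCoord q, ?_⟩, cosetBundle_ext h.symm ?_⟩
  · rw [← QuotientGroup.eq, mk_groupCoord, mk_groupCoord, h]
  · change groupCoord q = groupCoord p * ((groupCoord p)⁻¹ * groupCoord q)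
    group

theorem groupCoord_rightAct (l : H) (p : cosetBundle φ) :
    groupCoord (rightAct l p) = groupCoord p * l := rfl

theorem baseMap_rightAct (l : H) (p : cosetBundle φ) : baseMap (rightAct l p) = baseMap p := rfl

theorem groupCoord_gaugeMap (w : stab 𝔤 EM φ) (p : cosetBundle φ) :
    groupCoord (gaugeMap w p) = w.1 (baseMap p) * groupCoord p := rfl

theorem baseMap_gaugeMap (w : stab 𝔤 EM φ) (p : cosetBundle φ) :
    baseMap (gaugeMap w p) = baseMap p := rfl

section

variable (hP : IsSmoothEmbedding 𝓘(ℝ, EP) (𝓘(ℝ, EM).prod 𝓘(ℝ, 𝔤)) ∞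
    (Subtype.val : cosetBundle φ → M × G))

include hP

theorem smoothAt_baseMap (p : cosetBundle φ) : SmoothAt EP EM (baseMap (φ := φ)) p :=
  smoothAt_fst_of_isSmoothEmbedding hP p

theorem smoothAt_groupCoord (p : cosetBundle φ) : SmoothAt EP 𝔤 (groupCoord (φ := φ)) p :=
  smoothAt_snd_of_isSmoothEmbedding hP p

theorem smoothAt_cosetBundle {f : N → cosetBundle φ} {n : N}
    (h1 : SmoothAt E' EM (fun x => baseMap (f x)) n)
    (h2 : SmoothAt E' 𝔤 (fun x => groupCoord (f x)) n) : SmoothAt E' EP f n :=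
  contMDiffAt_of_isSmoothEmbedding_prod hP h1 h2

theorem smoothAt_rightAct (l : H) (p : cosetBundle φ) : SmoothAt EP EP (rightAct l) p :=
  smoothAt_cosetBundle hP (smoothAt_baseMap hP p)
    ((smoothAt_groupCoord hP p).mul (smoothAt_const _ _))

theorem smoothAt_stab_baseMap (w : stab 𝔤 EM φ) (p : cosetBundle φ) :
    SmoothAt EP 𝔤 (fun p : cosetBundle φ => w.1 (baseMap p)) p :=
  SmoothAt.comp (g := w.1) (w.2.1 _) (smoothAt_baseMap hP p)

theorem smoothAt_gaugeMap (w : stab 𝔤 EM φ) (p : cosetBundle φ) :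
    SmoothAt EP EP (gaugeMap w) p :=
  smoothAt_cosetBundle hP (smoothAt_baseMap hP p)
    ((smoothAt_stab_baseMap hP w p).mul (smoothAt_groupCoord hP p))

variable (hX : IsSubmersion 𝓘(ℝ, 𝔤) 𝓘(ℝ, EX) ∞ (QuotientGroup.mk : G → G ⧸ H))
  (hφ : ∀ m, SmoothAt EM EX φ m)

include hX hφ

theorem hasSections_baseMap : HasSections EP EM (baseMap (φ := φ)) where
  smooth := smoothAt_baseMap hP
  surj := baseMap_surjective
  exists_section p := by
    classical
    obtain ⟨s, hs, hsp, hq⟩ := exists_section_of_isSubmersionAt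
      (hX.isSubmersionAt (groupCoord p))
    rw [mk_groupCoord] at hs hsp hq
    let t : M → cosetBundle φ := fun m =>
      if h : φ m = (s (φ m) : G ⧸ H) then cosetPoint m (s (φ m)) h else p
    have ht : ∀ᶠ m in 𝓝 (baseMap p), φ m = (s (φ m) : G ⧸ H) := by
      filter_upwards [(hφ (baseMap p)).continuousAt.eventually hq] with m hm
      exact hm.symm
    have h1 : ∀ᶠ m in 𝓝 (baseMap p), baseMap (t m) = m := by
      filter_upwards [ht] with m hm
      simp only [t, dif_pos hm]; rfl
    have h2 : ∀ᶠ m in 𝓝 (baseMap p), groupCoord (t m) = s (φ m) := by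
      filter_upwards [ht] with m hm
      simp only [t, dif_pos hm]; rfl
    refine ⟨t, smoothAt_cosetBundle hP ?_ ?_, ?_, h1⟩
    · exact ContMDiffAt.congr_of_eventuallyEq (contMDiffAt_id (n := ∞)) h1
    · exact ContMDiffAt.congr_of_eventuallyEq (SmoothAt.comp (g := s) hs (hφ _)) h2
    · exact cosetBundle_ext h1.self_of_nhds (h2.self_of_nhds.trans hsp)

/-- The chain rule for the square π ∘ g = φ ∘ π₁ on the coset bundle. -/
theorem dmap_mk_groupCoord (p : cosetBundle φ) (v : EP) :
    dmap 𝔤 EX (QuotientGroup.mk : G → G ⧸ H) (groupCoord p) (dmap EP 𝔤 groupCoord p v) =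
      dmap EM EX φ (baseMap p) (dmap EP EM baseMap p v) := by
  rw [← dmap_comp_apply (g := (QuotientGroup.mk : G → G ⧸ H)) (smoothAt_mk hX _)
    (smoothAt_groupCoord hP p), ← dmap_comp_apply (hφ _) (smoothAt_baseMap hP p)]
  congr 2
  funext q
  exact mk_groupCoord q

/-- On vertical vectors `g⁻¹dg` takes values in `𝔥`. -/
theorem logD_groupCoord_mem {p : cosetBundle φ} {v : EP} (hv : dmap EP EM baseMap p v = 0) :
    logD EP 𝔤 groupCoord p v ∈ lieAlgOf (𝔤 := 𝔤) H := by
  rw [← mc_dmap (smoothAt_groupCoord hP p), ← dmap_mk_eq_zero_iff hX,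
    dmap_mk_groupCoord hP hX hφ, hv, map_zero]

variable {ρ : GroupMetric 𝔤 G}

/-- The pullback of the coisotropy form to the coset bundle. -/
theorem coisotropyForm_lin {θ : DForm EX (G ⧸ H) 𝔤 1} (hθ : IsCoisotropyForm ρ θ)
    (p : cosetBundle φ) (v : EP) :
    DForm.lin (E := EM) (pullback (E := EM) φ θ) (baseMap p) (dmap EP EM baseMap p v) =
      Ad (groupCoord p) (logD EP 𝔤 groupCoord p v -
        prOn ρ (lieAlgOf H) (logD EP 𝔤 groupCoord p v)) := by
  rw [pullback_lin, ← dmap_mk_groupCoord hP hX hφ, ← mk_groupCoord p, isCoisotropyForm_iff.1 hθ,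
    mc_dmap (smoothAt_groupCoord hP p)]

end

end CosetBundle

/-! ### Connections, potentials and curvature -/

section Wedge

variable {𝔤 : Type*} [NormedAddCommGroup 𝔤] [NormedSpace ℝ 𝔤] [FiniteDimensional ℝ 𝔤]
  {G : Type*} [TopologicalSpace G] [ChartedSpace 𝔤 G] [Group G] [LieGroup 𝓘(ℝ, 𝔤) ∞ G]
  {E : Type*} [NormedAddCommGroup E] [NormedSpace ℝ E]
  {M : Type*} [TopologicalSpace M] [ChartedSpace E M]

theorem bracketForm_eq (α β : DForm E M 𝔤 1) (m : M) (v : Fin 2 → E) :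
    bracketForm G α β m v =
      lieBr G (α.lin m (v 0)) (β.lin m (v 1)) - lieBr G (α.lin m (v 1)) (β.lin m (v 0)) := by
  simp only [DForm.lin_apply]
  rfl

theorem wedgeSq_eq (α : DForm E M 𝔤 1) (m : M) (v : Fin 2 → E) :
    wedgeSq G α m v = lieBr G (α.lin m (v 0)) (α.lin m (v 1)) := by
  have h := bracketForm_eq (G := G) α α m v
  change (1 / 2 : ℝ) • bracketForm G α α m v = _
  rw [h, lieBr_swap G (α.lin m (v 1)), sub_neg_eq_add, ← two_smul ℝ, smul_smul]
  norm_num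

variable (G) in
/-- The wedge square of a `1`-form, as a form. -/
def sqForm (α : DForm E M 𝔤 1) : DForm E M 𝔤 2 := wedgeForm ((1 / 2 : ℝ) • brL 𝔤 G) α α

theorem sqForm_at (α : DForm E M 𝔤 1) (m : M) (v : Fin 2 → E) :
    (sqForm G α).at m v = lieBr G (α.lin m (v 0)) (α.lin m (v 1)) := by
  rw [sqForm, wedgeForm_at]
  change (1 / 2 : ℝ) • lieBr (𝔤 := 𝔤) G _ _ - (1 / 2 : ℝ) • lieBr (𝔤 := 𝔤) G _ _ = _
  rw [lieBr_swap G (α.lin m (v 1)), smul_neg, sub_neg_eq_add, ← two_smul ℝ, smul_smul]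
  norm_num

variable {ρ : GroupMetric 𝔤 G} {H : Subgroup G}

theorem lieBr_zero_right (ξ : 𝔤) : lieBr G ξ 0 = 0 := (brL 𝔤 G ξ).map_zero

/-- The projection fixes [ξ, η], because it commutes with ad(ξ) and fixes η. -/
theorem lieBr_mem (hρ : IsBiinvariant ρ) {ξ η : 𝔤} (hξ : ξ ∈ lieAlgOf (𝔤 := 𝔤) H)
    (hη : η ∈ lieAlgOf (𝔤 := 𝔤) H) : lieBr G ξ η ∈ lieAlgOf (𝔤 := 𝔤) H := by
  have := prOn_lieBr hρ hξ η
  rw [prOn_of_mem ρ hη] at this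
  rw [← this]
  exact prOn_mem _ _ _

/-- The algebra behind the curvature formula, with a and c the 𝔥- and 𝔥^⊥-parts of g⁻¹dg on two
vectors and β the values of Ad(g⁻¹)b. As pr_𝔥 commutes with ad(𝔥), it kills [a, c] and fixes [a₀,
a₁]; the latter and the terms [a, β] cancel against the expanded square. -/
theorem curvature_identity (hρ : IsBiinvariant ρ) {a₀ a₁ c₀ c₁ : 𝔤} (β₀ β₁ : 𝔤)
    (ha₀ : a₀ ∈ lieAlgOf (𝔤 := 𝔤) H) (ha₁ : a₁ ∈ lieAlgOf (𝔤 := 𝔤) H)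
    (hc₀ : prOn ρ (lieAlgOf H) c₀ = 0) (hc₁ : prOn ρ (lieAlgOf H) c₁ = 0) :
    -(lieBr G (a₀ + c₀) β₁ - lieBr G (a₁ + c₁) β₀) -
        prOn ρ (lieAlgOf H) (lieBr G (a₀ + c₀) (a₁ + c₁)) + lieBr G (β₀ + a₀) (β₁ + a₁) =
      lieBr G β₀ β₁ - (lieBr G β₀ c₁ - lieBr G β₁ c₀) -
        prOn ρ (lieAlgOf H) (lieBr G c₀ c₁) := by
  have h1 : prOn ρ (lieAlgOf H) (lieBr G a₀ a₁) = lieBr G a₀ a₁ := by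
    rw [prOn_lieBr hρ ha₀, prOn_of_mem ρ ha₁]
  have h2 : prOn ρ (lieAlgOf H) (lieBr G a₀ c₁) = 0 := by
    rw [prOn_lieBr hρ ha₀, hc₁, lieBr_zero_right]
  have h3 : prOn ρ (lieAlgOf H) (lieBr G c₀ a₁) = 0 := by
    rw [lieBr_swap, map_neg, prOn_lieBr hρ ha₁, hc₀, lieBr_zero_right, neg_zero]
  simp only [lieBr_add_left, lieBr_add_right, map_add, h1, h2, h3]
  rw [lieBr_swap G β₀ c₁, lieBr_swap G β₁ c₀, lieBr_swap G β₀ a₁]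
  abel

end Wedge

/-! ### Connections and their gauge potentials -/

section Connection

variable {𝔤 : Type*} [NormedAddCommGroup 𝔤] [NormedSpace ℝ 𝔤] [FiniteDimensional ℝ 𝔤]
  {G : Type*} [TopologicalSpace G] [ChartedSpace 𝔤 G] [Group G] [LieGroup 𝓘(ℝ, 𝔤) ∞ G]
  {ρ : GroupMetric 𝔤 G} {H : Subgroup G}
  {EX : Type*} [NormedAddCommGroup EX] [NormedSpace ℝ EX] [FiniteDimensional ℝ EX]
  [ChartedSpace EX (G ⧸ H)] [IsManifold 𝓘(ℝ, EX) ∞ (G ⧸ H)]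
  {EM : Type*} [NormedAddCommGroup EM] [NormedSpace ℝ EM] [FiniteDimensional ℝ EM]
  {M : Type*} [TopologicalSpace M] [ChartedSpace EM M] [IsManifold 𝓘(ℝ, EM) ∞ M]
  {φ : M → G ⧸ H}
  {EP : Type*} [NormedAddCommGroup EP] [NormedSpace ℝ EP] [FiniteDimensional ℝ EP]
  [ChartedSpace EP (cosetBundle φ)] [IsManifold 𝓘(ℝ, EP) ∞ (cosetBundle φ)]

/-- The axioms as statements about linear maps between the model spaces, the form in which all
computations are made. -/
theorem isConnection_iff (hP : IsSmoothEmbedding 𝓘(ℝ, EP) (𝓘(ℝ, EM).prod 𝓘(ℝ, 𝔤)) ∞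
    (Subtype.val : cosetBundle φ → M × G)) {B : DForm EP (cosetBundle φ) 𝔤 1} :
    IsConnection EM B ↔ (∀ p, SmoothFormAt B p) ∧
      (∀ p v, B.lin p v ∈ lieAlgOf (𝔤 := 𝔤) H) ∧
      (∀ p v, dmap EP EM baseMap p v = 0 → B.lin p v = logD EP 𝔤 groupCoord p v) ∧
      ∀ (l : H) p v, B.lin (rightAct l p) (dmap EP EP (rightAct l) p v) =
        Ad (l : G)⁻¹ (B.lin p v) := by
  constructor
  · intro h
    refine ⟨smoothForm_iff.1 h.smooth, fun p v => ?_, fun p v hv => ?_, fun l p v => ?_⟩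
    · rw [DForm.lin_apply]; exact h.mem p ![v]
    · rw [DForm.lin_apply, ← logDeriv_eq (smoothAt_groupCoord hP p)]
      exact h.vertical p v hv
    · have := h.equivariant l p ![v]
      change DForm.at (E := EP) (pullback (E := EP) (rightAct l) B) p ![v] =
        Ad (l : G)⁻¹ (B.at p ![v]) at this
      rwa [← DForm.lin_apply, ← DForm.lin_apply] at this
  · rintro ⟨h1, h2, h3, h4⟩
    refine ⟨smoothForm_iff.2 h1, fun p (v : Fin 1 → EP) => ?_, fun p (v : EP) hv => ?_,
      fun l p (v : Fin 1 → EP) => ?_⟩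
    · change B.at p v ∈ _
      rw [DForm.at_eq_lin]; exact h2 p _
    · have h5 := h3 p v hv
      rw [← logDeriv_eq (smoothAt_groupCoord hP p), DForm.lin_apply] at h5
      exact h5
    · change DForm.at (E := EP) (pullback (E := EP) (rightAct l) B) p v =
        Ad (l : G)⁻¹ (B.at p v)
      rw [DForm.at_eq_lin, DForm.at_eq_lin]
      exact h4 l p _

theorem isPotential_iff (hP : IsSmoothEmbedding 𝓘(ℝ, EP) (𝓘(ℝ, EM).prod 𝓘(ℝ, 𝔤)) ∞
    (Subtype.val : cosetBundle φ → M × G)) {B : DForm EP (cosetBundle φ) 𝔤 1}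
    {b : DForm EM M 𝔤 1} :
    IsPotential ρ B b ↔ (∀ m, SmoothFormAt b m) ∧ ∀ p v,
      b.lin (baseMap p) (dmap EP EM baseMap p v) = Ad (groupCoord p)
        (B.lin p v - prOn ρ (lieAlgOf H) (logD EP 𝔤 groupCoord p v)) := by
  refine and_congr smoothForm_iff (forall_congr' fun p => ?_)
  have h : ∀ v : EP, DForm.lin (E := EP) (pullback (E := EP) baseMap b) p v = Ad (groupCoord p)
        (B.lin p v - prOn ρ (lieAlgOf H) (logD EP 𝔤 groupCoord p v)) ↔
      DForm.at (E := EP) (pullback (E := EP) baseMap b) p ![v] = Ad (groupCoord p)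
        (B.at p ![v] - prOn ρ (lieAlgOf H)
          (CosetGauge.logDeriv (𝔤 := 𝔤) (groupCoord (φ := φ)) p v)) := fun v => by
    rw [logDeriv_eq (smoothAt_groupCoord hP p), DForm.lin_apply, DForm.lin_apply]
  exact (forall_congr' h).symm

/-- The connection with a given potential. -/
def connectionOf (ρ : GroupMetric 𝔤 G) (b : DForm EM M 𝔤 1) : DForm EP (cosetBundle φ) 𝔤 1 :=
  addForm (actForm (fun p => Ad (groupCoord p)⁻¹) (pullback (E := EP) baseMap b))
    (actForm (fun _ => prL ρ (lieAlgOf H)) (logForm groupCoord))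

theorem connectionOf_lin (b : DForm EM M 𝔤 1) (p : cosetBundle φ) (v : EP) :
    (connectionOf ρ b).lin p v = Ad (groupCoord p)⁻¹ (b.lin (baseMap p) (dmap EP EM baseMap p v)) +
      prOn ρ (lieAlgOf H) (logD EP 𝔤 groupCoord p v) := rfl

variable (hP : IsSmoothEmbedding 𝓘(ℝ, EP) (𝓘(ℝ, EM).prod 𝓘(ℝ, 𝔤)) ∞
    (Subtype.val : cosetBundle φ → M × G))

include hP

theorem smoothFormAt_connectionOf {b : DForm EM M 𝔤 1} (hb : ∀ m, SmoothFormAt b m)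
    (p : cosetBundle φ) : SmoothFormAt (connectionOf (EP := EP) ρ b) p :=
  ((hb _).pullback (smoothAt_baseMap hP p)).act
    (SmoothAt.Ad (SmoothAt.inv (smoothAt_groupCoord hP p))) |>.add
    ((smoothFormAt_logForm (smoothAt_groupCoord hP) p).act contMDiffAt_const)

/-- Ad(g) is invertible, so the equation for π₁^*b can be solved for B. This gives at once the
uniqueness of the connection with a given potential. -/
theorem isPotential_iff_eq {B : DForm EP (cosetBundle φ) 𝔤 1} {b : DForm EM M 𝔤 1} :
    IsPotential ρ B b ↔ (∀ m, SmoothFormAt b m) ∧ B = connectionOf ρ b := by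
  rw [isPotential_iff hP]
  refine and_congr_right fun _ => ⟨fun h => DForm.ext_lin fun p v => ?_, ?_⟩
  · rw [connectionOf_lin, h, Ad_inv_Ad, sub_add_cancel]
  · rintro rfl p v
    rw [connectionOf_lin, add_sub_cancel_right, Ad_Ad_inv]

variable (hX : IsSubmersion 𝓘(ℝ, 𝔤) 𝓘(ℝ, EX) ∞ (QuotientGroup.mk : G → G ⧸ H))
  (hφ : ∀ m, SmoothAt EM EX φ m)

include hX hφ

/-- The pulled-back term vanishes on vertical vectors, where g⁻¹dg already lies in 𝔥 and the
projection fixes it. Under right translation both terms pick up Ad(l⁻¹), the second because pr_𝔥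
commutes with Ad(H). -/
theorem isConnection_connectionOf (hρ : IsBiinvariant ρ) {b : DForm EM M 𝔤 1}
    (hb : ∀ m, SmoothFormAt b m) (hbv : ∀ m v, b.lin m v ∈ isotropyAlgebra (𝔤 := 𝔤) H (φ m)) :
    IsConnection EM (connectionOf (EP := EP) (φ := φ) ρ b) := by
  refine (isConnection_iff hP).2 ⟨smoothFormAt_connectionOf hP hb, fun p v => ?_,
    fun p v hv => ?_, fun l p v => ?_⟩
  · rw [connectionOf_lin]
    refine Submodule.add_mem _ ?_ (prOn_mem _ _ _)
    rw [← mem_isotropyAlgebra, mk_groupCoord]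
    exact hbv _ _
  · rw [connectionOf_lin, hv, map_zero, map_zero, zero_add,
      prOn_of_mem ρ (logD_groupCoord_mem hP hX hφ hv)]
  · have h1 := dmap_comp_apply (g := baseMap) (f := rightAct l) (x := p)
      (smoothAt_baseMap hP _) (smoothAt_rightAct hP l p) v
    have h2 := logD_comp (a := groupCoord) (f := rightAct l) (n := p)
      (smoothAt_groupCoord hP _) (smoothAt_rightAct hP l p) v
    have h3 := logD_mul_const (l : G) (smoothAt_groupCoord hP p) v
    change logD EP 𝔤 (fun x => groupCoord x * (l : G)) p v = _ at h2
    change dmap EP EM baseMap p v = _ at h1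
    rw [connectionOf_lin, connectionOf_lin, ← h1, ← h2, h3, map_add, groupCoord_rightAct,
      baseMap_rightAct, mul_inv_rev, Ad_mul_apply, prOn_Ad_of_mem hρ (H.inv_mem l.2)]

theorem exists_isPotential (hρ : IsBiinvariant ρ) {B : DForm EP (cosetBundle φ) 𝔤 1}
    (hB : IsConnection EM B) : ∃ b : DForm EM M 𝔤 1, IsPotential ρ B b := by
  obtain ⟨h1, -, h3, h4⟩ := (isConnection_iff hP).1 hB
  have hq := hasSections_baseMap hP hX hφ
  let β : DForm EP (cosetBundle φ) 𝔤 1 := actForm (fun p => Ad (groupCoord p))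
    (addForm B (actForm (fun _ => -prL ρ (lieAlgOf H)) (logForm groupCoord)))
  have hβv : ∀ p v, β.lin p v =
      Ad (groupCoord p) (B.lin p v - prOn ρ (lieAlgOf H) (logD EP 𝔤 groupCoord p v)) := by
    intro p v
    rw [sub_eq_add_neg]; rfl
  obtain ⟨b, hb, hbv⟩ := hq.exists_descent (β := β)
    (fun p => ((h1 p).add ((smoothFormAt_logForm (smoothAt_groupCoord hP) p).act
      contMDiffAt_const)).act (SmoothAt.Ad (smoothAt_groupCoord hP p))) (by
      intro p p' v v' hpp hvv
      obtain ⟨l, rfl⟩ := exists_rightAct hpp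
      have h5 := dmap_comp_apply (g := baseMap) (f := rightAct l) (x := p)
        (smoothAt_baseMap hP _) (smoothAt_rightAct hP l p) (v 0)
      have h6 := logD_comp (a := groupCoord) (f := rightAct l) (n := p)
        (smoothAt_groupCoord hP _) (smoothAt_rightAct hP l p) (v 0)
      have h7 := logD_mul_const (l : G) (smoothAt_groupCoord hP p) (v 0)
      change logD EP 𝔤 (fun x => groupCoord x * (l : G)) p (v 0) = _ at h6
      change dmap EP EM baseMap p (v 0) = _ at h5
      -- The lifts differ by the right translation and a vertical vector `u`. On `u` both B and the
      -- reference connection equal g⁻¹dg, so their difference vanishes; equivariance takes care of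
      -- the translation.
      obtain ⟨u, hu⟩ : ∃ u, u = v' 0 - dmap EP EP (rightAct l) p (v 0) := ⟨_, rfl⟩
      have hu' : v' 0 = dmap EP EP (rightAct l) p (v 0) + u := by rw [hu]; abel
      have huv : dmap EP EM baseMap (rightAct l p) u = 0 := by
        rw [hu, map_sub, ← h5, ← hvv 0, sub_self]
      rw [DForm.at_eq_lin, DForm.at_eq_lin, hβv, hβv, hu', map_add, map_add, map_add, h4,
        h3 _ u huv, prOn_of_mem ρ (logD_groupCoord_mem hP hX hφ huv), ← h6, h7,
        prOn_Ad_of_mem hρ (H.inv_mem l.2), add_sub_add_right_eq_sub, ← map_sub,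
        groupCoord_rightAct, Ad_mul_apply, Ad_Ad_inv])
  refine ⟨b, (isPotential_iff hP).2 ⟨hb, fun p v => ?_⟩⟩
  have := hbv p ![v]
  rw [DForm.at_eq_lin, DForm.at_eq_lin, hβv] at this
  exact this

theorem existsUnique_isPotential (hρ : IsBiinvariant ρ) {B : DForm EP (cosetBundle φ) 𝔤 1}
    (hB : IsConnection EM B) : ∃! b : DForm EM M 𝔤 1, IsPotential ρ B b := by
  obtain ⟨b, hb⟩ := exists_isPotential hP hX hφ hρ hB
  refine ⟨b, hb, fun b' hb' => (hasSections_baseMap hP hX hφ).form_ext fun p v => ?_⟩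
  rw [DForm.at_eq_lin, DForm.at_eq_lin, ((isPotential_iff hP).1 hb).2,
    ((isPotential_iff hP).1 hb').2]

theorem IsPotential.mem {B : DForm EP (cosetBundle φ) 𝔤 1} (hB : IsConnection EM B)
    {b : DForm EM M 𝔤 1} (hb : IsPotential ρ B b) (m : M) (v : EM) :
    b.lin m v ∈ isotropyAlgebra (𝔤 := 𝔤) H (φ m) := by
  obtain ⟨p, rfl⟩ := baseMap_surjective (φ := φ) m
  obtain ⟨u, rfl⟩ := (hasSections_baseMap hP hX hφ).dmap_surjective p v
  rw [((isPotential_iff hP).1 hb).2, ← mk_groupCoord p]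
  exact Ad_mem_isotropyAlgebra
    (Submodule.sub_mem _ (((isConnection_iff hP).1 hB).2.1 p u) (prOn_mem _ _ _))

end Connection

/-! ### Curvature and curvature potentials -/

section Curvature

variable {𝔤 : Type*} [NormedAddCommGroup 𝔤] [NormedSpace ℝ 𝔤] [FiniteDimensional ℝ 𝔤]
  {G : Type*} [TopologicalSpace G] [ChartedSpace 𝔤 G] [Group G] [LieGroup 𝓘(ℝ, 𝔤) ∞ G]
  {ρ : GroupMetric 𝔤 G} {H : Subgroup G}
  {EX : Type*} [NormedAddCommGroup EX] [NormedSpace ℝ EX] [FiniteDimensional ℝ EX]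
  [ChartedSpace EX (G ⧸ H)] [IsManifold 𝓘(ℝ, EX) ∞ (G ⧸ H)]
  {EM : Type*} [NormedAddCommGroup EM] [NormedSpace ℝ EM] [FiniteDimensional ℝ EM]
  {M : Type*} [TopologicalSpace M] [ChartedSpace EM M] [IsManifold 𝓘(ℝ, EM) ∞ M]
  {φ : M → G ⧸ H}
  {EP : Type*} [NormedAddCommGroup EP] [NormedSpace ℝ EP] [FiniteDimensional ℝ EP]
  [ChartedSpace EP (cosetBundle φ)] [IsManifold 𝓘(ℝ, EP) ∞ (cosetBundle φ)]

/-- The curvature `dB + B ∧ B` as a form. -/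
def curvForm (B : DForm EP (cosetBundle φ) 𝔤 1) : DForm EP (cosetBundle φ) 𝔤 2 :=
  addForm (extD B) (sqForm G B)

theorem curvForm_at (B : DForm EP (cosetBundle φ) 𝔤 1) (p : cosetBundle φ) (v : Fin 2 → EP) :
    (curvForm B).at p v =
      DForm.at (extD B) p v + lieBr G (B.lin p (v 0)) (B.lin p (v 1)) := by
  rw [curvForm, addForm_at, sqForm_at]

theorem curvature_eq (B : DForm EP (cosetBundle φ) 𝔤 1) (p : cosetBundle φ) (v : Fin 2 → EP) :
    curvature B p v = (curvForm B).at p v := by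
  rw [curvForm_at, ← wedgeSq_eq]; rfl

theorem smoothFormAt_curvForm {B : DForm EP (cosetBundle φ) 𝔤 1} (hB : ∀ p, SmoothFormAt B p)
    (p : cosetBundle φ) : SmoothFormAt (curvForm B) p :=
  (SmoothFormAt.extD hB p).add ((hB p).wedge _ (hB p))

theorem isCurvaturePotential_iff {B : DForm EP (cosetBundle φ) 𝔤 1} {F : DForm EM M 𝔤 2} :
    IsCurvaturePotential B F ↔ (∀ m, SmoothFormAt F m) ∧ ∀ p (v : Fin 2 → EP),
      F.at (baseMap p) (fun i => dmap EP EM baseMap p (v i)) =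
        Ad (groupCoord p) ((curvForm B).at p v) := by
  refine and_congr smoothForm_iff (forall_congr' fun p => ?_)
  have h : ∀ v : Fin 2 → EP, F.at (baseMap p) (fun i => dmap EP EM baseMap p (v i)) =
      Ad (groupCoord p) ((curvForm B).at p v) ↔
      F.at (baseMap p) (fun i => dmap EP EM baseMap p (v i)) =
        Ad (groupCoord p) (curvature B p v) := fun v => by rw [curvature_eq]
  exact (forall_congr' h).symm

/-- The constant linear map pr_𝔥 commutes with d, so B = pr_𝔥 B makes dB take values in 𝔥; the
bracket term stays in the subalgebra. -/
theorem curvForm_mem (hρ : IsBiinvariant ρ) {B : DForm EP (cosetBundle φ) 𝔤 1}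
    (hs : ∀ p, SmoothFormAt B p) (hB : ∀ p v, B.lin p v ∈ lieAlgOf (𝔤 := 𝔤) H)
    (p : cosetBundle φ) (v : Fin 2 → EP) : (curvForm B).at p v ∈ lieAlgOf (𝔤 := 𝔤) H := by
  rw [curvForm_at]
  refine Submodule.add_mem _ ?_ (lieBr_mem hρ (hB _ _) (hB _ _))
  have h1 : actForm (fun _ => prL ρ (lieAlgOf H)) B = B :=
    DForm.ext_lin fun p v => prOn_of_mem ρ (hB p v)
  have h2 := extD_actForm (A := fun _ : cosetBundle φ => prL ρ (lieAlgOf H)) (m := p)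
    contMDiffAt_const (hs p) v
  rw [h1, dmap_const, dmap_const, zero_apply, zero_apply, sub_zero, add_zero] at h2
  rw [h2]
  exact prOn_mem _ _ _

/-- The expression of the curvature potential through the potential `b` and the pullback `η` of the
coisotropy form. -/
def curvPotential (ρ : GroupMetric 𝔤 G) (φ : M → G ⧸ H) (b η : DForm EM M 𝔤 1) : DForm EM M 𝔤 2 :=
  addForm (addForm (extD b) (sqForm G b))
    (addForm (actForm (fun _ => -ContinuousLinearMap.id ℝ 𝔤) (wedgeForm (brL 𝔤 G) b η))
      (actForm (fun m => -prL ρ (isotropyAlgebra H (φ m))) (sqForm G η)))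

theorem curvPotential_at (b η : DForm EM M 𝔤 1) (m : M) (v : Fin 2 → EM) :
    (curvPotential ρ φ b η).at m v = DForm.at (extD b) m v +
      lieBr G (b.lin m (v 0)) (b.lin m (v 1)) -
      (lieBr G (b.lin m (v 0)) (η.lin m (v 1)) - lieBr G (b.lin m (v 1)) (η.lin m (v 0))) -
      prOn ρ (isotropyAlgebra H (φ m)) (lieBr G (η.lin m (v 0)) (η.lin m (v 1))) := by
  rw [curvPotential, addForm_at, addForm_at, addForm_at, actForm_at, actForm_at, sqForm_at,
    sqForm_at, sub_sub, sub_eq_add_neg, neg_add]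
  rfl

variable (hP : IsSmoothEmbedding 𝓘(ℝ, EP) (𝓘(ℝ, EM).prod 𝓘(ℝ, 𝔤)) ∞
    (Subtype.val : cosetBundle φ → M × G))

include hP

/-- The Leibniz rule for Ad(g⁻¹)π₁^*b and the Maurer-Cartan equation for pr_𝔥(g⁻¹dg) give dB. Once
Ad(g) is moved through brackets and projections, what remains is `curvature_identity`. -/
theorem Ad_curvForm_connectionOf (hρ : IsBiinvariant ρ) {b η : DForm EM M 𝔤 1}
    (hb : ∀ m, SmoothFormAt b m)
    (hη : ∀ (p : cosetBundle φ) (v : EP), η.lin (baseMap p) (dmap EP EM baseMap p v) =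
      Ad (groupCoord p)
      (logD EP 𝔤 groupCoord p v - prOn ρ (lieAlgOf H) (logD EP 𝔤 groupCoord p v)))
    (p : cosetBundle φ) (v : Fin 2 → EP) :
    Ad (groupCoord p) ((curvForm (connectionOf ρ b)).at p v) =
      (curvPotential ρ φ b η).at (baseMap p) (fun i => dmap EP EM baseMap p (v i)) := by
  have hpb := (hb (baseMap p)).pullback (smoothAt_baseMap hP p)
  have hl := smoothFormAt_logForm (smoothAt_groupCoord hP) p
  have hd : DForm.at (extD (connectionOf (EP := EP) (φ := φ) ρ b)) p v =
      Ad (groupCoord p)⁻¹ (DForm.at (extD b) (baseMap p) (fun i => dmap EP EM baseMap p (v i))) -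
        (lieBr G (logD EP 𝔤 groupCoord p (v 0))
            (Ad (groupCoord p)⁻¹ (b.lin (baseMap p) (dmap EP EM baseMap p (v 1)))) -
          lieBr G (logD EP 𝔤 groupCoord p (v 1))
            (Ad (groupCoord p)⁻¹ (b.lin (baseMap p) (dmap EP EM baseMap p (v 0))))) -
        prOn ρ (lieAlgOf H) (lieBr G (logD EP 𝔤 groupCoord p (v 0))
          (logD EP 𝔤 groupCoord p (v 1))) := by
    rw [connectionOf, extD_addForm (hpb.act (SmoothAt.Ad (SmoothAt.inv (smoothAt_groupCoord hP p))))
      (hl.act contMDiffAt_const), extD_actForm_Ad_inv (smoothAt_groupCoord hP p) hpb,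
      extD_actForm contMDiffAt_const hl, extD_pullback (hb _) (smoothAt_baseMap hP p),
      extD_logForm (smoothAt_groupCoord hP), dmap_const, dmap_const, zero_apply, zero_apply,
      sub_zero, add_zero, map_neg, ← sub_eq_add_neg]
    rfl
  rw [curvForm_at, hd, connectionOf_lin, connectionOf_lin, curvPotential_at, hη, hη]
  obtain ⟨β₀, hβ₀⟩ : ∃ β, b.lin (baseMap p) (dmap EP EM baseMap p (v 0)) =
    Ad (groupCoord p) β := ⟨_, (Ad_Ad_inv (groupCoord p) _).symm⟩
  obtain ⟨β₁, hβ₁⟩ : ∃ β, b.lin (baseMap p) (dmap EP EM baseMap p (v 1)) =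
    Ad (groupCoord p) β := ⟨_, (Ad_Ad_inv (groupCoord p) _).symm⟩
  rw [hβ₀, hβ₁, ← mk_groupCoord p, prOn_isotropyAlgebra hρ]
  simp only [← Ad_lieBr, Ad_inv_Ad]
  set l₀ := logD EP 𝔤 groupCoord p (v 0)
  set l₁ := logD EP 𝔤 groupCoord p (v 1)
  have hc : ∀ l : 𝔤, prOn ρ (lieAlgOf H) (l - prOn ρ (lieAlgOf H) l) = 0 := fun l => by
    rw [map_sub, prOn_of_mem ρ (prOn_mem ρ _ l), sub_self]
  have key := curvature_identity (G := G) (H := H) hρ β₀ β₁ (prOn_mem ρ (lieAlgOf H) l₀)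
    (prOn_mem ρ (lieAlgOf H) l₁) (hc l₀) (hc l₁)
  rw [add_sub_cancel, add_sub_cancel] at key
  have key' := congrArg (Ad (groupCoord p)) key
  simp only [map_add, map_sub, map_neg, Ad_Ad_inv] at key' ⊢
  rw [add_sub_assoc, add_sub_assoc, ← key']
  abel

variable (hX : IsSubmersion 𝓘(ℝ, 𝔤) 𝓘(ℝ, EX) ∞ (QuotientGroup.mk : G → G ⧸ H))
  (hφ : ∀ m, SmoothAt EM EX φ m)

include hX hφ

/-- The curvature potential in terms of the potential. -/
theorem isCurvaturePotential_curvPotential (hρ : IsBiinvariant ρ)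
    {B : DForm EP (cosetBundle φ) 𝔤 1} {b : DForm EM M 𝔤 1} (hb : IsPotential ρ B b)
    {θ : DForm EX (G ⧸ H) 𝔤 1} (hθ : IsCoisotropyForm ρ θ) :
    IsCurvaturePotential B (curvPotential ρ φ b (pullback (E := EM) φ θ)) := by
  obtain ⟨hs, rfl⟩ := (isPotential_iff_eq hP).1 hb
  have h1 := Ad_curvForm_connectionOf hP hρ hs (coisotropyForm_lin hP hX hφ hθ)
  refine isCurvaturePotential_iff.2 ⟨(hasSections_baseMap hP hX hφ).smoothFormAt fun p => ?_,
    fun p v => (h1 p v).symm⟩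
  -- Smoothness is read off upstairs, where the form is Ad(g)(dB + B ∧ B). This avoids proving that
  -- the projection onto the varying subspace 𝔥_{φ(m)} depends smoothly on m.
  have h2 : pullback (E := EP) baseMap (curvPotential ρ φ b (pullback (E := EM) φ θ)) =
      actForm (fun p => Ad (groupCoord p)) (curvForm (connectionOf (EP := EP) ρ b)) :=
    DForm.ext_at fun p v => (h1 p v).symm
  rw [h2]
  exact (smoothFormAt_curvForm (smoothFormAt_connectionOf hP hs) p).act
    (SmoothAt.Ad (smoothAt_groupCoord hP p))

theorem IsCurvaturePotential.unique {B : DForm EP (cosetBundle φ) 𝔤 1} {F F' : DForm EM M 𝔤 2}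
    (hF : IsCurvaturePotential B F) (hF' : IsCurvaturePotential B F') : F = F' :=
  (hasSections_baseMap hP hX hφ).form_ext fun p v => by
    rw [(isCurvaturePotential_iff.1 hF).2, (isCurvaturePotential_iff.1 hF').2]

theorem existsUnique_isCurvaturePotential (hρ : IsBiinvariant ρ)
    {B : DForm EP (cosetBundle φ) 𝔤 1} (hB : IsConnection EM B) :
    ∃! F : DForm EM M 𝔤 2, IsCurvaturePotential B F := by
  obtain ⟨b, hb⟩ := exists_isPotential hP hX hφ hρ hB
  obtain ⟨θ, hθ, -⟩ := existsUnique_coisotropyForm hρ hX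
  have h := isCurvaturePotential_curvPotential hP hX hφ hρ hb hθ.2
  exact ⟨_, h, fun F' hF' => hF'.unique hP hX hφ h⟩

theorem IsCurvaturePotential.mem (hρ : IsBiinvariant ρ) {B : DForm EP (cosetBundle φ) 𝔤 1}
    (hB : IsConnection EM B) {F : DForm EM M 𝔤 2} (hF : IsCurvaturePotential B F) (m : M)
    (v : Fin 2 → EM) : F.at m v ∈ isotropyAlgebra (𝔤 := 𝔤) H (φ m) := by
  obtain ⟨p, rfl⟩ := baseMap_surjective (φ := φ) m
  obtain ⟨u, hu⟩ := (hasSections_baseMap hP hX hφ).exists_lift p v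
  obtain ⟨h1, h2, -⟩ := (isConnection_iff hP).1 hB
  have h3 := (isCurvaturePotential_iff.1 hF).2 p u
  simp only [hu] at h3
  rw [h3, ← mk_groupCoord p]
  exact Ad_mem_isotropyAlgebra (curvForm_mem hρ h1 h2 p u)

end Curvature

/-! ### Gauge transformations of connections -/

section Gauge

variable {𝔤 : Type*} [NormedAddCommGroup 𝔤] [NormedSpace ℝ 𝔤] [FiniteDimensional ℝ 𝔤]
  {G : Type*} [TopologicalSpace G] [ChartedSpace 𝔤 G] [Group G] [LieGroup 𝓘(ℝ, 𝔤) ∞ G]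
  {ρ : GroupMetric 𝔤 G} {H : Subgroup G}
  {EX : Type*} [NormedAddCommGroup EX] [NormedSpace ℝ EX] [FiniteDimensional ℝ EX]
  [ChartedSpace EX (G ⧸ H)] [IsManifold 𝓘(ℝ, EX) ∞ (G ⧸ H)]
  {EM : Type*} [NormedAddCommGroup EM] [NormedSpace ℝ EM] [FiniteDimensional ℝ EM]
  {M : Type*} [TopologicalSpace M] [ChartedSpace EM M] [IsManifold 𝓘(ℝ, EM) ∞ M]
  {φ : M → G ⧸ H}
  {EP : Type*} [NormedAddCommGroup EP] [NormedSpace ℝ EP] [FiniteDimensional ℝ EP]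
  [ChartedSpace EP (cosetBundle φ)] [IsManifold 𝓘(ℝ, EP) ∞ (cosetBundle φ)]

variable (hP : IsSmoothEmbedding 𝓘(ℝ, EP) (𝓘(ℝ, EM).prod 𝓘(ℝ, 𝔤)) ∞
    (Subtype.val : cosetBundle φ → M × G))

include hP

theorem dmap_baseMap_gaugeMap (w : stab 𝔤 EM φ) (p : cosetBundle φ) (v : EP) :
    dmap EP EM baseMap (gaugeMap w p) (dmap EP EP (gaugeMap w) p v) = dmap EP EM baseMap p v :=
  (dmap_comp_apply (g := baseMap) (f := gaugeMap w) (smoothAt_baseMap hP _)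
    (smoothAt_gaugeMap hP w p) v).symm

/-- The group coordinate of f_w is the product w · g, so the product rule for logarithmic
derivatives applies. -/
theorem logD_groupCoord_gaugeMap (w : stab 𝔤 EM φ) (p : cosetBundle φ) (v : EP) :
    logD EP 𝔤 groupCoord (gaugeMap w p) (dmap EP EP (gaugeMap w) p v) =
      Ad (groupCoord p)⁻¹ (logD EM 𝔤 w.1 (baseMap p) (dmap EP EM baseMap p v)) +
        logD EP 𝔤 groupCoord p v := by
  have h1 := logD_comp (a := groupCoord) (f := gaugeMap w) (n := p)
    (smoothAt_groupCoord hP _) (smoothAt_gaugeMap hP w p) v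
  have h2 := logD_mul (smoothAt_stab_baseMap hP w p) (smoothAt_groupCoord hP p) v
  have h3 := logD_comp (a := w.1) (f := baseMap) (n := p) (w.2.1 _) (smoothAt_baseMap hP p) v
  rw [← h1, ← h3]
  exact h2

theorem isConnection_gauge {B : DForm EP (cosetBundle φ) 𝔤 1} (hB : IsConnection EM B)
    (w : stab 𝔤 EM φ) : IsConnection EM (pullback (E := EP) (gaugeMap w) B) := by
  obtain ⟨h1, h2, h3, h4⟩ := (isConnection_iff hP).1 hB
  refine (isConnection_iff hP).2 ⟨fun p => (h1 _).pullback (smoothAt_gaugeMap hP w p),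
    fun p v => h2 _ _, fun p v hv => ?_, fun l p v => ?_⟩
  · rw [pullback_lin, h3 _ _ (by rw [dmap_baseMap_gaugeMap hP, hv]),
      logD_groupCoord_gaugeMap hP, hv, map_zero, map_zero, zero_add]
  · have h5 := dmap_comp_apply (g := gaugeMap w) (f := rightAct l) (x := p)
      (smoothAt_gaugeMap hP w _) (smoothAt_rightAct hP l p) v
    have h6 := dmap_comp_apply (g := rightAct l) (f := gaugeMap w) (x := p)
      (smoothAt_rightAct hP l _) (smoothAt_gaugeMap hP w p) v
    have h7 : ∀ q : cosetBundle φ, gaugeMap w (rightAct l q) = rightAct l (gaugeMap w q) :=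
      fun q => cosetBundle_ext rfl (mul_assoc _ _ _).symm
    rw [pullback_lin, pullback_lin, ← h5, ← h4, ← h6, h7]
    simp only [h7]

/-- Naturality of d and of the bracket under pullback. -/
theorem curvForm_gauge {B : DForm EP (cosetBundle φ) 𝔤 1} (hB : ∀ p, SmoothFormAt B p)
    (w : stab 𝔤 EM φ) (p : cosetBundle φ) (v : Fin 2 → EP) :
    (curvForm (pullback (E := EP) (gaugeMap w) B)).at p v =
      (curvForm B).at (gaugeMap w p) (fun i => dmap EP EP (gaugeMap w) p (v i)) := by
  rw [curvForm_at, curvForm_at, extD_pullback (hB _) (smoothAt_gaugeMap hP w p)]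
  rfl

variable (hX : IsSubmersion 𝓘(ℝ, 𝔤) 𝓘(ℝ, EX) ∞ (QuotientGroup.mk : G → G ⧸ H))
  (hφ : ∀ m, SmoothAt EM EX φ m)

include hX hφ

/-- The gauge action on potentials. -/
theorem potential_gauge {B : DForm EP (cosetBundle φ) 𝔤 1} {θ : DForm EX (G ⧸ H) 𝔤 1}
    (hθ : IsCoisotropyForm ρ θ) (w : stab 𝔤 EM φ) {b bw : DForm EM M 𝔤 1} (hb : IsPotential ρ B b)
    (hbw : IsPotential ρ (pullback (E := EP) (gaugeMap w) B) bw) (m : M) (v : EM) :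
    bw.lin m v = Ad (w.1 m)⁻¹ (b.lin m v) + logD EM 𝔤 w.1 m v -
      (Ad (w.1 m)⁻¹ (DForm.lin (E := EM) (pullback (E := EM) φ θ) m v) -
        DForm.lin (E := EM) (pullback (E := EM) φ θ) m v) := by
  obtain ⟨p, rfl⟩ := baseMap_surjective (φ := φ) m
  obtain ⟨u, rfl⟩ := (hasSections_baseMap hP hX hφ).dmap_surjective p v
  have hη := coisotropyForm_lin hP hX hφ hθ
  have h1 := hη p u
  have h2 := hη (gaugeMap w p) (dmap EP EP (gaugeMap w) p u)
  have h3 := ((isPotential_iff hP).1 hb).2 (gaugeMap w p) (dmap EP EP (gaugeMap w) p u)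
  have h4 := ((isPotential_iff hP).1 hbw).2 p u
  rw [dmap_baseMap_gaugeMap hP, baseMap_gaugeMap, logD_groupCoord_gaugeMap hP,
    groupCoord_gaugeMap, Ad_mul_apply] at h2 h3
  rw [pullback_lin] at h4
  -- Of the two occurrences of φ^*ω^⊥, the one under Ad(w⁻¹) is expressed at f_w(p) and the other at
  -- p. Their difference then supplies exactly the change of pr_𝔥(g⁻¹dg) that separates b^w from
  -- Ad(w⁻¹)b.
  rw [h2, Ad_inv_Ad, ← h2, h1, h3, Ad_inv_Ad, h4]
  simp only [map_add, map_sub, Ad_Ad_inv]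
  abel

/-- Both potentials express the curvature of B at f_w(p); the prefactors Ad(g) and Ad(wg) differ by
Ad(w). -/
theorem curvaturePotential_gauge {B : DForm EP (cosetBundle φ) 𝔤 1}
    (hB : ∀ p, SmoothFormAt B p) (w : stab 𝔤 EM φ)
    {F Fw : DForm EM M 𝔤 2} (hF : IsCurvaturePotential B F)
    (hFw : IsCurvaturePotential (pullback (E := EP) (gaugeMap w) B) Fw) (m : M) (v : Fin 2 → EM) :
    Fw.at m v = Ad (w.1 m)⁻¹ (F.at m v) := by
  obtain ⟨p, rfl⟩ := baseMap_surjective (φ := φ) m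
  obtain ⟨u, hu⟩ := (hasSections_baseMap hP hX hφ).exists_lift p v
  have h1 := (isCurvaturePotential_iff.1 hFw).2 p u
  have h2 := (isCurvaturePotential_iff.1 hF).2 (gaugeMap w p)
    (fun i => dmap EP EP (gaugeMap w) p (u i))
  simp only [dmap_baseMap_gaugeMap hP, hu] at h1 h2
  rw [baseMap_gaugeMap, groupCoord_gaugeMap, Ad_mul_apply] at h2
  rw [h1, h2, Ad_inv_Ad, curvForm_gauge hP hB]

end Gauge

/-! ### The gauge group -/

section GaugeGroup

variable {𝔤 : Type*} [NormedAddCommGroup 𝔤] [NormedSpace ℝ 𝔤] [FiniteDimensional ℝ 𝔤]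
  {G : Type*} [TopologicalSpace G] [ChartedSpace 𝔤 G] [Group G] [LieGroup 𝓘(ℝ, 𝔤) ∞ G]
  {H : Subgroup G}
  {EX : Type*} [NormedAddCommGroup EX] [NormedSpace ℝ EX] [FiniteDimensional ℝ EX]
  [ChartedSpace EX (G ⧸ H)] [IsManifold 𝓘(ℝ, EX) ∞ (G ⧸ H)]
  {EM : Type*} [NormedAddCommGroup EM] [NormedSpace ℝ EM]
  {M : Type*} [TopologicalSpace M] [ChartedSpace EM M]
  {φ : M → G ⧸ H}
  {EP : Type*} [NormedAddCommGroup EP] [NormedSpace ℝ EP]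
  [ChartedSpace EP (cosetBundle φ)]

theorem gaugeMap_one (p : cosetBundle φ) : gaugeMap (1 : stab 𝔤 EM φ) p = p :=
  cosetBundle_ext rfl (one_mul _)

theorem gaugeMap_mul (w w' : stab 𝔤 EM φ) (p : cosetBundle φ) :
    gaugeMap (w * w') p = gaugeMap w (gaugeMap w' p) :=
  cosetBundle_ext rfl (mul_assoc _ _ _)

theorem gaugeMap_rightAct (w : stab 𝔤 EM φ) (l : H) (p : cosetBundle φ) :
    gaugeMap w (rightAct l p) = rightAct l (gaugeMap w p) :=
  cosetBundle_ext rfl (mul_assoc _ _ _).symm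

/-- The gauge transformation `f_w` as a permutation. -/
def gaugePerm (w : stab 𝔤 EM φ) : Equiv.Perm (cosetBundle φ) where
  toFun := gaugeMap w
  invFun := gaugeMap w⁻¹
  left_inv p := by rw [← gaugeMap_mul, inv_mul_cancel, gaugeMap_one]
  right_inv p := by rw [← gaugeMap_mul, mul_inv_cancel, gaugeMap_one]

variable (hP : IsSmoothEmbedding 𝓘(ℝ, EP) (𝓘(ℝ, EM).prod 𝓘(ℝ, 𝔤)) ∞
    (Subtype.val : cosetBundle φ → M × G))

include hP

theorem gaugePerm_mem (w : stab 𝔤 EM φ) : gaugePerm w ∈ gaugeGroup EP φ :=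
  ⟨fun p => smoothAt_gaugeMap hP w p, fun p => smoothAt_gaugeMap hP w⁻¹ p, fun _ => rfl,
    fun l p => gaugeMap_rightAct w l p⟩

variable (hX : IsSubmersion 𝓘(ℝ, 𝔤) 𝓘(ℝ, EX) ∞ (QuotientGroup.mk : G → G ⧸ H))
  (hφ : ∀ m, SmoothAt EM EX φ m)

include hX hφ

/-- The quotient g(f(p)) g(p)⁻¹ is constant on fibres because f commutes with the right action.
Local sections of the coset bundle show that it is smooth in m, and it fixes φ(m) because f covers
the identity. -/
theorem exists_gaugePerm_eq {f : Equiv.Perm (cosetBundle φ)} (hf : f ∈ gaugeGroup EP φ) :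
    ∃ w : stab 𝔤 EM φ, gaugePerm w = f := by
  obtain ⟨hs, -, hb, he⟩ := hf
  choose p hp using baseMap_surjective (φ := φ)
  let w : M → G := fun m => groupCoord (f (p m)) * (groupCoord (p m))⁻¹
  have hw : ∀ q, groupCoord (f q) = w (baseMap q) * groupCoord q := by
    intro q
    obtain ⟨l, hl⟩ := exists_rightAct (hp (baseMap q))
    have h1 : groupCoord (f q) = groupCoord (f (p (baseMap q))) * l := by
      conv_lhs => rw [hl, he, groupCoord_rightAct]
    have h2 : groupCoord q = groupCoord (p (baseMap q)) * l := by
      conv_lhs => rw [hl, groupCoord_rightAct]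
    rw [h1, h2]
    simp only [w]
    group
  have hws : ∀ m, SmoothAt EM 𝔤 w m := by
    intro m
    obtain ⟨s, hsm, hsp, hq⟩ := (hasSections_baseMap hP hX hφ).exists_section (p m)
    rw [hp] at hsm hsp hq
    have h1 : SmoothAt EM 𝔤 (fun x => groupCoord (s x)) m :=
      SmoothAt.comp (g := groupCoord) (smoothAt_groupCoord hP _) hsm
    have h2 : SmoothAt EM 𝔤 (fun x => groupCoord (f (s x))) m :=
      SmoothAt.comp (g := groupCoord) (f := fun x => f (s x)) (smoothAt_groupCoord hP _)
        (SmoothAt.comp (g := f) (hs _) hsm)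
    refine ContMDiffAt.congr_of_eventuallyEq (SmoothAt.mul h2 (SmoothAt.inv h1)) ?_
    filter_upwards [hq] with x hx
    rw [hw, hx, mul_inv_cancel_right]
  refine ⟨⟨w, hws, fun m => ?_⟩, Equiv.ext fun q => cosetBundle_ext (hb q).symm (hw q).symm⟩
  have h1 := mk_groupCoord (f (p m))
  rw [hb, hw, ← mk_groupCoord (p m), hp] at h1
  rw [← hp m, ← mk_groupCoord (p m), hp m]
  exact h1

/-- The stabilizer is isomorphic to the gauge group. -/
theorem exists_gaugeGroup_equiv :
    ∃ Θ : stab 𝔤 EM φ ≃* gaugeGroup EP φ, ∀ w p, (Θ w).1 p = gaugeMap w p := by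
  let T : stab 𝔤 EM φ →* gaugeGroup EP φ :=
    { toFun := fun w => ⟨gaugePerm w, gaugePerm_mem hP w⟩
      map_one' := Subtype.ext (Equiv.ext fun p => gaugeMap_one p)
      map_mul' := fun w w' => Subtype.ext (Equiv.ext fun p => gaugeMap_mul w w' p) }
  have hT : Function.Bijective T := by
    constructor
    · intro w w' h
      refine Subtype.ext (funext fun m => ?_)
      obtain ⟨p, rfl⟩ := baseMap_surjective (φ := φ) m
      have h1 : gaugeMap w p = gaugeMap w' p := congrArg (fun f => f.1 p) h
      have h2 := congrArg groupCoord h1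
      rw [groupCoord_gaugeMap, groupCoord_gaugeMap] at h2
      exact mul_right_cancel h2
    · rintro ⟨f, hf⟩
      obtain ⟨w, hw⟩ := exists_gaugePerm_eq hP hX hφ hf
      exact ⟨w, Subtype.ext hw⟩
  exact ⟨MulEquiv.ofBijective T hT, fun _ _ => rfl⟩

end GaugeGroup

/-! ### Quotient manifolds -/

section QuotientManifold

variable {E : Type*} [NormedAddCommGroup E] [NormedSpace ℝ E] {K : Type*} [TopologicalSpace K]
  {I : ModelWithCorners ℝ E K} [I.Boundaryless]
  {N : Type*} [TopologicalSpace N] [ChartedSpace K N]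
  {E₁ : Type*} [NormedAddCommGroup E₁] [NormedSpace ℝ E₁]
  {A : Type*} [TopologicalSpace A] [ChartedSpace E₁ A]
  {E₂ : Type*} [NormedAddCommGroup E₂] [NormedSpace ℝ E₂]
  {S : Type*} [TopologicalSpace S] [ChartedSpace E₂ S]

/-- Two smooth quotients of a manifold by the same equivalence relation are diffeomorphic. -/
theorem exists_diffeomorph_of_isSubmersion {q : N → A} {f : N → S}
    (hq : IsSubmersion I 𝓘(ℝ, E₁) ∞ q) (hqs : Function.Surjective q)
    (hf : ContMDiff I 𝓘(ℝ, E₂) ∞ f) (h : ∀ a b, q a = q b ↔ f a = f b)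
    (hs : ∀ s, ∃ t : S → N, ContMDiffAt 𝓘(ℝ, E₂) I ∞ t s ∧ ∀ᶠ s' in 𝓝 s, f (t s') = s') :
    ∃ Φ : A ≃ₘ⟮𝓘(ℝ, E₁), 𝓘(ℝ, E₂)⟯ S, ∀ a, Φ (q a) = f a := by
  choose c hc using hqs
  -- The set-theoretic choice `c` is harmless since `f` is constant on the fibres of `q`. Local
  -- sections of `q` give smoothness of `g`, local sections of `f` give smoothness of its inverse.
  let g : A → S := fun x => f (c x)
  have hg : ∀ a, g (q a) = f a := fun a => (h _ _).1 (hc _)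
  have hb : Function.Bijective g := by
    refine ⟨fun x y hxy => ?_, fun s => ?_⟩
    · rw [← hc x, ← hc y]
      exact (h _ _).2 hxy
    · obtain ⟨t, -, ht⟩ := hs s
      exact ⟨q (t s), (hg _).trans ht.self_of_nhds⟩
  let e : A ≃ S := Equiv.ofBijective g hb
  refine ⟨⟨e, fun x => ?_, fun s => ?_⟩, hg⟩
  · obtain ⟨a, rfl⟩ : ∃ a, q a = x := ⟨c x, hc x⟩
    obtain ⟨t, ht, hta, htq⟩ := exists_section_of_isSubmersionAt (hq.isSubmersionAt a)
    have h1 : ContMDiffAt 𝓘(ℝ, E₁) 𝓘(ℝ, E₂) ∞ (fun y => f (t y)) (q a) :=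
      ContMDiffAt.comp (I' := I) (q a) (hf _) ht
    refine h1.congr_of_eventuallyEq ?_
    filter_upwards [htq] with y hy
    change g y = f (t y)
    rw [← hg, hy]
  · obtain ⟨t, ht, hts⟩ := hs s
    have h1 : ContMDiffAt 𝓘(ℝ, E₂) 𝓘(ℝ, E₁) ∞ (fun y => q (t y)) s :=
      ContMDiffAt.comp (I' := I) s hq.contMDiff.contMDiffAt ht
    refine h1.congr_of_eventuallyEq ?_
    filter_upwards [hts] with y hy
    change e.symm y = q (t y)
    rw [Equiv.symm_apply_eq]
    exact hy.symm.trans (hg _).symm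

end QuotientManifold

/-! ### The adjoint bundles -/

section AdjointBundle

variable {𝔤 : Type*} [NormedAddCommGroup 𝔤] [NormedSpace ℝ 𝔤] [FiniteDimensional ℝ 𝔤]
  {G : Type*} [TopologicalSpace G] [ChartedSpace 𝔤 G] [Group G] [LieGroup 𝓘(ℝ, 𝔤) ∞ G]
  {H : Subgroup G}
  {EH : Type*} [NormedAddCommGroup EH] [NormedSpace ℝ EH] [ChartedSpace EH H]
  {EM : Type*} [NormedAddCommGroup EM] [NormedSpace ℝ EM] [FiniteDimensional ℝ EM]
  {M : Type*} [TopologicalSpace M] [ChartedSpace EM M] [IsManifold 𝓘(ℝ, EM) ∞ M]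
  {φ : M → G ⧸ H}
  {EP : Type*} [NormedAddCommGroup EP] [NormedSpace ℝ EP] [FiniteDimensional ℝ EP]
  [ChartedSpace EP (cosetBundle φ)] [IsManifold 𝓘(ℝ, EP) ∞ (cosetBundle φ)]

theorem smul_eq_iff (p : cosetBundle φ) (γ : G) :
    γ • φ (baseMap p) = φ (baseMap p) ↔ (groupCoord p)⁻¹ * γ * groupCoord p ∈ H := by
  rw [← mk_groupCoord p]
  change (QuotientGroup.mk (γ * groupCoord p) : G ⧸ H) = _ ↔ _
  rw [eq_comm, QuotientGroup.eq, mul_assoc]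

theorem conj_mem (p : cosetBundle φ) (l : H) :
    (baseMap p, groupCoord p * l * (groupCoord p)⁻¹) ∈ isotropyGroupBundle φ := by
  have h : (groupCoord p)⁻¹ * (groupCoord p * l * (groupCoord p)⁻¹) * groupCoord p = l := by group
  refine (smul_eq_iff p _).2 ?_
  rw [h]
  exact l.2

theorem Ad_groupCoord_mem_iff (p : cosetBundle φ) (ξ : 𝔤) :
    ξ ∈ isotropyAlgebra (𝔤 := 𝔤) H (φ (baseMap p)) ↔
      Ad (groupCoord p)⁻¹ ξ ∈ lieAlgOf (𝔤 := 𝔤) H := by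
  rw [← mk_groupCoord p]
  exact mem_isotropyAlgebra

theorem Ad_groupCoord_mem (p : cosetBundle φ) (ξ : lieAlgOf (𝔤 := 𝔤) H) :
    (baseMap p, Ad (groupCoord p) (ξ : 𝔤)) ∈ isotropyAlgebraBundle (𝔤 := 𝔤) φ := by
  refine (Ad_groupCoord_mem_iff p _).2 ?_
  rw [Ad_inv_Ad]
  exact ξ.2

/-- The map `(p, l) ↦ (π₁(p), g l g⁻¹)` that induces `Ad(φ^*G) ≅ H_φ`. -/
def conjMap (a : cosetBundle φ × H) : isotropyGroupBundle φ :=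
  ⟨(baseMap a.1, groupCoord a.1 * a.2 * (groupCoord a.1)⁻¹), conj_mem a.1 a.2⟩

/-- The map `(p, ξ) ↦ (π₁(p), Ad(g) ξ)` that induces `Ad_*(φ^*G) ≅ 𝔥_φ`. -/
def AdMap (a : cosetBundle φ × lieAlgOf (𝔤 := 𝔤) H) : isotropyAlgebraBundle (𝔤 := 𝔤) φ :=
  ⟨(baseMap a.1, Ad (groupCoord a.1) (a.2 : 𝔤)), Ad_groupCoord_mem a.1 a.2⟩

/-- Conjugation by g absorbs the change of representative. Conversely, equal images lie over one
base point, so the two points of P differ by some x in H, and cancelling g shows that a single step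
of the relation joins the pairs. -/
theorem AdBundle.mk_eq_iff (a b : cosetBundle φ × H) :
    AdBundle.mk a = AdBundle.mk b ↔ conjMap a = conjMap b := by
  constructor
  · refine fun h => congrArg (Quot.lift conjMap ?_) h
    rintro ⟨p, l⟩ ⟨q, m⟩ ⟨x, hq, hm⟩
    obtain rfl : q = rightAct x p := hq
    obtain rfl : m = x⁻¹ * l * x := hm
    refine Subtype.ext (Prod.ext rfl ?_)
    change groupCoord p * l * (groupCoord p)⁻¹ =
      groupCoord p * x * ((x⁻¹ * l * x : H) : G) * (groupCoord p * x)⁻¹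
    push_cast
    group
  · obtain ⟨p, l⟩ := a
    obtain ⟨q, m⟩ := b
    intro h
    obtain ⟨x, rfl⟩ := exists_rightAct (congrArg (fun s => s.1.1) h : baseMap p = baseMap q)
    refine Quot.sound ⟨x, rfl, Subtype.ext ?_⟩
    have h2 : groupCoord p * l * (groupCoord p)⁻¹ =
      groupCoord p * x * m * (groupCoord p * x)⁻¹ := congrArg (fun s => s.1.2) h
    have h3 : (m : G) = (groupCoord p * x)⁻¹ * (groupCoord p * x * m * (groupCoord p * x)⁻¹) *
      (groupCoord p * x) := by group
    change (m : G) = ((x⁻¹ * l * x : H) : G)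
    rw [h3, ← h2]
    push_cast
    group

theorem AdAlgBundle.mk_eq_iff (a b : cosetBundle φ × lieAlgOf (𝔤 := 𝔤) H) :
    AdAlgBundle.mk a = AdAlgBundle.mk b ↔ AdMap a = AdMap b := by
  constructor
  · refine fun h => congrArg (Quot.lift AdMap ?_) h
    rintro ⟨p, ξ⟩ ⟨q, η⟩ ⟨x, hq, hη⟩
    obtain rfl : q = rightAct x p := hq
    replace hη : (η : 𝔤) = Ad (x : G)⁻¹ (ξ : 𝔤) := hη
    refine Subtype.ext (Prod.ext rfl ?_)
    change Ad (groupCoord p) (ξ : 𝔤) = Ad (groupCoord p * x) (η : 𝔤)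
    rw [Ad_mul_apply, hη, Ad_Ad_inv]
  · obtain ⟨p, ξ⟩ := a
    obtain ⟨q, η⟩ := b
    intro h
    obtain ⟨x, rfl⟩ := exists_rightAct (congrArg (fun s => s.1.1) h : baseMap p = baseMap q)
    refine Quot.sound ⟨x, rfl, ?_⟩
    have h2 : Ad (groupCoord p) (ξ : 𝔤) = Ad (groupCoord p * x) (η : 𝔤) :=
      congrArg (fun s => s.1.2) h
    change (η : 𝔤) = Ad (x : G)⁻¹ (ξ : 𝔤)
    rw [Ad_mul_apply] at h2
    rw [← Ad_inv_Ad (groupCoord p) (ξ : 𝔤), h2, Ad_inv_Ad, Ad_inv_Ad]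

theorem AdBundle.mk_surjective : Function.Surjective (AdBundle.mk (φ := φ)) := Quot.mk_surjective

theorem AdAlgBundle.mk_surjective :
    Function.Surjective (AdAlgBundle.mk (𝔤 := 𝔤) (φ := φ)) := Quot.mk_surjective

variable (hHG : IsSmoothEmbedding 𝓘(ℝ, EH) 𝓘(ℝ, 𝔤) ∞ (Subtype.val : H → G))
  (hP : IsSmoothEmbedding 𝓘(ℝ, EP) (𝓘(ℝ, EM).prod 𝓘(ℝ, 𝔤)) ∞
    (Subtype.val : cosetBundle φ → M × G))
  (hq : HasSections EP EM (baseMap (φ := φ)))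

include hP hq

section Group

variable {EHφ : Type*} [NormedAddCommGroup EHφ] [NormedSpace ℝ EHφ]
  [ChartedSpace EHφ (isotropyGroupBundle φ)]
  (hHφ : IsSmoothEmbedding 𝓘(ℝ, EHφ) (𝓘(ℝ, EM).prod 𝓘(ℝ, 𝔤)) ∞
    (Subtype.val : isotropyGroupBundle φ → M × G))
  {EA : Type*} [NormedAddCommGroup EA] [NormedSpace ℝ EA] [ChartedSpace EA (AdBundle φ)]
  (hA : IsSubmersion (𝓘(ℝ, EP).prod 𝓘(ℝ, EH)) 𝓘(ℝ, EA) ∞ (AdBundle.mk (φ := φ)))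

include hHG hHφ hA

/-- `Ad(φ^*G)` is diffeomorphic to `H_φ`. -/
theorem exists_AdBundle_diffeomorph :
    ∃ Φ : AdBundle φ ≃ₘ⟮𝓘(ℝ, EA), 𝓘(ℝ, EHφ)⟯ isotropyGroupBundle φ,
      ∀ (p : cosetBundle φ) (l : H), (Φ (AdBundle.mk (p, l)) : M × G) =
        (baseMap p, groupCoord p * l * (groupCoord p)⁻¹) := by
  classical
  refine (exists_diffeomorph_of_isSubmersion (f := conjMap (φ := φ)) (E₂ := EHφ) hA
    AdBundle.mk_surjective ?_ AdBundle.mk_eq_iff ?_).imp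
      fun Φ hΦ p l => congrArg Subtype.val (hΦ (p, l))
  · intro a
    have h1 : ContMDiffAt (𝓘(ℝ, EP).prod 𝓘(ℝ, EH)) 𝓘(ℝ, EM) ∞
        (fun x : cosetBundle φ × H => baseMap x.1) a :=
      ContMDiffAt.comp (I' := 𝓘(ℝ, EP)) a (g := baseMap) (f := Prod.fst) (smoothAt_baseMap hP a.1)
        contMDiffAt_fst
    have h2 : ContMDiffAt (𝓘(ℝ, EP).prod 𝓘(ℝ, EH)) 𝓘(ℝ, 𝔤) ∞
        (fun x : cosetBundle φ × H => groupCoord x.1) a :=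
      ContMDiffAt.comp (I' := 𝓘(ℝ, EP)) a (g := groupCoord) (f := Prod.fst)
        (smoothAt_groupCoord hP a.1) contMDiffAt_fst
    have h3 : ContMDiffAt (𝓘(ℝ, EP).prod 𝓘(ℝ, EH)) 𝓘(ℝ, 𝔤) ∞
        (fun x : cosetBundle φ × H => (x.2 : G)) a :=
      ContMDiffAt.comp (I' := 𝓘(ℝ, EH)) a (g := Subtype.val) hHG.contMDiff.contMDiffAt
        contMDiffAt_snd
    exact contMDiffAt_of_isSmoothEmbedding_prod hHφ h1 ((h2.mul h3).mul h2.inv)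
  · intro s
    obtain ⟨p, hp⟩ := baseMap_surjective (φ := φ) s.1.1
    obtain ⟨t, ht, -, htq⟩ := hq.exists_section p
    rw [hp] at ht htq
    have hb : SmoothAt EHφ EM (fun x : isotropyGroupBundle φ => x.1.1) s :=
      smoothAt_fst_of_isSmoothEmbedding hHφ s
    have hts : SmoothAt EHφ EP (fun x : isotropyGroupBundle φ => t x.1.1) s :=
      SmoothAt.comp (g := t) ht hb
    have hgs : SmoothAt EHφ 𝔤 (fun x : isotropyGroupBundle φ => groupCoord (t x.1.1)) s :=
      SmoothAt.comp (g := groupCoord) (smoothAt_groupCoord hP _) hts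
    -- The local inverse is (m, γ) ↦ (t(m), g⁻¹γg), with g the group coordinate of t(m).
    let c : isotropyGroupBundle φ → G := fun x =>
      (groupCoord (t x.1.1))⁻¹ * x.1.2 * groupCoord (t x.1.1)
    have hc : SmoothAt EHφ 𝔤 c s :=
      (hgs.inv.mul (smoothAt_snd_of_isSmoothEmbedding hHφ s)).mul hgs
    have hbt : ∀ᶠ x in 𝓝 s, baseMap (t x.1.1) = x.1.1 := hb.continuousAt.eventually htq
    have hcH : ∀ᶠ x in 𝓝 s, c x ∈ H := by
      filter_upwards [hbt] with x hx
      refine (smul_eq_iff (t x.1.1) _).1 ?_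
      rw [hx]
      exact x.2
    let l : isotropyGroupBundle φ → H := fun x => if h : c x ∈ H then ⟨c x, h⟩ else 1
    have hl : ∀ᶠ x in 𝓝 s, (l x : G) = c x := by
      filter_upwards [hcH] with x hx
      simp only [l, dif_pos hx]
    have hls : SmoothAt EHφ EH l s :=
      smoothAt_of_isSmoothEmbedding hHG (hc.congr_of_eventuallyEq hl)
    refine ⟨fun x => (t x.1.1, l x), hts.prodMk hls, ?_⟩
    filter_upwards [hbt, hl] with x hx hlx
    refine Subtype.ext (Prod.ext hx ?_)
    change groupCoord (t x.1.1) * (l x : G) * (groupCoord (t x.1.1))⁻¹ = x.1.2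
    rw [hlx]
    simp only [c]
    group

end Group

section Algebra

variable {Ehφ : Type*} [NormedAddCommGroup Ehφ] [NormedSpace ℝ Ehφ]
  [ChartedSpace Ehφ (isotropyAlgebraBundle (𝔤 := 𝔤) φ)]
  (hhφ : IsSmoothEmbedding 𝓘(ℝ, Ehφ) (𝓘(ℝ, EM).prod 𝓘(ℝ, 𝔤)) ∞
    (Subtype.val : isotropyAlgebraBundle (𝔤 := 𝔤) φ → M × 𝔤))
  {Ea : Type*} [NormedAddCommGroup Ea] [NormedSpace ℝ Ea]
  [ChartedSpace Ea (AdAlgBundle (𝔤 := 𝔤) φ)]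
  (ha : IsSubmersion (𝓘(ℝ, EP).prod 𝓘(ℝ, lieAlgOf (𝔤 := 𝔤) H)) 𝓘(ℝ, Ea) ∞
    (AdAlgBundle.mk (𝔤 := 𝔤) (φ := φ)))

include hhφ ha

/-- `Ad_*(φ^*G)` is diffeomorphic to `𝔥_φ`. -/
theorem exists_AdAlgBundle_diffeomorph :
    ∃ Ψ : AdAlgBundle (𝔤 := 𝔤) φ ≃ₘ⟮𝓘(ℝ, Ea), 𝓘(ℝ, Ehφ)⟯ isotropyAlgebraBundle (𝔤 := 𝔤) φ,
      ∀ (p : cosetBundle φ) (ξ : lieAlgOf (𝔤 := 𝔤) H),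
        (Ψ (AdAlgBundle.mk (p, ξ)) : M × 𝔤) = (baseMap p, Ad (groupCoord p) (ξ : 𝔤)) := by
  refine (exists_diffeomorph_of_isSubmersion (f := AdMap (𝔤 := 𝔤) (φ := φ)) (E₂ := Ehφ)
    ha AdAlgBundle.mk_surjective ?_ AdAlgBundle.mk_eq_iff ?_).imp
      fun Ψ hΨ p ξ => congrArg Subtype.val (hΨ (p, ξ))
  · intro a
    have h1 : ContMDiffAt (𝓘(ℝ, EP).prod 𝓘(ℝ, lieAlgOf (𝔤 := 𝔤) H)) 𝓘(ℝ, EM) ∞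
        (fun x : cosetBundle φ × lieAlgOf (𝔤 := 𝔤) H => baseMap x.1) a :=
      ContMDiffAt.comp (I' := 𝓘(ℝ, EP)) a (g := baseMap) (f := Prod.fst) (smoothAt_baseMap hP a.1)
        contMDiffAt_fst
    have h2 : ContMDiffAt (𝓘(ℝ, EP).prod 𝓘(ℝ, lieAlgOf (𝔤 := 𝔤) H)) 𝓘(ℝ, 𝔤 →L[ℝ] 𝔤) ∞
        (fun x : cosetBundle φ × lieAlgOf (𝔤 := 𝔤) H => (Ad (groupCoord x.1) : 𝔤 →L[ℝ] 𝔤)) a :=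
      ContMDiffAt.comp (I' := 𝓘(ℝ, EP)) a (smoothAt_groupCoord hP a.1).Ad contMDiffAt_fst
    have h3 : ContMDiffAt (𝓘(ℝ, EP).prod 𝓘(ℝ, lieAlgOf (𝔤 := 𝔤) H)) 𝓘(ℝ, 𝔤) ∞
        (fun x : cosetBundle φ × lieAlgOf (𝔤 := 𝔤) H => (x.2 : 𝔤)) a :=
      ContMDiffAt.comp (I' := 𝓘(ℝ, lieAlgOf (𝔤 := 𝔤) H)) a (g := Subtype.val)
        (lieAlgOf (𝔤 := 𝔤) H).subtypeL.contMDiff.contMDiffAt contMDiffAt_snd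
    exact contMDiffAt_of_isSmoothEmbedding_prod hhφ h1 (h2.clm_apply h3)
  · intro s
    -- A linear retraction onto 𝔥 makes the fibre coordinate Ad(g⁻¹)ξ an 𝔥-valued smooth map; it
    -- changes nothing where this coordinate already lies in 𝔥.
    obtain ⟨π, hπ⟩ := Submodule.ClosedComplemented.of_finiteDimensional (lieAlgOf (𝔤 := 𝔤) H)
    obtain ⟨p, hp⟩ := baseMap_surjective (φ := φ) s.1.1
    obtain ⟨t, ht, -, htq⟩ := hq.exists_section p
    rw [hp] at ht htq
    have hb : SmoothAt Ehφ EM (fun x : isotropyAlgebraBundle (𝔤 := 𝔤) φ => x.1.1) s :=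
      smoothAt_fst_of_isSmoothEmbedding hhφ s
    have hts : SmoothAt Ehφ EP (fun x : isotropyAlgebraBundle (𝔤 := 𝔤) φ => t x.1.1) s :=
      SmoothAt.comp (g := t) ht hb
    have hgs : SmoothAt Ehφ 𝔤
        (fun x : isotropyAlgebraBundle (𝔤 := 𝔤) φ => groupCoord (t x.1.1)) s :=
      SmoothAt.comp (g := groupCoord) (smoothAt_groupCoord hP _) hts
    have hbt : ∀ᶠ x in 𝓝 s, baseMap (t x.1.1) = x.1.1 := hb.continuousAt.eventually htq
    have hc : SmoothAt Ehφ 𝔤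
        (fun x : isotropyAlgebraBundle (𝔤 := 𝔤) φ => Ad (groupCoord (t x.1.1))⁻¹ x.1.2) s :=
      hgs.inv.Ad.clm_apply (smoothAt_snd_of_isSmoothEmbedding hhφ s)
    refine ⟨fun x => (t x.1.1, π (Ad (groupCoord (t x.1.1))⁻¹ x.1.2)),
      hts.prodMk (SmoothAt.comp (g := π) π.contMDiff.contMDiffAt hc), ?_⟩
    filter_upwards [hbt] with x hx
    have hm : Ad (groupCoord (t x.1.1))⁻¹ x.1.2 ∈ lieAlgOf (𝔤 := 𝔤) H := by
      refine (Ad_groupCoord_mem_iff (t x.1.1) _).1 ?_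
      rw [hx]
      exact x.2
    refine Subtype.ext (Prod.ext hx ?_)
    change Ad (groupCoord (t x.1.1)) ((π (Ad (groupCoord (t x.1.1))⁻¹ x.1.2) : lieAlgOf H) : 𝔤) =
      x.1.2
    rw [hπ ⟨_, hm⟩, Ad_Ad_inv]

end Algebra

end AdjointBundle

/-! ### Sections of the adjoint bundle -/

section Sections

variable {𝔤 : Type*} [NormedAddCommGroup 𝔤] [NormedSpace ℝ 𝔤] [FiniteDimensional ℝ 𝔤]
  {G : Type*} [TopologicalSpace G] [ChartedSpace 𝔤 G] [Group G] [LieGroup 𝓘(ℝ, 𝔤) ∞ G]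
  {H : Subgroup G}
  {EM : Type*} [NormedAddCommGroup EM] [NormedSpace ℝ EM]
  {M : Type*} [TopologicalSpace M] [ChartedSpace EM M]
  {φ : M → G ⧸ H}
  {EHφ : Type*} [NormedAddCommGroup EHφ] [NormedSpace ℝ EHφ]
  [ChartedSpace EHφ (isotropyGroupBundle φ)]
  (hHφ : IsSmoothEmbedding 𝓘(ℝ, EHφ) (𝓘(ℝ, EM).prod 𝓘(ℝ, 𝔤)) ∞
    (Subtype.val : isotropyGroupBundle φ → M × G))
  {EA : Type*} [NormedAddCommGroup EA] [NormedSpace ℝ EA] [ChartedSpace EA (AdBundle φ)]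
  {Φ : AdBundle φ ≃ₘ⟮𝓘(ℝ, EA), 𝓘(ℝ, EHφ)⟯ isotropyGroupBundle φ}
  (hΦ : ∀ (p : cosetBundle φ) (l : H), (Φ (AdBundle.mk (p, l)) : M × G) =
    (baseMap p, groupCoord p * l * (groupCoord p)⁻¹))

include hHφ in
theorem existsUnique_section_of_stab (w : stab 𝔤 EM φ) : ∃! σ : M → AdBundle φ,
    ContMDiff 𝓘(ℝ, EM) 𝓘(ℝ, EA) ∞ σ ∧ ∀ m, (Φ (σ m) : M × G) = (m, w.1 m) := by
  refine ⟨fun m => Φ.symm ⟨(m, w.1 m), w.2.2 m⟩, ⟨fun m => ?_, fun m => ?_⟩, fun σ hσ => ?_⟩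
  · have h : SmoothAt EM EHφ (fun m => (⟨(m, w.1 m), w.2.2 m⟩ : isotropyGroupBundle φ)) m :=
      contMDiffAt_of_isSmoothEmbedding_prod hHφ contMDiffAt_id (w.2.1 m)
    exact SmoothAt.comp (g := Φ.symm) (Φ.symm.contMDiff _) h
  · rw [Φ.apply_symm_apply]
  · funext m
    have h := Φ.apply_symm_apply (⟨(m, w.1 m), w.2.2 m⟩ : isotropyGroupBundle φ)
    exact Φ.injective (Subtype.ext ((hσ.2 m).trans (congrArg Subtype.val h).symm))

include hΦ

theorem fst_AdBundle_equiv (x : AdBundle φ) : (Φ x).1.1 = x.proj := by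
  obtain ⟨⟨p, l⟩, rfl⟩ := AdBundle.mk_surjective x
  rw [hΦ]
  rfl

include hHφ in
theorem existsUnique_stab_of_section {σ : M → AdBundle φ}
    (hσ : ContMDiff 𝓘(ℝ, EM) 𝓘(ℝ, EA) ∞ σ) (hσ' : ∀ m, (σ m).proj = m) :
    ∃! w : stab 𝔤 EM φ, ∀ m, (Φ (σ m) : M × G) = (m, w.1 m) := by
  have h1 : ∀ m, (Φ (σ m)).1.1 = m := fun m => (fst_AdBundle_equiv hΦ _).trans (hσ' m)
  refine ⟨⟨fun m => (Φ (σ m)).1.2, fun m => ?_, fun m => ?_⟩, fun m => Prod.ext (h1 m) rfl,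
    fun w hw => Subtype.ext (funext fun m => ?_)⟩
  · exact SmoothAt.comp (g := fun s : isotropyGroupBundle φ => s.1.2)
      (smoothAt_snd_of_isSmoothEmbedding hHφ _)
      (SmoothAt.comp (g := Φ) (Φ.contMDiff _) (hσ m))
  · have h2 : (Φ (σ m)).1.2 • φ (Φ (σ m)).1.1 = φ (Φ (σ m)).1.1 := (Φ (σ m)).2
    rwa [h1] at h2
  · exact (congrArg Prod.snd (hw m)).symm

theorem gaugeMap_eq_rightAct (w : stab 𝔤 EM φ) (p : cosetBundle φ) (l : H)
    (h : (Φ (AdBundle.mk (p, l)) : M × G) = (baseMap p, w.1 (baseMap p))) :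
    gaugeMap w p = rightAct l p := by
  rw [hΦ] at h
  refine cosetBundle_ext rfl ?_
  have h2 : groupCoord p * l * (groupCoord p)⁻¹ = w.1 (baseMap p) := congrArg Prod.snd h
  rw [groupCoord_gaugeMap, groupCoord_rightAct, ← h2]
  group

end Sections

/-! ### Vector fields -/

section VectorField

variable {E : Type*} [NormedAddCommGroup E] [NormedSpace ℝ E] [FiniteDimensional ℝ E]
  {M : Type*} [TopologicalSpace M] [ChartedSpace E M] [IsManifold 𝓘(ℝ, E) ∞ M]
  {V : Type*} [NormedAddCommGroup V] [NormedSpace ℝ V] [FiniteDimensional ℝ V] {k : ℕ}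

/-- The trivialization of the tangent bundle at `m₀` is the differential of the chart at `m₀`. -/
theorem contMDiffAt_vectorField_iff {X : ∀ m : M, TangentSpace 𝓘(ℝ, E) m} {m₀ : M} :
    ContMDiffAt 𝓘(ℝ, E) 𝓘(ℝ, E).tangent ∞ (fun m => (⟨m, X m⟩ : TangentBundle 𝓘(ℝ, E) M)) m₀ ↔
      SmoothAt E E (fun m => dmap E E (extChartAt 𝓘(ℝ, E) m₀) m (X m)) m₀ := by
  have : IsManifold 𝓘(ℝ, E) 1 M := isManifold_one_of_infty
  have : ContMDiffVectorBundle ∞ E (TangentSpace 𝓘(ℝ, E) : M → Type _) 𝓘(ℝ, E) := by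
    have : IsManifold 𝓘(ℝ, E) (∞ + 1) M := inferInstanceAs (IsManifold 𝓘(ℝ, E) ∞ M)
    infer_instance
  refine (Bundle.contMDiffAt_section (F := E) (IB := 𝓘(ℝ, E)) m₀).trans ?_
  have h : (fun m => (trivializationAt E (TangentSpace 𝓘(ℝ, E)) m₀ ⟨m, X m⟩).2) =ᶠ[𝓝 m₀]
      fun m => dmap E E (extChartAt 𝓘(ℝ, E) m₀) m (X m) := by
    filter_upwards [(chartAt E m₀).open_source.mem_nhds (mem_chart_source E m₀)] with m hm
    have h1 := TangentBundle.continuousLinearMapAt_trivializationAt (I := 𝓘(ℝ, E)) (x₀ := m₀) hm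
    have h2 := Bundle.Trivialization.continuousLinearMapAt_apply_of_mem (R := ℝ)
      (trivializationAt E (TangentSpace 𝓘(ℝ, E)) m₀) (b := m) (by simpa using hm) (X m)
    rw [h1] at h2
    exact h2.symm
  exact ⟨fun h' => h'.congr_of_eventuallyEq h.symm, fun h' => h'.congr_of_eventuallyEq h⟩

/-- The coordinate vector fields of a chart are smooth. -/
theorem contMDiffAt_coordinateField {m₀ m₁ : M} (hm : m₁ ∈ (chartAt E m₀).source) (v : E) :
    ContMDiffAt 𝓘(ℝ, E) 𝓘(ℝ, E).tangent ∞ (fun m => (⟨m, dmap E E (extChartAt 𝓘(ℝ, E) m₀).symm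
      (extChartAt 𝓘(ℝ, E) m₀ m) v⟩ : TangentBundle 𝓘(ℝ, E) M)) m₁ := by
  refine contMDiffAt_vectorField_iff.2 ?_
  have hm' : m₁ ∈ (extChartAt 𝓘(ℝ, E) m₀).source := by rwa [extChartAt_source]
  have e : (extChartAt 𝓘(ℝ, E) m₀).symm (extChartAt 𝓘(ℝ, E) m₀ m₁) = m₁ :=
    (extChartAt 𝓘(ℝ, E) m₀).left_inv hm'
  have h1 : ContDiffAt ℝ ∞ (localExpr E E (fun x : M => x) m₀ m₁) (extChartAt 𝓘(ℝ, E) m₀ m₁) :=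
    contDiffAt_localExpr (E' := E) ((extChartAt 𝓘(ℝ, E) m₀).map_source hm') contMDiffAt_id
      (by rw [e]; exact mem_chart_source E m₁)
  have h2 : ContDiffAt ℝ ∞ (fun y => fderiv ℝ (localExpr E E (fun x : M => x) m₀ m₁) y v)
      (extChartAt 𝓘(ℝ, E) m₀ m₁) :=
    (h1.fderiv_right (m := ∞) (by simp)).clm_apply contDiffAt_const
  have h3 := SmoothAt.comp (f := extChartAt 𝓘(ℝ, E) m₀) (smoothAt_iff_contDiffAt.2 h2)
    (smoothAt_chart hm)
  refine h3.congr_of_eventuallyEq ?_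
  filter_upwards [(chartAt E m₀).open_source.mem_nhds hm,
    (chartAt E m₁).open_source.mem_nhds (mem_chart_source E m₁)] with m h4 h5
  have h4' : m ∈ (extChartAt 𝓘(ℝ, E) m₀).source := by rwa [extChartAt_source]
  have e' : (extChartAt 𝓘(ℝ, E) m₀).symm (extChartAt 𝓘(ℝ, E) m₀ m) = m :=
    (extChartAt 𝓘(ℝ, E) m₀).left_inv h4'
  rw [← dmap_eq_fderiv]
  have h6 := dmap_comp_apply (g := extChartAt 𝓘(ℝ, E) m₁) (f := (extChartAt 𝓘(ℝ, E) m₀).symm)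
    (x := extChartAt 𝓘(ℝ, E) m₀ m) (by rw [e']; exact smoothAt_chart h5)
    (smoothAt_chart_symm ((extChartAt 𝓘(ℝ, E) m₀).map_source h4')) v
  rw [e'] at h6
  exact h6.symm

/-- A smooth form takes smooth values on smooth vector fields. -/
theorem SmoothFormAt.apply_vectorField {r : DForm E M V k} {m₀ : M} (hr : SmoothFormAt r m₀)
    {X : Fin k → ∀ m : M, TangentSpace 𝓘(ℝ, E) m}
    (hX : ∀ i, ContMDiffAt 𝓘(ℝ, E) 𝓘(ℝ, E).tangent ∞
      (fun m => (⟨m, X i m⟩ : TangentBundle 𝓘(ℝ, E) M)) m₀) :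
    SmoothAt E V (fun m => r m (fun i => X i m)) m₀ := by
  have h1 := fun i => smoothAt_in_chart (contMDiffAt_vectorField_iff.1 (hX i))
  have h2 := SmoothAt.comp (f := extChartAt 𝓘(ℝ, E) m₀)
    (smoothAt_iff_contDiffAt.2 (contDiffAt_alternating_apply hr h1))
    (smoothAt_chart (mem_chart_source E m₀))
  refine h2.congr_of_eventuallyEq ?_
  filter_upwards [(chartAt E m₀).open_source.mem_nhds (mem_chart_source E m₀)] with m hm
  have e : (extChartAt 𝓘(ℝ, E) m₀).symm (extChartAt 𝓘(ℝ, E) m₀ m) = m :=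
    (extChartAt 𝓘(ℝ, E) m₀).left_inv (by rwa [extChartAt_source])
  have h3 := fun v => DFunLike.congr_fun (dmap_chart_symm_comp hm) v
  rw [formInChart_apply, e]
  change r.at m _ = r.at m _
  congr 1
  funext i
  exact (h3 (X i m)).symm

/-- A form that takes smooth values on smooth vector fields is smooth. -/
theorem isSmoothForm_of_vectorField {r : DForm E M V k}
    (h : ∀ (U : Set M) (X : Fin k → ∀ m : M, TangentSpace 𝓘(ℝ, E) m), IsOpen U →
      (∀ i, ContMDiffOn 𝓘(ℝ, E) 𝓘(ℝ, E).tangent ∞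
        (fun m => (⟨m, X i m⟩ : TangentBundle 𝓘(ℝ, E) M)) U) →
      ∀ m ∈ U, SmoothAt E V (fun m => r m (fun i => X i m)) m) : IsSmoothForm r := by
  refine smoothForm_iff.2 fun m₀ => contDiffAt_alternating_iff.2 fun v => ?_
  -- Evaluated on the coordinate fields of the chart at `m₀`, the form gives its components in that
  -- chart.
  have h1 := smoothAt_in_chart (h (chartAt E m₀).source (fun i m =>
    dmap E E (extChartAt 𝓘(ℝ, E) m₀).symm (extChartAt 𝓘(ℝ, E) m₀ m) (v i))
    (chartAt E m₀).open_source
    (fun i m hm => (contMDiffAt_coordinateField hm (v i)).contMDiffWithinAt) m₀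
    (mem_chart_source E m₀))
  refine h1.congr_of_eventuallyEq ?_
  filter_upwards [(isOpen_target m₀).mem_nhds (center_mem m₀)] with y hy
  rw [formInChart_apply, (extChartAt 𝓘(ℝ, E) m₀).right_inv hy]
  rfl

end VectorField

/-! ### Forms with values in the adjoint bundle -/

section AdForms

variable {𝔤 : Type*} [NormedAddCommGroup 𝔤] [NormedSpace ℝ 𝔤] [FiniteDimensional ℝ 𝔤]
  {G : Type*} [TopologicalSpace G] [ChartedSpace 𝔤 G] [Group G] [LieGroup 𝓘(ℝ, 𝔤) ∞ G]
  {H : Subgroup G}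
  {EM : Type*} [NormedAddCommGroup EM] [NormedSpace ℝ EM] [FiniteDimensional ℝ EM]
  {M : Type*} [TopologicalSpace M] [ChartedSpace EM M] [IsManifold 𝓘(ℝ, EM) ∞ M]
  {φ : M → G ⧸ H}
  {Ehφ : Type*} [NormedAddCommGroup Ehφ] [NormedSpace ℝ Ehφ]
  [ChartedSpace Ehφ (isotropyAlgebraBundle (𝔤 := 𝔤) φ)]
  (hhφ : IsSmoothEmbedding 𝓘(ℝ, Ehφ) (𝓘(ℝ, EM).prod 𝓘(ℝ, 𝔤)) ∞
    (Subtype.val : isotropyAlgebraBundle (𝔤 := 𝔤) φ → M × 𝔤))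
  {Ea : Type*} [NormedAddCommGroup Ea] [NormedSpace ℝ Ea]
  [ChartedSpace Ea (AdAlgBundle (𝔤 := 𝔤) φ)]
  {Ψ : AdAlgBundle (𝔤 := 𝔤) φ ≃ₘ⟮𝓘(ℝ, Ea), 𝓘(ℝ, Ehφ)⟯ isotropyAlgebraBundle (𝔤 := 𝔤) φ}
  (hΨ : ∀ (p : cosetBundle φ) (ξ : lieAlgOf (𝔤 := 𝔤) H),
    (Ψ (AdAlgBundle.mk (p, ξ)) : M × 𝔤) = (baseMap p, Ad (groupCoord p) (ξ : 𝔤)))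
  {k : ℕ}

include hhφ hΨ

/-- A smooth form with values in the adjoint bundle is a smooth `𝔤`-valued form. -/
theorem existsUnique_form_of_isAdForm
    {α : ∀ m : M, (Fin k → TangentSpace 𝓘(ℝ, EM) m) → AdAlgBundle (𝔤 := 𝔤) φ}
    (hα : IsAdForm (EA := Ea) k α) :
    ∃! r : DForm EM M 𝔤 k, IsSmoothForm r ∧ ∀ m v, (Ψ (α m v) : M × 𝔤) = (m, r m v) := by
  have h1 : ∀ m, ∃ R : EM [⋀^Fin k]→L[ℝ] 𝔤, ∀ v : Fin k → EM,
      (Ψ (α m v) : M × 𝔤) = (m, R v) := by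
    intro m
    obtain ⟨p, rfl⟩ := baseMap_surjective (φ := φ) m
    obtain ⟨A, hA⟩ := hα.1 p
    refine ⟨((Ad (groupCoord p) : 𝔤 →L[ℝ] 𝔤).comp
      (lieAlgOf (𝔤 := 𝔤) H).subtypeL).compContinuousAlternatingMap A, fun v => ?_⟩
    exact (congrArg (fun x => (Ψ x).1) (hA v)).trans (hΨ _ _)
  choose R hR using h1
  refine ⟨R, ⟨isSmoothForm_of_vectorField fun U X hU hX m hm => ?_, hR⟩, fun r hr => ?_⟩
  · have h2 : SmoothAt EM Ea (fun m => α m (fun i => X i m)) m :=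
      (hα.2 U X hU hX).contMDiffAt (hU.mem_nhds hm)
    have h3 : SmoothAt EM 𝔤 (fun m => (Ψ (α m (fun i => X i m))).1.2) m :=
      SmoothAt.comp (g := fun s : isotropyAlgebraBundle (𝔤 := 𝔤) φ => s.1.2)
        (smoothAt_snd_of_isSmoothEmbedding hhφ _)
        (SmoothAt.comp (g := Ψ) (Ψ.contMDiff _) h2)
    refine h3.congr_of_eventuallyEq (Filter.Eventually.of_forall fun m => ?_)
    exact (congrArg Prod.snd (hR m _)).symm
  · exact DForm.ext_at fun m v => congrArg Prod.snd ((hr.2 m v).symm.trans (hR m v))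

/-- A smooth `𝔥_φ`-valued form is a smooth form with values in the adjoint bundle. -/
theorem existsUnique_isAdForm {r : DForm EM M 𝔤 k} (hr : IsSmoothForm r)
    (hm : ∀ m v, r m v ∈ isotropyAlgebra H (φ m)) :
    ∃! α : ∀ m : M, (Fin k → TangentSpace 𝓘(ℝ, EM) m) → AdAlgBundle (𝔤 := 𝔤) φ,
      IsAdForm (EA := Ea) k α ∧ ∀ m v, (Ψ (α m v) : M × 𝔤) = (m, r m v) := by
  let α : ∀ m : M, (Fin k → TangentSpace 𝓘(ℝ, EM) m) → AdAlgBundle (𝔤 := 𝔤) φ :=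
    fun m v => Ψ.symm ⟨(m, r m v), hm m v⟩
  have hα : ∀ m v, (Ψ (α m v) : M × 𝔤) = (m, r m v) := fun m v =>
    congrArg Subtype.val (Ψ.apply_symm_apply _)
  refine ⟨α, ⟨⟨fun p => ?_, fun U X hU hX m hmU => ?_⟩, hα⟩, fun α' h' => ?_⟩
  · obtain ⟨π, hπ⟩ := Submodule.ClosedComplemented.of_finiteDimensional (lieAlgOf (𝔤 := 𝔤) H)
    refine ⟨(π.comp (Ad (groupCoord p)⁻¹ : 𝔤 →L[ℝ] 𝔤)).compContinuousAlternatingMap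
      (r (baseMap p)), fun v => Ψ.injective (Subtype.ext ?_)⟩
    refine (hα _ _).trans (Eq.trans ?_ (hΨ _ _).symm)
    have h1 := hπ ⟨_, (Ad_groupCoord_mem_iff p _).1 (hm (baseMap p) v)⟩
    refine Prod.ext rfl ?_
    change r (baseMap p) v =
      Ad (groupCoord p) ((π (Ad (groupCoord p)⁻¹ (r (baseMap p) v)) : lieAlgOf H) : 𝔤)
    rw [h1, Ad_Ad_inv]
  · have h1 : SmoothAt EM 𝔤 (fun m => r m (fun i => X i m)) m :=
      (smoothForm_iff.1 hr m).apply_vectorField fun i => (hX i).contMDiffAt (hU.mem_nhds hmU)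
    have h2 : SmoothAt EM Ehφ (fun m => (⟨(m, r m (fun i => X i m)), hm m _⟩ :
        isotropyAlgebraBundle (𝔤 := 𝔤) φ)) m :=
      contMDiffAt_of_isSmoothEmbedding_prod hhφ contMDiffAt_id h1
    exact (SmoothAt.comp (g := Ψ.symm) (Ψ.symm.contMDiff _) h2).contMDiffWithinAt
  · funext m v
    exact Ψ.injective (Subtype.ext ((h'.2 m v).trans (hα m v).symm))

variable {EP : Type*} [NormedAddCommGroup EP] [NormedSpace ℝ EP]
  [ChartedSpace EP (cosetBundle φ)]

/-- The descent of an `𝔥`-valued form on the coset bundle to a form with values in the adjoint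
bundle, which corresponds to the given `𝔤`-valued form. -/
theorem exists_isDescent {r : DForm EM M 𝔤 k} (hr : IsSmoothForm r)
    (hm : ∀ m v, r m v ∈ isotropyAlgebra H (φ m))
    {R : ∀ p : cosetBundle φ, (Fin k → TangentSpace 𝓘(ℝ, EP) p) → 𝔤}
    (hR : ∀ p v, pullback (E := EP) (baseMap (φ := φ)) r p v = Ad (groupCoord p) (R p v)) :
    ∃ β : ∀ m : M, (Fin k → TangentSpace 𝓘(ℝ, EM) m) → AdAlgBundle (𝔤 := 𝔤) φ,
      IsAdForm (EA := Ea) k β ∧ IsDescent R β ∧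
        ∀ m v, (Ψ (β m v) : M × 𝔤) = (m, r m v) := by
  obtain ⟨β, ⟨h1, h2⟩, -⟩ := existsUnique_isAdForm hhφ hΨ hr hm
  refine ⟨β, h1, fun p v => ?_, h2⟩
  -- That `R` is 𝔥-valued follows from its relation to `r`: Ad(g⁻¹) takes 𝔥_{φ(m)} to 𝔥.
  have h3 : R p v ∈ lieAlgOf (𝔤 := 𝔤) H := by
    rw [← Ad_inv_Ad (groupCoord p) (R p v), ← hR]
    exact (Ad_groupCoord_mem_iff p _).1 (hm _ _)
  refine ⟨⟨R p v, h3⟩, rfl, Ψ.injective (Subtype.ext ?_)⟩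
  refine (h2 _ _).trans (Eq.trans ?_ (hΨ _ _).symm)
  exact Prod.ext rfl (hR p v)

end AdForms

end

end CosetGauge

/-- `G` is a Lie group with a bi-invariant metric `ρ`, `H` a closed subgroup, `X = G/H`, and
`φ : M → X` a smooth map.  The spaces below carry their standard smooth structures, which are
uniquely determined: `H`, `φ^*G`, `H_φ`, `𝔥_φ` are embedded submanifolds of `G`, `M × G`, `M × G`,
`M × 𝔤`, and `G/H`, `Ad(φ^*G)`, `Ad_*(φ^*G)` are quotient manifolds of `G`, `φ^*G × H`,
`φ^*G × 𝔥`, i.e. the quotient maps are submersions. -/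
theorem theorem2p1
    {𝔤 : Type*} [NormedAddCommGroup 𝔤] [NormedSpace ℝ 𝔤] [FiniteDimensional ℝ 𝔤]
    {G : Type*} [TopologicalSpace G] [ChartedSpace 𝔤 G] [Group G] [LieGroup 𝓘(ℝ, 𝔤) ∞ G]
    (ρ : GroupMetric 𝔤 G) (hρ : IsBiinvariant ρ)
    (H : Subgroup G) (hH : IsClosed (H : Set G))
    {EH : Type*} [NormedAddCommGroup EH] [NormedSpace ℝ EH] [FiniteDimensional ℝ EH]
    [ChartedSpace EH H] [IsManifold 𝓘(ℝ, EH) ∞ H]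
    (hHG : IsSmoothEmbedding 𝓘(ℝ, EH) 𝓘(ℝ, 𝔤) ∞ (Subtype.val : H → G))
    {EX : Type*} [NormedAddCommGroup EX] [NormedSpace ℝ EX] [FiniteDimensional ℝ EX]
    [ChartedSpace EX (G ⧸ H)] [IsManifold 𝓘(ℝ, EX) ∞ (G ⧸ H)]
    (hX : IsSubmersion 𝓘(ℝ, 𝔤) 𝓘(ℝ, EX) ∞ (QuotientGroup.mk : G → G ⧸ H))
    {EM : Type*} [NormedAddCommGroup EM] [NormedSpace ℝ EM] [FiniteDimensional ℝ EM]
    {M : Type*} [TopologicalSpace M] [ChartedSpace EM M] [IsManifold 𝓘(ℝ, EM) ∞ M]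
    (φ : M → G ⧸ H) (hφ : ContMDiff 𝓘(ℝ, EM) 𝓘(ℝ, EX) ∞ φ)
    {EP : Type*} [NormedAddCommGroup EP] [NormedSpace ℝ EP] [FiniteDimensional ℝ EP]
    [ChartedSpace EP (cosetBundle φ)]
    [IsManifold 𝓘(ℝ, EP) ∞ (cosetBundle φ)]
    (hP : IsSmoothEmbedding 𝓘(ℝ, EP) (𝓘(ℝ, EM).prod 𝓘(ℝ, 𝔤)) ∞
      (Subtype.val : cosetBundle φ → M × G))
    {EHφ : Type*} [NormedAddCommGroup EHφ] [NormedSpace ℝ EHφ] [FiniteDimensional ℝ EHφ]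
    [ChartedSpace EHφ (isotropyGroupBundle φ)]
    [IsManifold 𝓘(ℝ, EHφ) ∞ (isotropyGroupBundle φ)]
    (hHφ : IsSmoothEmbedding 𝓘(ℝ, EHφ) (𝓘(ℝ, EM).prod 𝓘(ℝ, 𝔤)) ∞
      (Subtype.val : isotropyGroupBundle φ → M × G))
    {Ehφ : Type*} [NormedAddCommGroup Ehφ] [NormedSpace ℝ Ehφ] [FiniteDimensional ℝ Ehφ]
    [ChartedSpace Ehφ (isotropyAlgebraBundle (𝔤 := 𝔤) φ)]
    [IsManifold 𝓘(ℝ, Ehφ) ∞ (isotropyAlgebraBundle (𝔤 := 𝔤) φ)]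
    (hhφ : IsSmoothEmbedding 𝓘(ℝ, Ehφ) (𝓘(ℝ, EM).prod 𝓘(ℝ, 𝔤)) ∞
      (Subtype.val : isotropyAlgebraBundle (𝔤 := 𝔤) φ → M × 𝔤))
    {EA : Type*} [NormedAddCommGroup EA] [NormedSpace ℝ EA] [FiniteDimensional ℝ EA]
    [ChartedSpace EA (AdBundle φ)] [IsManifold 𝓘(ℝ, EA) ∞ (AdBundle φ)]
    (hA : IsSubmersion (𝓘(ℝ, EP).prod 𝓘(ℝ, EH)) 𝓘(ℝ, EA) ∞
      (AdBundle.mk (φ := φ)))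
    {Ea : Type*} [NormedAddCommGroup Ea] [NormedSpace ℝ Ea] [FiniteDimensional ℝ Ea]
    [ChartedSpace Ea (AdAlgBundle (𝔤 := 𝔤) φ)]
    [IsManifold 𝓘(ℝ, Ea) ∞ (AdAlgBundle (𝔤 := 𝔤) φ)]
    (ha : IsSubmersion (𝓘(ℝ, EP).prod 𝓘(ℝ, lieAlgOf (𝔤 := 𝔤) H)) 𝓘(ℝ, Ea) ∞
      (AdAlgBundle.mk (𝔤 := 𝔤) (φ := φ))) :
    -- the coisotropy form is well defined and smooth
    (∃! θ : DForm EX (G ⧸ H) 𝔤 1,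
      IsSmoothForm θ ∧ IsCoisotropyForm ρ θ) ∧
    -- `Ad(φ^*G) ≅ H_φ`, sections of `Ad(φ^*G)` correspond to elements of `Stab_φ`
    (∃ Φ : AdBundle φ ≃ₘ⟮𝓘(ℝ, EA), 𝓘(ℝ, EHφ)⟯ isotropyGroupBundle φ,
      (∀ (p : cosetBundle φ) (l : H), (Φ (AdBundle.mk (p, l)) : M × G) =
        (baseMap p, groupCoord p * l * (groupCoord p)⁻¹)) ∧
      (∀ w : stab 𝔤 EM φ, ∃! σ : M → AdBundle φ,
        ContMDiff 𝓘(ℝ, EM) 𝓘(ℝ, EA) ∞ σ ∧ ∀ m, (Φ (σ m) : M × G) = (m, w.1 m)) ∧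
      (∀ σ : M → AdBundle φ, ContMDiff 𝓘(ℝ, EM) 𝓘(ℝ, EA) ∞ σ →
        (∀ m, (σ m).proj = m) →
        ∃! w : stab 𝔤 EM φ, ∀ m, (Φ (σ m) : M × G) = (m, w.1 m)) ∧
      -- the gauge transformation `p ↦ p l`, `σ = [p, l]`, given by the section `σ` is `f_w`
      (∀ (w : stab 𝔤 EM φ) (p : cosetBundle φ) (l : H),
        (Φ (AdBundle.mk (p, l)) : M × G) =
          (baseMap p, w.1 (baseMap p)) →
        gaugeMap w p = rightAct l p)) ∧
    -- the gauge group is isomorphic to `Stab_φ`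
    (∃ Θ : stab 𝔤 EM φ ≃* gaugeGroup EP φ,
      ∀ w p, (Θ w).1 p = gaugeMap w p) ∧
    -- `Ad_*(φ^*G) ≅ 𝔥_φ`, with the induced isomorphism on forms; twisted potentials and curvatures
    -- correspond to the untwisted ones
    (∃ Ψ : AdAlgBundle (𝔤 := 𝔤) φ ≃ₘ⟮𝓘(ℝ, Ea), 𝓘(ℝ, Ehφ)⟯
        isotropyAlgebraBundle (𝔤 := 𝔤) φ,
      (∀ (p : cosetBundle φ) (ξ : lieAlgOf (𝔤 := 𝔤) H),
        (Ψ (AdAlgBundle.mk (p, ξ)) : M × 𝔤) =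
          (baseMap p, Ad (groupCoord p) (ξ : 𝔤))) ∧
      (∀ (k : ℕ) (α : ∀ m : M, (Fin k → TangentSpace 𝓘(ℝ, EM) m) →
          AdAlgBundle (𝔤 := 𝔤) φ), IsAdForm (EA := Ea) k α →
        ∃! r : DForm EM M 𝔤 k, IsSmoothForm r ∧
          ∀ m v, (Ψ (α m v) : M × 𝔤) = (m, r m v)) ∧
      (∀ (k : ℕ) (r : DForm EM M 𝔤 k), IsSmoothForm r →
        (∀ m v, r m v ∈ isotropyAlgebra H (φ m)) →
        ∃! α : ∀ m : M, (Fin k → TangentSpace 𝓘(ℝ, EM) m) →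
            AdAlgBundle (𝔤 := 𝔤) φ,
          IsAdForm (EA := Ea) k α ∧ ∀ m v, (Ψ (α m v) : M × 𝔤) = (m, r m v)) ∧
      (∀ (B : DForm EP (cosetBundle φ) 𝔤 1), IsConnection EM B →
        (∃! β : ∀ m : M, (Fin 1 → TangentSpace 𝓘(ℝ, EM) m) →
            AdAlgBundle (𝔤 := 𝔤) φ, IsAdForm (EA := Ea) 1 β ∧
          IsDescent (EM := EM) (fun p v => B p v - refConnection ρ p (v 0)) β ∧
          ∀ b : DForm EM M 𝔤 1, IsPotential ρ B b →
            ∀ m v, (Ψ (β m v) : M × 𝔤) = (m, b m v)) ∧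
        (∃! β : ∀ m : M, (Fin 2 → TangentSpace 𝓘(ℝ, EM) m) →
            AdAlgBundle (𝔤 := 𝔤) φ, IsAdForm (EA := Ea) 2 β ∧
          IsDescent (EM := EM) (fun p v => curvature B p v) β ∧
          ∀ F : DForm EM M 𝔤 2, IsCurvaturePotential B F →
            ∀ m v, (Ψ (β m v) : M × 𝔤) = (m, F m v)))) ∧
    -- the `𝔥_φ`-valued `1`-forms are the potentials of connections
    (∀ b : DForm EM M 𝔤 1, IsSmoothForm b →
      (∀ m v, b m v ∈ isotropyAlgebra H (φ m)) →
      ∃! B : DForm EP (cosetBundle φ) 𝔤 1,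
        IsConnection EM B ∧ IsPotential ρ B b) ∧
    -- every connection has a potential and a curvature potential, and these are `𝔥_φ`-valued
    (∀ B : DForm EP (cosetBundle φ) 𝔤 1, IsConnection EM B →
      (∃! b : DForm EM M 𝔤 1, IsPotential ρ B b) ∧
      (∀ b : DForm EM M 𝔤 1, IsPotential ρ B b →
        ∀ m v, b m v ∈ isotropyAlgebra H (φ m)) ∧
      (∃! F : DForm EM M 𝔤 2, IsCurvaturePotential B F) ∧
      (∀ F : DForm EM M 𝔤 2, IsCurvaturePotential B F →
        ∀ m v, F m v ∈ isotropyAlgebra H (φ m))) ∧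
    ∀ θ : DForm EX (G ⧸ H) 𝔤 1, IsCoisotropyForm ρ θ →
    ∀ B : DForm EP (cosetBundle φ) 𝔤 1, IsConnection EM B →
      -- the curvature `F(b)`
      (∀ (b : DForm EM M 𝔤 1) (F : DForm EM M 𝔤 2),
        IsPotential ρ B b → IsCurvaturePotential B F →
        ∀ m v, F m v = extD b m v + wedgeSq G b m v -
          bracketForm G b (pullback (E := EM) φ θ) m v -
          prOn ρ (isotropyAlgebra H (φ m))
            (wedgeSq G (pullback (E := EM) φ θ) m v)) ∧
      ∀ w : stab 𝔤 EM φ,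
        IsConnection EM (pullback (E := EP) (gaugeMap w) B) ∧
        -- the gauge action `b^w`
        (∀ b bw : DForm EM M 𝔤 1, IsPotential ρ B b →
          IsPotential ρ (pullback (E := EP) (gaugeMap w) B) bw →
          ∀ (m : M) (v : TangentSpace 𝓘(ℝ, EM) m),
            bw m ![v] = Ad (w.1 m)⁻¹ (b m ![v]) + logDeriv w.1 m v -
              (Ad (w.1 m)⁻¹ (pullback (E := EM) φ θ m ![v]) -
                pullback (E := EM) φ θ m ![v])) ∧
        -- the curvature transforms as `F(b^w) = Ad_*(w⁻¹) F(b)`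
        (∀ F Fw : DForm EM M 𝔤 2, IsCurvaturePotential B F →
          IsCurvaturePotential (pullback (E := EP) (gaugeMap w) B) Fw →
          ∀ m v, Fw m v = Ad (w.1 m)⁻¹ (F m v)) := by
  have hφ' : ∀ m, SmoothAt EM EX φ m := fun m => hφ m
  have hq := hasSections_baseMap hP hX hφ'
  obtain ⟨Φ, hΦ⟩ := exists_AdBundle_diffeomorph hHG hP hq hHφ hA
  obtain ⟨Ψ, hΨ⟩ := exists_AdAlgBundle_diffeomorph hP hq hhφ ha
  refine ⟨existsUnique_coisotropyForm hρ hX,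
    ⟨Φ, hΦ, existsUnique_section_of_stab hHφ,
      fun σ hσ hσ' => existsUnique_stab_of_section hHφ hΦ hσ hσ', gaugeMap_eq_rightAct hΦ⟩,
    exists_gaugeGroup_equiv hP hX hφ',
    ⟨Ψ, hΨ, fun k α hα => existsUnique_form_of_isAdForm hhφ hΨ hα,
      fun k r hr hm => existsUnique_isAdForm hhφ hΨ hr hm, fun B hB => ⟨?_, ?_⟩⟩,
    fun b hb hbv => ?_, fun B hB => ⟨existsUnique_isPotential hP hX hφ' hρ hB,
      fun b hb m v => ?_, existsUnique_isCurvaturePotential hP hX hφ' hρ hB,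
      fun F hF m v => hF.mem hP hX hφ' hρ hB m v⟩,
    fun θ hθ B hB => ⟨fun b F hb hF m v => ?_, fun w => ⟨isConnection_gauge hP hB w,
      fun b bw hb hbw m v => ?_,
      fun F Fw hF hFw m v => curvaturePotential_gauge hP hX hφ' (smoothForm_iff.1 hB.smooth) w
        hF hFw m v⟩⟩⟩
  · obtain ⟨b, hb, hbu⟩ := existsUnique_isPotential hP hX hφ' hρ hB
    have hbm : ∀ m (v : Fin 1 → EM), b.at m v ∈ isotropyAlgebra (𝔤 := 𝔤) H (φ m) := fun m v => by
      rw [b.at_eq_lin]; exact hb.mem hP hX hφ' hB m _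
    obtain ⟨β, h1, h2, h3⟩ := exists_isDescent hhφ hΨ hb.1 hbm
      (R := fun p (v : Fin 1 → TangentSpace 𝓘(ℝ, EP) p) => B p v - refConnection ρ p (v 0))
      (fun p v => by
        have h := hb.2 p (v 0)
        have hv : v = ![v 0] := by funext i; fin_cases i; rfl
        rw [hv]
        exact h)
    refine ⟨β, ⟨h1, h2, fun b' hb' => by rw [hbu b' hb']; exact h3⟩, fun β' h' => ?_⟩
    funext m v
    -- The correspondence with the potential `b` already determines the twisted form.
    exact Ψ.injective (Subtype.ext ((h'.2.2 b hb m v).trans (h3 m v).symm))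
  · obtain ⟨F, hF, hFu⟩ := existsUnique_isCurvaturePotential hP hX hφ' hρ hB
    obtain ⟨β, h1, h2, h3⟩ := exists_isDescent hhφ hΨ hF.1
      (fun m v => hF.mem hP hX hφ' hρ hB m v) hF.2
    refine ⟨β, ⟨h1, h2, fun F' hF' => by rw [hFu F' hF']; exact h3⟩, fun β' h' => ?_⟩
    funext m v
    exact Ψ.injective (Subtype.ext ((h'.2.2 F hF m v).trans (h3 m v).symm))
  · have hb' := smoothForm_iff.1 hb
    have hbv' : ∀ m v, b.lin m v ∈ isotropyAlgebra (𝔤 := 𝔤) H (φ m) := fun m v => by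
      rw [b.lin_apply]; exact hbv m _
    exact ⟨connectionOf ρ b, ⟨isConnection_connectionOf hP hX hφ' hρ hb' hbv',
      (isPotential_iff_eq hP).2 ⟨hb', rfl⟩⟩, fun B hB => ((isPotential_iff_eq hP).1 hB.2).2⟩
  · have hbm : ∀ v : Fin 1 → EM, b.at m v ∈ isotropyAlgebra (𝔤 := 𝔤) H (φ m) := fun v => by
      rw [b.at_eq_lin]; exact hb.mem hP hX hφ' hB m _
    exact hbm v
  · rw [hF.unique hP hX hφ' (isCurvaturePotential_curvPotential hP hX hφ' hρ hb hθ)]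
    have h := curvPotential_at (ρ := ρ) (φ := φ) b (pullback (E := EM) φ θ) m v
    rw [← wedgeSq_eq b m v, ← wedgeSq_eq (pullback (E := EM) φ θ) m v,
      ← bracketForm_eq b (pullback (E := EM) φ θ) m v] at h
    exact h
  · have h : ∀ u : EM, bw.lin m u = Ad (w.1 m)⁻¹ (b.lin m u) + CosetGauge.logDeriv w.1 m u -
        (Ad (w.1 m)⁻¹ (DForm.lin (E := EM) (pullback (E := EM) φ θ) m u) -
          DForm.lin (E := EM) (pullback (E := EM) φ θ) m u) := fun u =>
      (potential_gauge hP hX hφ' hθ w hb hbw m u).trans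
        (by rw [logDeriv_eq (w.2.1 m) u])
    simp only [DForm.lin_apply] at h
    exact h v
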